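/- **Corollary (Powers of Hamilton cycles in jumbled graphs).** An $n$-vertex graph $G$ is called $(p,b)$-jumbled if $$\bigl|e(A,B)-p|A||B|\bigr|\le b\sqrt{|A||B|}$$ for all disjoint $A,B\subseteq V(G)$, where $e(A,B)$ is the number of edges of $G$ with one endvertex in $A$ and the other in $B$. The $k$th power of a graph $H$ is the graph on $V(H)$ in which two distinct vertices are adjacent if and only if their distance in $H$ is at most $k$; the square is the second power. A graph on $n\ge 3$ vertices contains the $k$th power of a Hamilton cycle if it has a (not necessarily induced) subgraph isomorphic to the $k$th power of the cycle on $n$ vertices. For every integer $k\ge 2$ and every real $\beta>0$ there is an $\varepsilon>0$ such that the following holds for every real $p$ with $0<p<1$, every integer $n\ge 3$, and every graph $G$ on $n$ vertices with minimum degree $\delta(G)\ge\beta pn$. (a) If $G$ is $(p,\varepsilon p^{5/2}n)$-jumbled, then $G$ contains the square of a Hamilton cycle. (b) If $G$ is $(p,\varepsilon p^{3k/2}n)$-jumbled, then $G$ contains the $k$th power of a Hamilton cycle. -/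

import Mathlib

/-- The `k`th power of a graph `H`: distinct vertices are adjacent iff their distance in `H` is at
most `k`. The extended distance is used, so vertices in different components of `H` are at
distance `⊤` and stay non-adjacent. -/
def graphPower {W : Type*} (H : SimpleGraph W) (k : ℕ) : SimpleGraph W where
  Adj u v := u ≠ v ∧ H.edist u v ≤ (k : ℕ∞)
  symm := ⟨fun u v h => ⟨h.1.symm, by rw [SimpleGraph.edist_comm]; exact h.2⟩⟩
  loopless := ⟨fun _ h => h.1 rfl⟩

/-- A graph is `(p, b)`-jumbled if `|e(A, B) - p |A| |B|| ≤ b √(|A| |B|)` for all disjoint vertex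
sets `A` and `B`. (For disjoint `A`, `B` the finset `G.interedges A B` of pairs `(x, y)` with
`x ∈ A`, `y ∈ B`, `x` adjacent to `y`, has one element for each edge between `A` and `B`.) -/
def IsJumbled {V : Type*} (G : SimpleGraph V) [DecidableRel G.Adj] (p b : ℝ) : Prop :=
  ∀ A B : Finset V, Disjoint A B →
    |((G.interedges A B).card : ℝ) - p * A.card * B.card| ≤
      b * Real.sqrt ((A.card : ℝ) * B.card)

/-- `G` contains the `k`th power of a Hamilton cycle: `G` has at least three vertices, and has a
(not necessarily induced) subgraph isomorphic to the `k`th power of the cycle on as many vertices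
as `G`. -/
def ContainsHamiltonCyclePower {V : Type*} [Fintype V] (G : SimpleGraph V) (k : ℕ) : Prop :=
  3 ≤ Fintype.card V ∧
    (graphPower (SimpleGraph.cycleGraph (Fintype.card V)) k).IsContained G

-- The proof is by absorption. Squared jumbledness gives `Psr`, with error `γ p^(τ+2) n² |A||B|`;
-- the exponent 5/2 corresponds to `τ = 3`, the exponent 3k/2 to `τ = 3k - 2`. Nearly everything is
-- drawn from one budget rule (`Psr.low_filter`, and `Psr.low_filter'` for sets that may overlap):
-- if `|A| ≥ c p^a n` and `a + b ≤ τ`, then all but a tiny multiple of `p^b n` vertices have at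
-- least half the expected number of neighbours in `A`. Each embedding is designed so that the
-- exponents of any two sets that interact add up to at most `τ`.
--
-- A path power is flexible (`Flex`) if any subset of a reservoir `R` can be deleted from it without
-- changing its first and last `k` vertices. An end is extendable (`Extd`) into `U` if the common
-- neighbourhoods in `U` of its last vertices have the expected order of magnitude. Two local
-- statements carry the argument. `HasConnections`: two extendable ends can be joined through `L`
-- prescribed disjoint sets, one vertex in each. `HasGadgets`: there are bounded flexible paths that
-- can drop one vertex of a given linear-size set.
--
-- For connections one shows that from an end most cliques in fresh sets are reached (`HasReach`),
-- in the sense of the nested quantifier `Most`. Reaching more than half of the cliques from both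
-- sides gives a common clique, once `Most` is known not to depend on the order of the sets
-- (`exists_most_reverse`). For `τ ≥ 3k - 2` reachability follows by replacing the sets of the
-- clique one at a time. For `k = 2`, `τ = 3` this is one factor `p` too expensive, and a count of
-- triangles with one vertex in a sparse set replaces it (`exists_card_unreached_le`,
-- `hasReach_two`). For `k ≥ 3` a gadget is a path in the neighbourhood of a vertex, with that
-- vertex put into its middle or not. For `k = 2` the neighbourhood is too sparse, and the gadget is
-- a pair of connected blocks that can be traversed in either order (`Flex.of_gadget`,
-- `hasGadgets_two`).
--
-- Globally, linearly many gadgets are chained into an absorber whose reservoir has linear size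
-- (`exists_absorbing_chain`). The chain is prolonged until only a small set is left over
-- (`exists_covering_chain`). The leftover vertices are covered by a second path through reservoir
-- vertices, and the two paths are closed to a cycle, the absorber dropping the reservoir vertices
-- used twice (`exists_finish`, `exists_close`). Minimum degree is what lets the few vertices that
-- look atypical be covered first.

universe u

section HamPow
open Classical Finset

/-! ### Pseudorandomness and vertices of low degree -/

section

/-- The neighbours of `v` in `A`. -/
noncomputable def nb {V : Type u} (G : SimpleGraph V) (A : Finset V) (v : V) : Finset V :=
  A.filter (fun w => G.Adj v w)

/-- The number of vertices, as a real number. -/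
noncomputable abbrev order (V : Type u) [Fintype V] : ℝ := (Fintype.card V : ℝ)

/-- Quantitative pseudorandomness: the squared form of jumbledness with error parameter `γ`,
together with a lower bound on the size of typical common neighbourhoods of `k` vertices. -/
structure Psr {V : Type u} [Fintype V] (G : SimpleGraph V) (k τ : ℕ) (p γ : ℝ) : Prop where
  p_pos : 0 < p
  p_le : p ≤ 1
  big : 1 ≤ γ * (p ^ k * order V)
  jum : ∀ A B : Finset V, Disjoint A B →
    ((∑ a ∈ A, ((nb G B a).card : ℝ)) - p * A.card * B.card) ^ 2 ≤
      γ * p ^ (τ + 2) * order V ^ 2 * (A.card * B.card)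

variable {V : Type u} {G : SimpleGraph V}

theorem mem_nb {A : Finset V} {v w : V} : w ∈ nb G A v ↔ w ∈ A ∧ G.Adj v w := by
  simp [nb]

theorem nb_subset (A : Finset V) (v : V) : nb G A v ⊆ A := filter_subset _ _

theorem nb_mono {A B : Finset V} (h : A ⊆ B) (v : V) : nb G A v ⊆ nb G B v :=
  filter_subset_filter _ h

theorem nb_comm (A : Finset V) (v w : V) : nb G (nb G A v) w = nb G (nb G A w) v := by
  ext x; simp [mem_nb]; tauto

theorem sum_nb_comm (A B : Finset V) :
    ∑ a ∈ A, ((nb G B a).card : ℝ) = ∑ b ∈ B, ((nb G A b).card : ℝ) := by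
  simp only [nb, card_filter, Nat.cast_sum]
  rw [sum_comm]
  refine sum_congr rfl fun b _ => sum_congr rfl fun a _ => ?_
  simp [G.adj_comm]

/-- The vertices adjacent to all members of `l` in `A`. -/
noncomputable def cnb (G : SimpleGraph V) (A : Finset V) (l : List V) : Finset V :=
  A.filter (fun w => ∀ v ∈ l, G.Adj v w)

theorem mem_cnb {A : Finset V} {l : List V} {w : V} :
    w ∈ cnb G A l ↔ w ∈ A ∧ ∀ v ∈ l, G.Adj v w := by
  simp [cnb]

theorem cnb_nil (A : Finset V) : cnb G A [] = A := by ext; simp [mem_cnb]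

theorem cnb_cons (A : Finset V) (v : V) (l : List V) :
    cnb G A (v :: l) = nb G (cnb G A l) v := by
  ext; simp [mem_cnb, mem_nb]; tauto

theorem cnb_subset (A : Finset V) (l : List V) : cnb G A l ⊆ A := filter_subset _ _

variable [Fintype V] {k τ : ℕ} {p γ : ℝ}

theorem Psr.mono (h : Psr G k τ p γ) {γ' : ℝ} (hγ : γ ≤ γ') : Psr G k τ p γ' where
  p_pos := h.p_pos
  p_le := h.p_le
  big := h.big.trans (by have := h.p_pos; gcongr)
  jum A B hAB := (h.jum A B hAB).trans (by have := h.p_pos; gcongr)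

theorem Psr.order_pos (h : Psr G k τ p γ) : 0 < order V := by
  rcases (Nat.cast_nonneg (Fintype.card V) : (0:ℝ) ≤ order V).lt_or_eq with h0 | h0
  · exact h0
  · have := h.big
    rw [order, ← h0] at this
    norm_num at this

theorem Psr.gamma_pos (h : Psr G k τ p γ) : 0 < γ := by
  have h1 := h.big
  have h2 : 0 < p ^ k * order V := mul_pos (pow_pos h.p_pos _) h.order_pos
  by_contra hc
  nlinarith

theorem Psr.pow_pos (h : Psr G k τ p γ) (m : ℕ) : 0 < p ^ m := _root_.pow_pos h.p_pos m

theorem Psr.pow_le (h : Psr G k τ p γ) {a b : ℕ} (hab : a ≤ b) : p ^ b ≤ p ^ a :=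
  pow_le_pow_of_le_one h.p_pos.le h.p_le hab

theorem Psr.pow_mul_pos (h : Psr G k τ p γ) (m : ℕ) : 0 < p ^ m * order V :=
  mul_pos (h.pow_pos m) h.order_pos

theorem Psr.le_pow_order (h : Psr G k τ p γ) {D : ℝ} (hD : γ * D ≤ 1) {m : ℕ} (hm : m ≤ k) :
    D ≤ p ^ m * order V := by
  have h1 := h.big
  have h2 := h.gamma_pos
  have h3 : p ^ k * order V ≤ p ^ m * order V :=
    mul_le_mul_of_nonneg_right (h.pow_le hm) h.order_pos.le
  have : γ * D ≤ γ * (p ^ k * order V) := hD.trans h1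
  exact (le_of_mul_le_mul_left this h2).trans h3

/-- Disjoint sets with an edge count deviating by a `δ` proportion are small. -/
theorem Psr.mul_card_le (h : Psr G k τ p γ) {A B : Finset V} (hAB : Disjoint A B) {δ : ℝ}
    (hδ : 0 ≤ δ)
    (hdev : δ * (p * A.card * B.card) ≤ |(∑ a ∈ A, ((nb G B a).card : ℝ)) - p * A.card * B.card|) :
    δ ^ 2 * (A.card * B.card) ≤ γ * p ^ τ * order V ^ 2 := by
  have h1 := h.jum A B hAB
  have hp := h.p_pos
  rw [← sq_abs] at h1
  set x : ℝ := (A.card : ℝ) * B.card with hx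
  have hx0 : 0 ≤ x := by positivity
  have h2 : (δ * (p * x)) ^ 2 ≤ γ * p ^ (τ + 2) * order V ^ 2 * x := by
    refine le_trans ?_ h1
    apply pow_le_pow_left₀ (by positivity)
    simpa only [mul_assoc, hx] using hdev
  rcases hx0.eq_or_lt with h0 | h0
  · rw [← h0]
    have := h.gamma_pos
    simp; positivity
  · have h3 : (δ ^ 2 * x) * (p ^ 2 * x) ≤ (γ * p ^ τ * order V ^ 2) * (p ^ 2 * x) := by
      calc _ = (δ * (p * x)) ^ 2 := by ring
        _ ≤ _ := h2
        _ = _ := by ring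
    exact le_of_mul_le_mul_right h3 (by positivity)

/-- Summing the degree bounds over `B` makes the edge count fall short of `p|A||B|` by the
proportion `δ`, so `Psr.mul_card_le` applies. -/
theorem Psr.low_card (h : Psr G k τ p γ) {A B : Finset V} (hAB : Disjoint A B) {δ : ℝ}
    (hδ : 0 ≤ δ) (hB : ∀ v ∈ B, ((nb G A v).card : ℝ) ≤ (1 - δ) * (p * A.card)) :
    δ ^ 2 * (A.card * B.card) ≤ γ * p ^ τ * order V ^ 2 := by
  apply h.mul_card_le hAB hδ
  rw [sum_nb_comm]
  have : ∑ b ∈ B, ((nb G A b).card : ℝ) ≤ B.card * ((1 - δ) * (p * A.card)) := by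
    rw [← nsmul_eq_mul]
    exact sum_le_card_nsmul _ _ _ hB
  rw [abs_sub_comm]
  refine le_trans ?_ (le_abs_self _)
  nlinarith

/-- The low degree bound for sets that need not be disjoint. -/
theorem Psr.low_card' (h : Psr G k τ p γ) {A B : Finset V}
    (hA : 1024 * (γ * p ^ τ * order V ^ 2) < (A.card : ℝ) ^ 2) (hA8 : 8 ≤ A.card)
    (hB : ∀ v ∈ B, ((nb G A v).card : ℝ) ≤ p / 2 * A.card) :
    (A.card * B.card : ℝ) ≤ 64 * (γ * p ^ τ * order V ^ 2) := by
  have hp := h.p_pos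
  -- A part `D` of `B` inside `A` is tested against `A \ D`, which keeps three quarters of `A`;
  -- since `p/2 = (2/3)(3/4)p`, the degrees are still deficient by the proportion 1/3.
  have key : ∀ D ⊆ B, D ⊆ A → 4 * D.card ≤ A.card →
      (A.card * D.card : ℝ) ≤ 16 * (γ * p ^ τ * order V ^ 2) := by
    intro D hDB hDA hD
    have hc : ((A \ D).card : ℝ) = A.card - D.card := by
      rw [card_sdiff_of_subset hDA, Nat.cast_sub (card_le_card hDA)]
    have hD' : (4 * D.card : ℝ) ≤ A.card := by exact_mod_cast hD
    have h1 := h.low_card (A := A \ D) (B := D) sdiff_disjoint (δ := 1/3) (by norm_num)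
      (fun v hv => by
        have h2 := hB v (hDB hv)
        have h3 : ((nb G (A \ D) v).card : ℝ) ≤ (nb G A v).card := by
          exact_mod_cast card_le_card (nb_mono sdiff_subset v)
        rw [hc]
        nlinarith)
    rw [hc] at h1
    have h0 : (0:ℝ) ≤ D.card := by positivity
    nlinarith [mul_nonneg h0 (sub_nonneg.2 hD')]
  have h1 : (A.card * (B \ A).card : ℝ) ≤ 4 * (γ * p ^ τ * order V ^ 2) := by
    have := h.low_card (A := A) (B := B \ A) disjoint_sdiff (δ := 1/2) (by norm_num)
      (fun v hv => by
        have := hB v (mem_sdiff.1 hv).1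
        linarith)
    linarith
  have h2 : (A.card * (B ∩ A).card : ℝ) ≤ 16 * (γ * p ^ τ * order V ^ 2) := by
    by_cases hs : 4 * (B ∩ A).card ≤ A.card
    · exact key _ inter_subset_left inter_subset_right hs
    · exfalso
      -- If `B ∩ A` exceeded a quarter of `A`, a subset of about that size would give `|A|² ≤ 128 γ
      -- p^τ n²`, against the lower bound assumed for `|A|`.
      obtain ⟨D, hD, hDc⟩ := exists_subset_card_eq (s := B ∩ A) (n := A.card / 4) (by omega)
      have h3 := key D (hD.trans inter_subset_left) (hD.trans inter_subset_right) (by omega)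
      have h4 : (A.card : ℝ) ≤ 8 * D.card := by
        have : A.card ≤ 8 * D.card := by omega
        exact_mod_cast this
      nlinarith [(Nat.cast_nonneg A.card : (0:ℝ) ≤ A.card)]
  have h3 : (B.card : ℝ) = (B \ A).card + (B ∩ A).card := by
    rw [← Nat.cast_add, card_sdiff_add_card_inter]
  have h4 : (0:ℝ) ≤ γ * p ^ τ * order V ^ 2 := by
    have := h.gamma_pos; positivity
  rw [h3]; nlinarith

/-- Few vertices of `B` have few neighbours in `A`: the form used for embedding. -/
theorem Psr.low_filter (h : Psr G k τ p γ) {A B : Finset V} {c δ : ℝ} {a b : ℕ} (hc : 0 < c)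
    (hδ : 0 < δ) (hA : c * (p ^ a * order V) ≤ A.card) (hab : a + b ≤ τ) {θ : ℝ}
    (hθ : γ ≤ δ ^ 2 * c * θ) (hAB : Disjoint A B)
    (hB : ∀ v ∈ B, ((nb G A v).card : ℝ) ≤ (1 - δ) * (p * A.card)) :
    (B.card : ℝ) ≤ θ * (p ^ b * order V) := by
  have h1 := h.low_card hAB hδ.le hB
  have hn := h.order_pos
  have hg := h.gamma_pos
  have hpa := h.pow_mul_pos a
  have hpb := h.pow_mul_pos b
  have h2 : p ^ τ ≤ p ^ a * p ^ b := by rw [← pow_add]; exact h.pow_le hab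
  have h3 : δ ^ 2 * (c * (p ^ a * order V) * B.card) ≤
      δ ^ 2 * c * θ * (p ^ a * order V * (p ^ b * order V)) := by
    calc δ ^ 2 * (c * (p ^ a * order V) * B.card) ≤ δ ^ 2 * (A.card * B.card) := by gcongr
      _ ≤ γ * p ^ τ * order V ^ 2 := h1
      _ ≤ γ * (p ^ a * p ^ b) * order V ^ 2 := by gcongr
      _ = γ * (p ^ a * order V * (p ^ b * order V)) := by ring
      _ ≤ _ := by gcongr
  have h4 : (δ ^ 2 * c * (p ^ a * order V)) * B.card ≤
      (δ ^ 2 * c * (p ^ a * order V)) * (θ * (p ^ b * order V)) := by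
    linarith
  exact le_of_mul_le_mul_left h4 (by positivity)

theorem Psr.empty_filter (h : Psr G k τ p γ) {A B : Finset V} {c : ℝ} {a b : ℕ} (hc : 0 < c)
    (hA : c * (p ^ a * order V) ≤ A.card) (hab : a + b ≤ τ) {θ : ℝ}
    (hθ : γ ≤ c * θ) (hAB : Disjoint A B) (hB : ∀ v ∈ B, nb G A v = ∅) :
    (B.card : ℝ) ≤ θ * (p ^ b * order V) :=
  h.low_filter hc one_pos hA hab (by simpa using hθ) hAB (fun v hv => by simp [hB v hv])

/-- The version of `Psr.low_filter` for large sets that need not be disjoint. -/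
theorem Psr.low_filter' (h : Psr G k τ p γ) {A B : Finset V} {c : ℝ} {a b : ℕ} (hc : 0 < c)
    (hA : c * (p ^ a * order V) ≤ A.card) (hab : a + b ≤ τ) (haa : 2 * a ≤ τ) (hak : a ≤ k) {θ : ℝ}
    (hθ : 64 * γ ≤ c * θ) (hγ : 1024 * γ < c ^ 2) (hγ' : 8 * γ ≤ c)
    (hB : ∀ v ∈ B, ((nb G A v).card : ℝ) ≤ p / 2 * A.card) :
    (B.card : ℝ) ≤ θ * (p ^ b * order V) := by
  have hn := h.order_pos
  have hg := h.gamma_pos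
  have hpa := h.pow_mul_pos a
  have hpb := h.pow_mul_pos b
  have h2 : p ^ τ ≤ p ^ a * p ^ b := by rw [← pow_add]; exact h.pow_le hab
  -- `2a ≤ τ` makes `|A|²` exceed `1024 γ p^τ n²`, as `Psr.low_card'` demands; `a ≤ k` is for `8 ≤
  -- |A|`.
  have h2' : p ^ τ ≤ p ^ a * p ^ a := by rw [← pow_add]; exact h.pow_le (by omega)
  have h1 := h.low_card' (A := A) (B := B) (by
      calc 1024 * (γ * p ^ τ * order V ^ 2) ≤ 1024 * (γ * (p ^ a * p ^ a) * order V ^ 2) := by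
            gcongr
        _ = 1024 * γ * (p ^ a * order V) ^ 2 := by ring
        _ < c ^ 2 * (p ^ a * order V) ^ 2 := by gcongr
        _ = (c * (p ^ a * order V)) ^ 2 := by ring
        _ ≤ _ := by gcongr) (by
      have : (8:ℝ) ≤ A.card := by
        refine le_trans ?_ hA
        have := h.le_pow_order (D := 1 / γ) (by field_simp; rfl) hak
        calc (8:ℝ) = 8 * γ * (1 / γ) := by field_simp
          _ ≤ c * (p ^ a * order V) := by gcongr
      exact_mod_cast this) hB
  have h3 : (c * (p ^ a * order V)) * B.card ≤
      (c * (p ^ a * order V)) * (θ * (p ^ b * order V)) := by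
    calc (c * (p ^ a * order V)) * B.card ≤ A.card * B.card := by gcongr
      _ ≤ 64 * (γ * p ^ τ * order V ^ 2) := h1
      _ ≤ 64 * (γ * (p ^ a * p ^ b) * order V ^ 2) := by gcongr
      _ = 64 * γ * (p ^ a * order V * (p ^ b * order V)) := by ring
      _ ≤ c * θ * (p ^ a * order V * (p ^ b * order V)) := by gcongr
      _ = _ := by ring
  exact le_of_mul_le_mul_left h3 (by positivity)

end

/-! ### Greedy embedding with candidate sets -/

section

variable {V : Type u} {G : SimpleGraph V}

/-- The number of indices below `i` that are related to `j`. -/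
noncomputable def backDeg {ι : Type*} (adj : ℕ → ι → Prop) (i : ℕ) (j : ι) : ℕ :=
  ((range i).filter (fun l => adj l j)).card

/-- The candidates for `j` after the first `i` vertices have been embedded by `z`. -/
noncomputable def cand {ι : Type*} (G : SimpleGraph V) (adj : ℕ → ι → Prop) (A : ι → Finset V)
    (z : ℕ → V) (i : ℕ) (j : ι) : Finset V :=
  (A j).filter (fun v => ∀ l < i, adj l j → G.Adj (z l) v)

theorem mem_cand {ι : Type*} {adj : ℕ → ι → Prop} {A : ι → Finset V} {z : ℕ → V} {i : ℕ} {j : ι}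
    {v : V} : v ∈ cand G adj A z i j ↔ v ∈ A j ∧ ∀ l < i, adj l j → G.Adj (z l) v := by
  simp [cand]

theorem backDeg_succ {ι : Type*} (adj : ℕ → ι → Prop) (i : ℕ) (j : ι) :
    backDeg adj (i + 1) j = backDeg adj i j + if adj i j then 1 else 0 := by
  unfold backDeg
  rw [range_add_one, filter_insert]
  split_ifs with h
  · rw [card_insert_of_notMem (by simp)]
  · rfl

theorem cand_succ {ι : Type*} (adj : ℕ → ι → Prop) (A : ι → Finset V) (z : ℕ → V) (i : ℕ)
    (j : ι) : cand G adj A z (i + 1) j =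
      if adj i j then nb G (cand G adj A z i j) (z i) else cand G adj A z i j := by
  split_ifs with h
  · ext v
    simp only [cand, mem_filter, mem_nb, Nat.lt_succ_iff_lt_or_eq, or_imp, forall_and,
      forall_eq, and_assoc]
    tauto
  · ext v
    simp only [cand, mem_filter, Nat.lt_succ_iff_lt_or_eq, or_imp, forall_and, forall_eq]
    tauto

theorem cand_congr {ι : Type*} (adj : ℕ → ι → Prop) (A : ι → Finset V) {z z' : ℕ → V} {i : ℕ}
    (h : ∀ l < i, z l = z' l) (j : ι) : cand G adj A z i j = cand G adj A z' i j := by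
  ext v
  simp only [cand, mem_filter]
  refine and_congr_right fun _ => forall_congr' fun l => forall_congr' fun hl => ?_
  rw [h l hl]

theorem cand_subset {ι : Type*} (adj : ℕ → ι → Prop) (A : ι → Finset V) (z : ℕ → V) (i : ℕ)
    (j : ι) : cand G adj A z i j ⊆ A j := filter_subset _ _

/-- Greedy embedding: vertices `0, …, N - 1` are embedded in turn, `i` into the candidate set of
the index `o i`, so that all candidate sets stay as large as expected up to a constant. -/
theorem greedy_embedding (k τ N M : ℕ) {c : ℝ} (hc : 0 < c) :
    ∃ γ : ℝ, 0 < γ ∧ ∀ (V : Type u) [Fintype V] (G : SimpleGraph V) (p : ℝ), Psr G k τ p γ →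
      ∀ (ι : Type u) (J : Finset ι) (o : ℕ → ι) (adj : ℕ → ι → Prop) (A : ι → Finset V)
        (e : ι → ℕ), J.card ≤ M → (∀ i < N, o i ∈ J) →
        (∀ j ∈ J, c * (p ^ e j * order V) ≤ (A j).card) →
        (∀ i < N, ∀ j ∈ J, adj i j →
          (e (o i) + backDeg adj i (o i)) + (e j + backDeg adj i j) ≤ τ ∧
          (Disjoint (A (o i)) (A j) ∨
            (2 * (e j + backDeg adj i j) ≤ τ ∧ e j + backDeg adj i j ≤ k))) →
        ∃ z : ℕ → V, (∀ i < N, z i ∈ cand G adj A z i (o i)) ∧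
          ∀ j ∈ J, c / 2 ^ N * (p ^ (e j + backDeg adj N j) * order V) ≤
            (cand G adj A z N j).card := by
  set c' : ℝ := c / 2 ^ N with hc'
  have hc'0 : 0 < c' := by positivity
  -- Each embedded vertex at worst halves a constant, so `c'` is the worst one that occurs. At most
  -- `M` bad sets arise per step, and `Mθ < c'` leaves a good candidate.
  set θ : ℝ := c' / (2 * (M + 1)) with hθ
  have hθ0 : 0 < θ := by positivity
  refine ⟨min (c' * θ / 64) (min (c' ^ 2 / 2048) (c' / 8)), by positivity, ?_⟩
  intro V _ G p h ι J o adj A e hJ ho hA hadj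
  set γ := min (c' * θ / 64) (min (c' ^ 2 / 2048) (c' / 8)) with hγ
  have hγ1 : γ ≤ c' * θ / 64 := min_le_left _ _
  have hγ2 : γ ≤ c' ^ 2 / 2048 := (min_le_right _ _).trans (min_le_left _ _)
  have hγ3 : γ ≤ c' / 8 := (min_le_right _ _).trans (min_le_right _ _)
  have hn := h.order_pos
  have hp := h.p_pos
  have : Nonempty V := by
    have : 0 < Fintype.card V := by exact_mod_cast hn
    exact Fintype.card_pos_iff.1 this
  have key : ∀ i ≤ N, ∃ z : ℕ → V, (∀ l < i, z l ∈ cand G adj A z l (o l)) ∧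
      ∀ j ∈ J, c / 2 ^ i * (p ^ (e j + backDeg adj i j) * order V) ≤
            (cand G adj A z i j).card := by
    intro i
    induction i with
    | zero =>
      intro _
      refine ⟨fun _ => Classical.arbitrary V, by simp, fun j hj => ?_⟩
      simpa [cand, backDeg] using hA j hj
    | succ i ih =>
      intro hi
      obtain ⟨z, hz, hzc⟩ := ih (by omega)
      have hcc : ∀ j ∈ J, c' * (p ^ (e j + backDeg adj i j) * order V) ≤
            (cand G adj A z i j).card := fun j hj => by
        refine le_trans ?_ (hzc j hj)
        have h2 : (2:ℝ) ^ i ≤ 2 ^ N := pow_le_pow_right₀ (by norm_num) (by omega)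
        rw [hc']; gcongr
      set C := cand G adj A z i (o i) with hC
      set b := e (o i) + backDeg adj i (o i) with hb
      have hCc := hcc (o i) (ho i (by omega))
      -- Choosing `v` outside `Bad j` shrinks the candidates of `j` by no more than the factor
      -- `p/2`.
      let Bad : ι → Finset V := fun j => C.filter (fun v =>
        ((nb G (cand G adj A z i j) v).card : ℝ) ≤ p / 2 * (cand G adj A z i j).card)
      have hBad : ∀ j ∈ J.filter (adj i), ((Bad j).card : ℝ) ≤ θ * (p ^ b * order V) := by
        intro j hj
        obtain ⟨hjJ, hij⟩ := mem_filter.1 hj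
        obtain ⟨h1, h2⟩ := hadj i (by omega) j hjJ hij
        have hlow : ∀ v ∈ Bad j, ((nb G (cand G adj A z i j) v).card : ℝ) ≤
            p / 2 * (cand G adj A z i j).card := fun v hv => (mem_filter.1 hv).2
        rcases h2 with h2 | h2
        · refine h.low_filter (δ := 1/2) (a := e j + backDeg adj i j) hc'0 (by norm_num)
            (hcc j hjJ) (by omega) (by nlinarith [mul_pos hc'0 hθ0]) ?_ ?_
          · exact (disjoint_of_subset_left ((filter_subset _ _).trans (cand_subset _ _ _ _ _))
              (disjoint_of_subset_right (cand_subset _ _ _ _ _) h2)).symm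
          · intro v hv
            have := hlow v hv
            linarith
        · refine h.low_filter' (a := e j + backDeg adj i j) hc'0 (hcc j hjJ) (by omega)
            h2.1 h2.2 (by linarith) (by nlinarith) (by linarith) hlow
      have hex : ∃ v ∈ C, ∀ j ∈ J.filter (adj i), v ∉ Bad j := by
        by_contra hcon
        push Not at hcon
        have hsub : C ⊆ (J.filter (adj i)).biUnion Bad := fun v hv => by
          obtain ⟨j, hj, hvj⟩ := hcon v hv
          exact mem_biUnion.2 ⟨j, hj, hvj⟩
        have h3 : (C.card : ℝ) ≤ M * (θ * (p ^ b * order V)) := by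
          calc (C.card : ℝ) ≤ ((J.filter (adj i)).biUnion Bad).card := by
                exact_mod_cast card_le_card hsub
            _ ≤ ∑ j ∈ J.filter (adj i), ((Bad j).card : ℝ) := by exact_mod_cast card_biUnion_le
            _ ≤ (J.filter (adj i)).card * (θ * (p ^ b * order V)) := by
                rw [← nsmul_eq_mul]; exact sum_le_card_nsmul _ _ _ hBad
            _ ≤ _ := by
                have : (J.filter (adj i)).card ≤ M := (card_filter_le _ _).trans hJ
                gcongr
        have h4 : M * θ < c' := by
          rw [hθ, mul_div_assoc', div_lt_iff₀ (by positivity)]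
          nlinarith [(Nat.cast_nonneg M : (0:ℝ) ≤ M)]
        have h5 := h.pow_mul_pos b
        nlinarith
      obtain ⟨v, hvC, hv⟩ := hex
      refine ⟨Function.update z i v, ?_, ?_⟩
      · intro l hl
        rw [cand_congr adj A (z' := z) (fun m hm => Function.update_of_ne (by omega) _ _)]
        rcases Nat.lt_succ_iff_lt_or_eq.1 hl with hl | rfl
        · rw [Function.update_of_ne (by omega)]; exact hz l hl
        · rw [Function.update_self]; exact hvC
      · intro j hj
        rw [cand_succ, backDeg_succ,
          cand_congr adj A (z' := z) (fun m hm => Function.update_of_ne (by omega) _ _),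
          Function.update_self]
        have h6 := hzc j hj
        have h7 : c / 2 ^ (i + 1) = c / 2 ^ i / 2 := by rw [pow_succ]; field_simp
        split_ifs with hij
        · have h8 := hv j (mem_filter.2 ⟨hj, hij⟩)
          simp only [Bad, mem_filter, not_and, not_le] at h8
          have h9 := h8 hvC
          rw [h7, ← add_assoc, pow_succ]
          calc c / 2 ^ i / 2 * (p ^ (e j + backDeg adj i j) * p * order V)
              = p / 2 * (c / 2 ^ i * (p ^ (e j + backDeg adj i j) * order V)) := by ring
            _ ≤ p / 2 * (cand G adj A z i j).card := by gcongr
            _ ≤ _ := h9.le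
        · refine le_trans ?_ h6
          rw [h7, add_zero]
          have := h.pow_mul_pos (e j + backDeg adj i j)
          have hci : 0 < c / 2 ^ i := by positivity
          nlinarith [mul_pos hci this]
  exact key N le_rfl

end

/-! ### Powers of paths, flexible paths and extendable ends -/

section

variable {V : Type u} {G : SimpleGraph V}

/-- `l` is a `k`th power of a path: entries at distance at most `k` are adjacent. -/
def KP (G : SimpleGraph V) (k : ℕ) (l : List V) : Prop :=
  ∀ (i j : ℕ) (hj : j < l.length) (hij : i < j), j ≤ i + k → G.Adj (l[i]'(hij.trans hj)) l[j]

/-- All adjacencies between the `k`th power of a path read backwards as `x` and a continuation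
`y`. -/
def Cross (G : SimpleGraph V) (k : ℕ) (x y : List V) : Prop :=
  ∀ (i j : ℕ) (hi : i < x.length) (hj : j < y.length), i + j < k → G.Adj x[i] y[j]

theorem Cross.symm {k : ℕ} {x y : List V} (h : Cross G k x y) : Cross G k y x :=
  fun i j hi hj hij => (h j i hj hi (by omega)).symm

theorem KP.reverse {k : ℕ} {l : List V} (h : KP G k l) : KP G k l.reverse := by
  intro i j hj hij hjk
  simp only [List.length_reverse] at hj
  rw [List.getElem_reverse, List.getElem_reverse]
  exact (h (l.length - 1 - j) (l.length - 1 - i) (by omega) (by omega) (by omega)).symm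

/-- Entry `i` of the reversed first list and entry `j` of the second are `i + j + 1` apart in the
concatenation, whence the strict inequality `i + j < k` in `Cross`. -/
theorem KP_append {k : ℕ} {l₁ l₂ : List V} :
    KP G k (l₁ ++ l₂) ↔ KP G k l₁ ∧ KP G k l₂ ∧ Cross G k l₁.reverse l₂ := by
  constructor
  · intro h
    refine ⟨fun i j hj hij hjk => ?_, fun i j hj hij hjk => ?_, fun i j hi hj hij => ?_⟩
    · have := h i j (by simp; omega) hij hjk
      rwa [List.getElem_append_left (by omega), List.getElem_append_left (by omega)] at this
    · have := h (l₁.length + i) (l₁.length + j) (by simp; omega) (by omega) (by omega)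
      rw [List.getElem_append_right (by omega), List.getElem_append_right (by omega)] at this
      simpa using this
    · simp only [List.length_reverse] at hi
      have := h (l₁.length - 1 - i) (l₁.length + j) (by simp; omega) (by omega) (by omega)
      rw [List.getElem_append_left (by omega), List.getElem_append_right (by omega)] at this
      rw [List.getElem_reverse]
      simpa using this
  · rintro ⟨h1, h2, h3⟩ i j hj hij hjk
    simp only [List.length_append] at hj
    by_cases hj1 : j < l₁.length
    · rw [List.getElem_append_left (by omega), List.getElem_append_left (by omega)]
      exact h1 i j hj1 hij hjk
    · by_cases hi1 : i < l₁.length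
      · rw [List.getElem_append_left (by omega), List.getElem_append_right (by omega)]
        have := h3 (l₁.length - 1 - i) (j - l₁.length) (by simp; omega) (by omega) (by omega)
        rw [List.getElem_reverse] at this
        have e : l₁.length - 1 - (l₁.length - 1 - i) = i := by omega
        simpa only [e] using this
      · rw [List.getElem_append_right (by omega), List.getElem_append_right (by omega)]
        exact h2 _ _ (by omega) (by omega) (by omega)

/-- `i + j < k` involves only the first `k` entries of each list. So joining conditions depend on
the ends of a flexible path alone, which deletions do not change. -/
theorem Cross_take {k : ℕ} {x y : List V} {a b : ℕ} (ha : k ≤ a) (hb : k ≤ b) :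
    Cross G k (x.take a) (y.take b) ↔ Cross G k x y := by
  constructor
  · intro h i j hi hj hij
    have := h i j (by simp; omega) (by simp; omega) hij
    simpa using this
  · intro h i j hi hj hij
    simp only [List.length_take] at hi hj
    have := h i j (by omega) (by omega) hij
    simpa using this

theorem Cross_append_right {k : ℕ} {x y z : List V} (hy : k ≤ y.length) :
    Cross G k x (y ++ z) ↔ Cross G k x y := by
  rw [← Cross_take (G := G) (x := x) (y := y ++ z) le_rfl le_rfl,
    List.take_append_of_le_length hy, Cross_take le_rfl le_rfl]

theorem Cross_append_left {k : ℕ} {x y z : List V} (hy : k ≤ y.length) :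
    Cross G k (y ++ z) x ↔ Cross G k y x :=
  ⟨fun h => ((Cross_append_right hy).1 h.symm).symm,
    fun h => ((Cross_append_right hy).2 h.symm).symm⟩

theorem KP_join {k : ℕ} {l₁ l₂ z : List V} (h1 : KP G k l₁) (h2 : KP G k l₂) (hz : KP G k z)
    (hk : k ≤ z.length) (hc1 : Cross G k (l₁.reverse.take k) z)
    (hc2 : Cross G k z.reverse (l₂.take k)) : KP G k (l₁ ++ (z ++ l₂)) := by
  rw [KP_append, KP_append, Cross_append_right hk]
  refine ⟨h1, ⟨hz, h2, ?_⟩, ?_⟩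
  · rw [← Cross_take le_rfl le_rfl] at hc2 ⊢
    rwa [List.take_take, min_self] at hc2
  · rw [← Cross_take le_rfl le_rfl] at hc1 ⊢
    rwa [List.take_take, min_self] at hc1

/-- A vertex set `S` carrying a `k`th power of a path with initial segment `x` and reversed final
segment `y`, from which any subset of `R` may be removed. -/
def Flex (G : SimpleGraph V) (k : ℕ) (S R : Finset V) (x y : List V) : Prop :=
  R ⊆ S ∧ x.length = k ∧ y.length = k ∧ ∀ R' ⊆ R, ∃ l : List V, l.Nodup ∧
    l.toFinset = S \ R' ∧ KP G k l ∧ l.take k = x ∧ l.reverse.take k = y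

theorem Flex.reverse {k : ℕ} {S R : Finset V} {x y : List V} (h : Flex G k S R x y) :
    Flex G k S R y x := by
  refine ⟨h.1, h.2.2.1, h.2.1, fun R' hR' => ?_⟩
  obtain ⟨l, h1, h2, h3, h4, h5⟩ := h.2.2.2 R' hR'
  exact ⟨l.reverse, List.nodup_reverse.2 h1, by simpa using h2, h3.reverse, h5, by simpa using h4⟩

theorem Flex.of_list {k : ℕ} {l : List V} (h1 : l.Nodup) (h2 : KP G k l) (hk : k ≤ l.length) :
    Flex G k l.toFinset ∅ (l.take k) (l.reverse.take k) := by
  refine ⟨by simp, by simp [hk], by simp [hk], fun R' hR' => ?_⟩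
  rw [subset_empty.1 hR']
  exact ⟨l, h1, by simp, h2, rfl, rfl⟩

/-- A set to be deleted splits into its parts in `R₁` and `R₂`. Each path deletes its part keeping
its ends, so the same connecting list `z` fits every time. -/
theorem Flex.join {k : ℕ} {S₁ R₁ S₂ R₂ : Finset V} {x₁ y₁ x₂ y₂ z : List V}
    (h1 : Flex G k S₁ R₁ x₁ y₁) (h2 : Flex G k S₂ R₂ x₂ y₂) (hz : z.Nodup) (hzk : KP G k z)
    (hk : k ≤ z.length) (hc1 : Cross G k y₁ z) (hc2 : Cross G k z.reverse x₂)
    (hd : Disjoint S₁ S₂) (hd1 : Disjoint S₁ z.toFinset) (hd2 : Disjoint S₂ z.toFinset) :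
    Flex G k (S₁ ∪ S₂ ∪ z.toFinset) (R₁ ∪ R₂) x₁ y₂ := by
  refine ⟨(union_subset_union h1.1 h2.1).trans subset_union_left, h1.2.1, h2.2.2.1,
    fun R' hR' => ?_⟩
  obtain ⟨l₁, a1, a2, a3, a4, a5⟩ := h1.2.2.2 (R' ∩ R₁) inter_subset_right
  obtain ⟨l₂, b1, b2, b3, b4, b5⟩ := h2.2.2.2 (R' ∩ R₂) inter_subset_right
  have m1 : ∀ v ∈ l₁, v ∈ S₁ := fun v hv => by
    have : v ∈ S₁ \ (R' ∩ R₁) := a2 ▸ List.mem_toFinset.2 hv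
    exact (mem_sdiff.1 this).1
  have m2 : ∀ v ∈ l₂, v ∈ S₂ := fun v hv => by
    have : v ∈ S₂ \ (R' ∩ R₂) := b2 ▸ List.mem_toFinset.2 hv
    exact (mem_sdiff.1 this).1
  have hl1 : k ≤ l₁.length := by
    have := h1.2.1; rw [← a4, List.length_take] at this; omega
  have hl2 : k ≤ l₂.length := by
    have := h2.2.1; rw [← b4, List.length_take] at this; omega
  refine ⟨l₁ ++ (z ++ l₂), ?_, ?_, KP_join a3 b3 hzk hk (a5 ▸ hc1) (b4 ▸ hc2), ?_, ?_⟩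
  · rw [List.nodup_append, List.nodup_append]
    refine ⟨a1, ⟨hz, b1, fun v hv w hw hvw => ?_⟩, fun v hv w hw hvw => ?_⟩
    · subst hvw
      exact disjoint_left.1 hd2 (m2 v hw) (List.mem_toFinset.2 hv)
    · subst hvw
      rcases List.mem_append.1 hw with hw | hw
      · exact disjoint_left.1 hd1 (m1 v hv) (List.mem_toFinset.2 hw)
      · exact disjoint_left.1 hd (m1 v hv) (m2 v hw)
  · rw [List.toFinset_append, List.toFinset_append, a2, b2]
    ext v
    have g1 : v ∈ R₁ → v ∈ S₁ := fun h => h1.1 h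
    have g2 : v ∈ R₂ → v ∈ S₂ := fun h => h2.1 h
    have g3 : v ∈ R' → v ∈ R₁ ∨ v ∈ R₂ := fun h => mem_union.1 (hR' h)
    have g4 : v ∈ S₁ → v ∉ S₂ := fun h => disjoint_left.1 hd h
    have g5 : v ∈ S₁ → v ∉ z.toFinset := fun h => disjoint_left.1 hd1 h
    have g6 : v ∈ S₂ → v ∉ z.toFinset := fun h => disjoint_left.1 hd2 h
    simp only [mem_union, mem_sdiff, mem_inter]
    clear * - g1 g2 g3 g4 g5 g6
    grind
  · rw [List.take_append_of_le_length hl1, a4]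
  · rw [List.reverse_append, List.reverse_append, List.append_assoc,
      List.take_append_of_le_length (by simpa using hl2), b5]

/-- The common neighbourhoods in `U` of the initial segments of `l` are large. -/
def Extd [Fintype V] (G : SimpleGraph V) (k : ℕ) (p c : ℝ) (l : List V) (U : Finset V) : Prop :=
  ∀ j ≤ k, c * (p ^ j * order V) ≤ (cnb G U (l.take j)).card

section
variable [Fintype V] {k τ : ℕ} {p γ : ℝ}

theorem Extd_take {c : ℝ} {l : List V} {U : Finset V} :
    Extd G k p c (l.take k) U ↔ Extd G k p c l U := by
  refine forall_congr' fun j => forall_congr' fun hj => ?_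
  rw [List.take_take, min_eq_left hj]

theorem Extd.card_le {c : ℝ} {l : List V} {U : Finset V} (h : Extd G k p c l U) :
    c * order V ≤ U.card := by
  simpa [cnb_nil] using h 0 (Nat.zero_le _)

theorem Extd.mono {c c' : ℝ} {l : List V} {U U' : Finset V} (h : Extd G k p c l U) (hp : 0 ≤ p)
    (hc : c' ≤ c) (hU : U ⊆ U') : Extd G k p c' l U' := fun j hj => by
  have hn : (0:ℝ) ≤ order V := Nat.cast_nonneg _
  calc c' * (p ^ j * order V) ≤ c * (p ^ j * order V) := by gcongr
    _ ≤ (cnb G U (l.take j)).card := h j hj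
    _ ≤ _ := by
      gcongr
      intro v hv
      rw [mem_cnb] at hv ⊢
      exact ⟨hU hv.1, hv.2⟩

/-- Removing few vertices preserves extendability. -/
theorem Extd.sdiff {c d : ℝ} {l : List V} {U S : Finset V} (h : Extd G k p c l U) (hp : 0 ≤ p)
    (hp1 : p ≤ 1) (hS : ((S ∩ U).card : ℝ) ≤ d * (p ^ k * order V)) (hd : 0 ≤ d) :
    Extd G k p (c - d) l (U \ S) := fun j hj => by
  have hn : (0:ℝ) ≤ order V := Nat.cast_nonneg _
  have h1 : cnb G U (l.take j) ⊆ cnb G (U \ S) (l.take j) ∪ (S ∩ U) := fun v hv => by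
    simp only [mem_cnb, mem_union, mem_inter, mem_sdiff] at hv ⊢
    tauto
  have h2 : ((cnb G U (l.take j)).card : ℝ) ≤
      (cnb G (U \ S) (l.take j)).card + (S ∩ U).card := by
    exact_mod_cast (card_le_card h1).trans (card_union_le _ _)
  have h3 := h j hj
  have h4 : p ^ k ≤ p ^ j := pow_le_pow_of_le_one hp hp1 hj
  have h5 : d * (p ^ k * order V) ≤ d * (p ^ j * order V) := by gcongr
  linarith

end

/-- A cyclic list through all vertices gives a power of a Hamilton cycle. -/
theorem containsHamiltonCyclePower_of_list [Fintype V] {k : ℕ} {l : List V} (h1 : l.Nodup)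
    (h2 : l.toFinset = univ) (h3 : KP G k l) (h4 : Cross G k l.reverse l)
    (h5 : 3 ≤ Fintype.card V) : ContainsHamiltonCyclePower G k := by
  refine ⟨h5, ?_⟩
  have hlen : l.length = Fintype.card V := by
    rw [← List.toFinset_card_of_nodup h1, h2, card_univ]
  set n := Fintype.card V with hn
  obtain ⟨m, hm⟩ : ∃ m, n = m + 3 := ⟨n - 3, by omega⟩
  clear_value n
  subst hm
  -- Each step of a walk in the cycle changes the position by ±1 modulo the length, so the total
  -- displacement `d` is bounded by the number of steps.
  have hw : ∀ (u v : Fin (m + 3)) (w : (SimpleGraph.cycleGraph (m + 3)).Walk u v),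
      ∃ d : ℤ, |d| ≤ w.length ∧ ∃ q : ℤ, (v : ℤ) = u + d + q * (m + 3) := by
    intro u v w
    induction w with
    | nil => exact ⟨0, by simp, 0, by simp⟩
    | @cons a b c hab w ih =>
      obtain ⟨d, hd, q, hq⟩ := ih
      rw [SimpleGraph.cycleGraph_adj'] at hab
      have hsub : ∀ x y : Fin (m + 3), (x - y).val = 1 → (x : ℤ) = y + 1 ∨
          (x : ℤ) = y + 1 - (m + 3) := by
        intro x y hxy
        rw [Fin.val_sub] at hxy
        have hx := x.2
        have hy := y.2
        rcases lt_or_ge (m + 3 - y.val + x.val) (m + 3) with hlt | hge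
        · rw [Nat.mod_eq_of_lt hlt] at hxy
          right; omega
        · rw [Nat.mod_eq_sub_mod hge, Nat.mod_eq_of_lt (by omega)] at hxy
          left; omega
      rcases hab with hab | hab
      · have := hsub _ _ hab
        refine ⟨d - 1, ?_, ?_⟩
        · rw [SimpleGraph.Walk.length_cons]; push_cast
          rw [abs_le] at hd ⊢; constructor <;> linarith
        · rcases this with h | h
          · exact ⟨q, by linarith⟩
          · exact ⟨q + 1, by linarith⟩
      · have := hsub _ _ hab
        refine ⟨d + 1, ?_, ?_⟩
        · rw [SimpleGraph.Walk.length_cons]; push_cast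
          rw [abs_le] at hd ⊢; constructor <;> linarith
        · rcases this with h | h
          · exact ⟨q, by linarith⟩
          · exact ⟨q - 1, by linarith⟩
  refine ⟨⟨⟨fun i => l[i.val]'(by rw [hlen]; exact i.2), ?_⟩, ?_⟩⟩
  · intro u v huv
    obtain ⟨hne, hd⟩ := huv
    have key : ∀ u v : Fin (m + 3), u.val < v.val →
        (SimpleGraph.cycleGraph (m + 3)).edist u v ≤ k →
        G.Adj (l[u.val]'(by rw [hlen]; exact u.2)) (l[v.val]'(by rw [hlen]; exact v.2)) := by
      intro u v huv hd
      have hfin : (SimpleGraph.cycleGraph (m + 3)).edist u v ≠ ⊤ :=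
        ne_top_of_le_ne_top (ENat.natCast_ne_top k) hd
      obtain ⟨w, hwl⟩ := SimpleGraph.exists_walk_of_edist_ne_top hfin
      rw [← hwl] at hd
      have hk : w.length ≤ k := by exact_mod_cast hd
      obtain ⟨d, hd, q, hq⟩ := hw u v w
      have hu := u.2
      have hv := v.2
      by_cases hsm : v.val ≤ u.val + k
      · exact h3 _ _ (by omega) huv hsm
      · have hcase : m + 3 - 1 - v.val + u.val < k := by
          rw [abs_le] at hd
          have hdk : d ≤ k := by omega
          have hdk' : -(k:ℤ) ≤ d := by omega
          -- As `v > u + k` while `d ≤ k`, the walk must have gone round through the end of the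
          -- list, so `u` and `v` are close across the seam, where `h4` applies.
          have hq1 : 1 ≤ q := by
            by_contra hq0
            have : q * ((m:ℤ) + 3) ≤ 0 := by
              apply mul_nonpos_of_nonpos_of_nonneg <;> omega
            omega
          have : (m:ℤ) + 3 ≤ q * ((m:ℤ) + 3) := by nlinarith
          omega
        have := h4 (m + 3 - 1 - v.val) u.val (by simp [hlen]; omega) (by omega) hcase
        rw [List.getElem_reverse] at this
        have e : l.length - 1 - (m + 3 - 1 - v.val) = v.val := by omega
        simp only [e] at this
        exact this.symm
    rcases lt_trichotomy u.val v.val with h | h | h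
    · exact key u v h hd
    · exact absurd (Fin.ext h) hne
    · rw [SimpleGraph.edist_comm] at hd
      exact (key v u h hd).symm
  · intro u v huv
    have := (List.Nodup.getElem_inj_iff h1).1 huv
    exact Fin.ext this

end

/-! ### Short pieces with extendable ends -/

section

variable {V : Type u} {G : SimpleGraph V}

/-- The number of predecessors of `j` below `i` under the relation `r`. -/
noncomputable def predCount (r : ℕ → ℕ → Prop) (i j : ℕ) : ℕ :=
  ((range i).filter (fun l => l < j ∧ r l j)).card

theorem backDeg_le {ι : Type*} {adj : ℕ → ι → Prop} {i : ℕ} {j : ι} (s : Finset ℕ)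
    (h : ∀ l < i, adj l j → l ∈ s) : backDeg adj i j ≤ s.card :=
  card_le_card fun l hl => h l (mem_range.1 (mem_filter.1 hl).1) (mem_filter.1 hl).2

/-- Embedding a path-like pattern `r` on `N` vertices into the sets `S i` so that both ends are
extendable to all members of `𝒰`. -/
theorem pattern_embedding (k τ N M e D₁ D₂ : ℕ) {c : ℝ} (hc : 0 < c) (r : ℕ → ℕ → Prop)
    (h1 : ∀ i < N, e + predCount r i i ≤ D₁)
    (h2 : ∀ i j, i < j → j < N → r i j → predCount r i j ≤ D₂) (h3 : e + D₁ + D₂ ≤ τ)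
    (h4 : D₁ + k ≤ τ + 1) (h5 : 2 * k ≤ τ + 2) :
    ∃ c' γ : ℝ, 0 < c' ∧ 0 < γ ∧ ∀ (V : Type u) [Fintype V] (G : SimpleGraph V) (p : ℝ),
      Psr G k τ p γ → ∀ (S : ℕ → Finset V) (𝒰 : Finset (Finset V)), 𝒰.card ≤ M →
        (∀ i < N, c * (p ^ e * order V) ≤ (S i).card) →
        (∀ i < N, ∀ j < N, i ≠ j → Disjoint (S i) (S j)) →
        (∀ U ∈ 𝒰, c * order V ≤ U.card) →
        ∃ l : List V, l.length = N ∧ (∀ i (h : i < l.length), l[i] ∈ S i) ∧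
          (∀ i j (h : j < l.length) (hij : i < j), r i j → G.Adj (l[i]'(hij.trans h)) l[j]) ∧
          ∀ U ∈ 𝒰, Extd G k p c' l U ∧ Extd G k p c' l.reverse U := by
  obtain ⟨γ, hγ, H⟩ := greedy_embedding.{u} k τ N (N + M * (2 * (k + 1))) hc
  refine ⟨c / 2 ^ N, γ, by positivity, hγ, ?_⟩
  intro V _ G p h S 𝒰 h𝒰 hS hSd hU
  have hp := h.p_pos
  have hn := h.order_pos
  -- Besides the `N` pattern vertices, the indices include virtual ones that are never embedded: the
  -- candidates of `(U, true, j)` and `(U, false, j)` are the common neighbourhoods in `U` of the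
  -- first and of the last `j` vertices. Keeping them large is extendability.
  let J : Finset (ℕ ⊕ (Finset V × Bool × ℕ)) := (range N).disjSum (𝒰 ×ˢ (univ : Finset Bool) ×ˢ range (k + 1))
  let adj : ℕ → (ℕ ⊕ (Finset V × Bool × ℕ)) → Prop := fun l j => match j with
    | Sum.inl j => l < j ∧ r l j
    | Sum.inr (_, true, j) => l < j
    | Sum.inr (_, false, j) => N - j ≤ l
  let A : (ℕ ⊕ (Finset V × Bool × ℕ)) → Finset V := fun j => match j with
    | Sum.inl j => S j
    | Sum.inr (U, _, _) => U
  let ex : (ℕ ⊕ (Finset V × Bool × ℕ)) → ℕ := fun j => match j with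
    | Sum.inl _ => e
    | Sum.inr _ => 0
  have b1 : ∀ i U j, backDeg adj i (Sum.inr (U, true, j)) ≤ j := fun i U j =>
    (backDeg_le (range j) fun l _ (hl : l < j) => mem_range.2 hl).trans (card_range j).le
  have b1' : ∀ i U j, backDeg adj i (Sum.inr (U, true, j)) ≤ i := fun i U j =>
    (backDeg_le (range i) fun l hl _ => mem_range.2 hl).trans (card_range i).le
  have b2 : ∀ i U j, backDeg adj i (Sum.inr (U, false, j)) ≤ i - (N - j) := fun i U j =>
    (backDeg_le (Ico (N - j) i) fun l hl (hl' : N - j ≤ l) => mem_Ico.2 ⟨hl', hl⟩).trans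
      (Nat.card_Ico _ _).le
  have b3 : ∀ i j, backDeg adj i (Sum.inl j) = predCount r i j := fun i j => by
    unfold backDeg predCount
    congr 1
    ext l
    simp [adj]
  obtain ⟨z, hz, hzU⟩ := H V G p h _ J (fun i => Sum.inl i) adj A ex
    (by
      rw [card_disjSum, card_product, card_product, card_range, card_range]
      simp only [card_univ, Fintype.card_bool]
      gcongr)
    (fun i hi => by simp [J, hi])
    (by
      rintro (j | ⟨U, b, j⟩) hj
      · simp only [J, inl_mem_disjSum, mem_range] at hj
        exact hS j hj
      · simp only [J, inr_mem_disjSum, mem_product] at hj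
        simpa [ex, A] using hU U hj.1)
    (by
      rintro i hi (j | ⟨U, b, j⟩) hj hij
      · simp only [J, inl_mem_disjSum, mem_range] at hj
        have hij' : i < j ∧ r i j := hij
        have a1 := h1 i hi
        have a2 := h2 i j hij'.1 hj hij'.2
        simp only [b3]
        exact ⟨by simp only [ex]; omega, Or.inl (hSd i hi j hj hij'.1.ne)⟩
      · simp only [J, inr_mem_disjSum, mem_product, mem_range] at hj
        have a1 := h1 i hi
        -- Vertex `i` is itself one of the at most `k` vertices concerned and has not been embedded
        -- yet. Since `U` may meet `S i`, the alternative for overlapping sets is used.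
        have hd : backDeg adj i (Sum.inr (U, b, j)) + 1 ≤ k := by
          cases b
          · have hij' : N - j ≤ i := hij
            have := b2 i U j
            omega
          · have hij' : i < j := hij
            have := b1' i U j
            omega
        simp only [b3]
        exact ⟨by simp only [ex]; omega, Or.inr ⟨by simp only [ex]; omega,
          by simp only [ex]; omega⟩⟩)
  have hadj : ∀ i j, i < j → j < N → r i j → G.Adj (z i) (z j) := fun i j hij hj hr =>
    (mem_cand.1 (hz j hj)).2 i hij ⟨hij, hr⟩
  refine ⟨(List.range N).map z, by simp, fun i hi => ?_, fun i j hj hij hr => ?_, fun U hUm => ?_⟩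
  · simp only [List.length_map, List.length_range] at hi
    simpa using cand_subset _ _ _ _ _ (hz i hi)
  · simp only [List.length_map, List.length_range] at hj
    simpa using hadj i j hij hj hr
  · constructor
    · intro j hj
      have hm := hzU (Sum.inr (U, true, j)) (by simp [J, hUm]; omega)
      have hb := b1 N U j
      calc _ ≤ c / 2 ^ N * (p ^ (ex (Sum.inr (U, true, j)) +
            backDeg adj N (Sum.inr (U, true, j))) * order V) := by
            have := h.pow_le (a := ex (Sum.inr (U, true, j)) +
              backDeg adj N (Sum.inr (U, true, j))) (b := j) (by simpa [ex] using hb)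
            gcongr
        _ ≤ _ := hm
        _ ≤ _ := by
            gcongr
            intro v hv
            obtain ⟨hv1, hv2⟩ := mem_cand.1 hv
            rw [mem_cnb]
            refine ⟨hv1, fun w hw => ?_⟩
            rw [← List.map_take, List.take_range, List.mem_map] at hw
            obtain ⟨l, hl, rfl⟩ := hw
            rw [List.mem_range] at hl
            exact hv2 l (by omega) (show l < j by omega)
    · intro j hj
      have hm := hzU (Sum.inr (U, false, j)) (by simp [J, hUm]; omega)
      have hb := b2 N U j
      calc _ ≤ c / 2 ^ N * (p ^ (ex (Sum.inr (U, false, j)) +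
            backDeg adj N (Sum.inr (U, false, j))) * order V) := by
            have := h.pow_le (a := ex (Sum.inr (U, false, j)) +
              backDeg adj N (Sum.inr (U, false, j))) (b := j) (by simp only [ex]; omega)
            gcongr
        _ ≤ _ := hm
        _ ≤ _ := by
            gcongr
            intro v hv
            obtain ⟨hv1, hv2⟩ := mem_cand.1 hv
            rw [mem_cnb]
            refine ⟨hv1, fun w hw => ?_⟩
            rw [List.mem_iff_getElem] at hw
            obtain ⟨i, hi, rfl⟩ := hw
            simp only [List.length_take, List.length_reverse, List.length_map,
              List.length_range] at hi
            simp only [List.getElem_take, List.getElem_reverse, List.getElem_map,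
              List.getElem_range, List.length_map, List.length_range]
            exact hv2 _ (by omega) (show N - j ≤ N - 1 - i by omega)

/-- A set contains disjoint subsets of prescribed equal sizes. -/
theorem exists_disjoint_subsets (A : Finset V) (s m : ℕ) (h : m * s ≤ A.card) :
    ∃ f : ℕ → Finset V, (∀ i < m, f i ⊆ A ∧ (f i).card = s) ∧
      ∀ i < m, ∀ j < m, i ≠ j → Disjoint (f i) (f j) := by
  induction m generalizing A with
  | zero => exact ⟨fun _ => ∅, by simp, by simp⟩
  | succ m ih =>
    have hs : s ≤ A.card := by nlinarith
    obtain ⟨B, hB, hBc⟩ := exists_subset_card_eq hs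
    obtain ⟨f, hf, hfd⟩ := ih (A \ B) (by rw [card_sdiff_of_subset hB, hBc]; rw [Nat.succ_mul] at h; omega)
    refine ⟨fun i => if i = m then B else f i, fun i hi => ?_, fun i hi j hj hij => ?_⟩
    · by_cases him : i = m
      · simp [him, hB, hBc]
      · have := hf i (by omega)
        simp only [him, if_false]
        exact ⟨this.1.trans sdiff_subset, this.2⟩
    · by_cases him : i = m
      · have hjm : j ≠ m := by omega
        simp only [him, hjm, if_true, if_false]
        exact disjoint_of_subset_right (hf j (by omega)).1 disjoint_sdiff
      · by_cases hjm : j = m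
        · simp only [him, hjm, if_true, if_false]
          exact (disjoint_of_subset_right (hf i (by omega)).1 disjoint_sdiff).symm
        · simp only [him, hjm, if_false]
          exact hfd i (by omega) j (by omega) hij

theorem exists_disjoint_subsets_real (A : Finset V) {m : ℕ} {x : ℝ} (hm : 0 < m)
    (hx : (m : ℝ) ≤ x) (h : x ≤ A.card) :
    ∃ f : ℕ → Finset V, (∀ i < m, f i ⊆ A ∧ x / (2 * m) ≤ (f i).card) ∧
      ∀ i < m, ∀ j < m, i ≠ j → Disjoint (f i) (f j) := by
  obtain ⟨f, hf, hfd⟩ := exists_disjoint_subsets A (A.card / m) m (Nat.mul_div_le _ _)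
  refine ⟨f, fun i hi => ⟨(hf i hi).1, ?_⟩, hfd⟩
  rw [(hf i hi).2]
  have h1 : m ≤ A.card := by exact_mod_cast hx.trans h
  have h2 : A.card ≤ 2 * m * (A.card / m) := by
    have h3 := Nat.lt_div_mul_add (a := A.card) hm
    have h4 : 1 ≤ A.card / m := (Nat.one_le_div_iff hm).2 h1
    nlinarith
  rw [div_le_iff₀ (by positivity)]
  have h5 : (A.card : ℝ) ≤ 2 * m * (A.card / m : ℕ) := by exact_mod_cast h2
  linarith

/-- The adjacency pattern of the `k`th power of a path. -/
def pathRel (k i j : ℕ) : Prop := j ≤ i + k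

/-- The adjacency pattern of the `k`th power of a path with its middle vertex left out. -/
def gapRel (k i j : ℕ) : Prop := j ≤ i + k ∧ ¬ (i < k ∧ k ≤ j ∧ j = i + k)

theorem predCount_pathRel_le (k i j : ℕ) (h : i ≤ j) :
    predCount (pathRel k) i j ≤ k - (j - i) := by
  calc _ ≤ (Ico (j - k) i).card := card_le_card fun l hl => by
        have h1 := mem_filter.1 hl
        have h2 : j ≤ l + k := h1.2.2
        have := mem_range.1 h1.1
        exact mem_Ico.2 ⟨by omega, this⟩
    _ ≤ _ := by rw [Nat.card_Ico]; omega

/-- A vertex of the second half loses its farthest predecessor, and one of the first half has at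
most `k - 1` anyway. This saving of one over `predCount_pathRel_le` pays for embedding inside the
neighbourhood of a vertex. -/
theorem predCount_gapRel_le (k i j : ℕ) (h : i ≤ j) (hj : j < 2 * k) :
    predCount (gapRel k) i j ≤ k - 1 - (j - i) := by
  by_cases hjk : j < k
  · calc _ ≤ (range i).card := card_le_card (filter_subset _ _)
      _ ≤ _ := by rw [card_range]; omega
  · calc _ ≤ (Ico (j - k + 1) i).card := card_le_card fun l hl => by
          have h1 := mem_filter.1 hl
          obtain ⟨h2, h3⟩ : gapRel k l j := h1.2.2
          have := mem_range.1 h1.1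
          exact mem_Ico.2 ⟨by omega, this⟩
      _ ≤ _ := by rw [Nat.card_Ico]; omega

theorem nodup_of_mem_disjoint {l : List V} {S : ℕ → Finset V}
    (hl : ∀ i (h : i < l.length), l[i] ∈ S i)
    (hS : ∀ i < l.length, ∀ j < l.length, i ≠ j → Disjoint (S i) (S j)) : l.Nodup := by
  rw [List.nodup_iff_injective_get]
  intro i j hij
  by_contra hne
  have := hS i i.2 j j.2 (fun h => hne (Fin.ext h))
  refine disjoint_left.1 this (hl i i.2) ?_
  have h2 := hl j j.2
  simp only [List.get_eq_getElem] at hij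
  rwa [← hij] at h2

/-- A large set, or for larger `τ` the neighbourhood of a vertex, contains the `k`th power of a
path with extendable ends. -/
theorem exists_path_piece (k τ N M e : ℕ) {c : ℝ} (hc : 0 < c) (hk : 1 ≤ k) (hek : e ≤ k)
    (hN : 0 < N) (h3 : 2 * e + 2 * k ≤ τ + 1) :
    ∃ c' γ : ℝ, 0 < c' ∧ 0 < γ ∧ ∀ (V : Type u) [Fintype V] (G : SimpleGraph V) (p : ℝ),
      Psr G k τ p γ → ∀ (A : Finset V) (𝒰 : Finset (Finset V)), 𝒰.card ≤ M →
        c * (p ^ e * order V) ≤ A.card → (∀ U ∈ 𝒰, c * order V ≤ U.card) →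
        ∃ l : List V, l.length = N ∧ l.Nodup ∧ KP G k l ∧ (∀ v ∈ l, v ∈ A) ∧
          ∀ U ∈ 𝒰, Extd G k p c' l U ∧ Extd G k p c' l.reverse U := by
  have hNR : (0:ℝ) < N := by exact_mod_cast hN
  -- Vertex `i` has exponent at most `e + k`. A later neighbour has at most `k - 1` predecessors
  -- embedded before `i`, so the total is `2e + 2k - 1 ≤ τ`.
  obtain ⟨c', γ, hc', hγ, H⟩ := pattern_embedding.{u} k τ N M e (e + k) (k - 1)
    (c := c / (2 * N)) (by positivity) (pathRel k)
    (fun i _ => by have := predCount_pathRel_le k i i le_rfl; omega)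
    (fun i j hij _ hr => by have := predCount_pathRel_le k i j hij.le; omega)
    (by omega) (by omega) (by omega)
  refine ⟨c', min γ (c / N), hc', by positivity, ?_⟩
  intro V _ G p h A 𝒰 h𝒰 hA hU
  have hn := h.order_pos
  have hbig : (N : ℝ) ≤ c * (p ^ e * order V) := by
    have := h.le_pow_order (D := N / c) (by
      calc min γ (c / N) * (N / c) ≤ (c / N) * (N / c) := by gcongr; exact min_le_right _ _
        _ = 1 := by field_simp) hek
    rwa [div_le_iff₀' hc] at this
  obtain ⟨S, hS, hSd⟩ := exists_disjoint_subsets_real A hN hbig hA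
  obtain ⟨l, hl, hlS, hadj, hext⟩ := H V G p (h.mono (min_le_left _ _)) S 𝒰 h𝒰
    (fun i hi => by
      refine le_trans (le_of_eq ?_) (hS i hi).2
      ring) hSd
    (fun U hUm => le_trans (by
      rw [div_mul_eq_mul_div, div_le_iff₀ (by positivity)]
      have : (1:ℝ) ≤ N := by exact_mod_cast hN
      nlinarith [mul_pos hc hn]) (hU U hUm))
  refine ⟨l, hl, nodup_of_mem_disjoint hlS (hl ▸ hSd), fun i j hj hij hr => hadj i j hj hij hr,
    fun v hv => ?_, hext⟩
  obtain ⟨i, hi, rfl⟩ := List.mem_iff_getElem.1 hv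
  exact (hS i (hl ▸ hi)).1 (hlS i hi)

/-- Inserting a common neighbour in the middle of a path-like list. -/
theorem KP_insert {k : ℕ} {l : List V} {u : V} (hl : l.length = 2 * k)
    (hadj : ∀ i j (h : j < l.length) (hij : i < j), gapRel k i j →
      G.Adj (l[i]'(hij.trans h)) l[j]) (hu : ∀ v ∈ l, G.Adj u v) :
    KP G k (l.take k ++ u :: l.drop k) := by
  rw [KP_append]
  refine ⟨fun i j hj hij hjk => ?_, ?_, ?_⟩
  · simp only [List.length_take] at hj
    simp only [List.getElem_take]
    exact hadj i j (by omega) hij ⟨hjk, by omega⟩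
  · intro i j hj hij hjk
    simp only [List.length_cons, List.length_drop] at hj
    obtain ⟨j, rfl⟩ : ∃ j', j = j' + 1 := ⟨j - 1, by omega⟩
    rw [List.getElem_cons_succ, List.getElem_drop]
    rcases i with _ | i
    · exact hu _ (List.getElem_mem _)
    · rw [List.getElem_cons_succ, List.getElem_drop]
      exact hadj _ _ (by omega) (by omega) ⟨by omega, by omega⟩
  · intro i j hi hj hij
    simp only [List.length_reverse, List.length_take] at hi
    simp only [List.length_cons, List.length_drop] at hj
    rw [List.getElem_reverse]
    simp only [List.getElem_take, List.length_take]
    rcases j with _ | j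
    · rw [List.getElem_cons_zero]
      exact (hu _ (List.getElem_mem _)).symm
    · rw [List.getElem_cons_succ, List.getElem_drop]
      exact hadj _ _ (by omega) (by omega) ⟨by omega, by omega⟩

theorem take_insert {k : ℕ} {l : List V} {u : V} (hl : l.length = 2 * k) :
    (l.take k ++ u :: l.drop k).take k = l.take k := by
  rw [List.take_append_of_le_length (by simp; omega), List.take_take, min_self]

theorem take_reverse_insert {k : ℕ} {l : List V} {u : V} (hl : l.length = 2 * k) :
    (l.take k ++ u :: l.drop k).reverse.take k = l.reverse.take k := by
  rw [List.reverse_append, List.reverse_cons, List.append_assoc,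
    List.take_append_of_le_length (by simp; omega), List.take_reverse, List.take_reverse]
  congr 1
  simp [hl]
  omega

/-- A vertex with a large neighbourhood in `A` lies in a short power of a path with extendable
ends, all of whose other vertices are in `A`. -/
theorem exists_cover_piece (k τ M : ℕ) {c : ℝ} (hc : 0 < c) (hk : 2 ≤ k)
    (hτ : 2 * k ≤ τ + 1) :
    ∃ c' γ : ℝ, 0 < c' ∧ 0 < γ ∧ ∀ (V : Type u) [Fintype V] (G : SimpleGraph V) (p : ℝ),
      Psr G k τ p γ → ∀ (u : V) (A : Finset V) (𝒰 : Finset (Finset V)), 𝒰.card ≤ M →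
        c * (p * order V) ≤ (nb G A u).card → (∀ U ∈ 𝒰, c * order V ≤ U.card) →
        ∃ l : List V, l.length = 2 * k + 1 ∧ l.Nodup ∧ KP G k l ∧ u ∈ l ∧
          (∀ v ∈ l, v = u ∨ v ∈ A) ∧
          ∀ U ∈ 𝒰, Extd G k p c' l U ∧ Extd G k p c' l.reverse U := by
  have hNR : (0:ℝ) < (2 * k : ℕ) := by exact_mod_cast (by omega : 0 < 2 * k)
  -- The neighbourhood of `u` has exponent 1. With the gap in the pattern the total is `1 + k + (k -
  -- 2) = 2k - 1 ≤ τ`, which is available even for `k = 2`, `τ = 3`.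
  obtain ⟨c', γ, hc', hγ, H⟩ := pattern_embedding.{u} k τ (2 * k) M 1 k (k - 2)
    (c := c / (2 * (2 * k : ℕ))) (by positivity) (gapRel k)
    (fun i hi => by have := predCount_gapRel_le k i i le_rfl hi; omega)
    (fun i j hij hj hr => by have := predCount_gapRel_le k i j hij.le hj; omega)
    (by omega) (by omega) (by omega)
  refine ⟨c', min γ (c / (2 * k : ℕ)), hc', by positivity, ?_⟩
  intro V _ G p h u A 𝒰 h𝒰 hA hU
  have hn := h.order_pos
  have hbig : ((2 * k : ℕ) : ℝ) ≤ c * (p * order V) := by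
    have := h.le_pow_order (D := (2 * k : ℕ) / c) (by
      calc min γ (c / (2 * k : ℕ)) * ((2 * k : ℕ) / c)
          ≤ (c / (2 * k : ℕ)) * ((2 * k : ℕ) / c) := by gcongr; exact min_le_right _ _
        _ = 1 := by field_simp) (m := 1) (by omega)
    rwa [div_le_iff₀' hc, pow_one] at this
  obtain ⟨S, hS, hSd⟩ := exists_disjoint_subsets_real (nb G A u) (by omega) hbig hA
  obtain ⟨l, hl, hlS, hadj, hext⟩ := H V G p (h.mono (min_le_left _ _)) S 𝒰 h𝒰
    (fun i hi => by
      refine le_trans (le_of_eq ?_) (hS i hi).2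
      ring) hSd
    (fun U hUm => le_trans (by
      rw [div_mul_eq_mul_div, div_le_iff₀ (by positivity)]
      have : (1:ℝ) ≤ (2 * k : ℕ) := by exact_mod_cast (by omega : 1 ≤ 2 * k)
      nlinarith [mul_pos hc hn]) (hU U hUm))
  have hnd : l.Nodup := nodup_of_mem_disjoint hlS (hl ▸ hSd)
  have hmem : ∀ v ∈ l, v ∈ nb G A u := fun v hv => by
    obtain ⟨i, hi, rfl⟩ := List.mem_iff_getElem.1 hv
    exact (hS i (hl ▸ hi)).1 (hlS i hi)
  have hul : u ∉ l := fun hu => G.loopless.irrefl u (mem_nb.1 (hmem u hu)).2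
  have hperm : (l.take k ++ u :: l.drop k).Perm (u :: l) := by
    refine List.perm_middle.trans ?_
    rw [List.take_append_drop]
  refine ⟨l.take k ++ u :: l.drop k, ?_, ?_, ?_, by simp, ?_, fun U hUm => ?_⟩
  · rw [hperm.length_eq, List.length_cons, hl]
  · rw [hperm.nodup_iff]
    exact List.nodup_cons.2 ⟨hul, hnd⟩
  · exact KP_insert hl hadj fun v hv => (mem_nb.1 (hmem v hv)).2
  · intro v hv
    rw [hperm.mem_iff, List.mem_cons] at hv
    exact hv.imp_right fun hv => (mem_nb.1 (hmem v hv)).1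
  · obtain ⟨h1, h2⟩ := hext U hUm
    rw [← Extd_take] at h1 h2
    rw [← Extd_take, take_insert hl, ← Extd_take (l := List.reverse _), take_reverse_insert hl]
    exact ⟨h1, h2⟩

end

/-! ### Absorbing gadgets for `k ≥ 3` -/

section

/-- Absorbing gadgets: short flexible paths from which one vertex of `T` may be removed. -/
def HasGadgets.{w} (k τ : ℕ) : Prop :=
  ∀ (c : ℝ) (M : ℕ), 0 < c → ∃ (c' γ : ℝ) (D : ℕ), 0 < c' ∧ 0 < γ ∧
    ∀ (V : Type w) [Fintype V] (G : SimpleGraph V) (p : ℝ), Psr G k τ p γ →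
      ∀ (T A : Finset V) (𝒰 : Finset (Finset V)), Disjoint T A → c * order V ≤ T.card →
        c * order V ≤ A.card → 𝒰.card ≤ M → (∀ U ∈ 𝒰, c * order V ≤ U.card) →
        ∃ (v : V) (S : Finset V) (x y : List V), v ∈ T ∧ Flex G k S {v} x y ∧
          S ⊆ insert v A ∧ S.card ≤ D ∧
          ∀ U ∈ 𝒰, Extd G k p c' x U ∧ Extd G k p c' y U

variable {V : Type u} {G : SimpleGraph V}

/-- Two lists with the same ends, one with an additional vertex, form a flexible path. -/
theorem Flex.of_two_lists {k : ℕ} {l l' : List V} {v : V} (h1 : l.Nodup) (h2 : KP G k l)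
    (h2' : KP G k l') (hk : k ≤ l.length) (hperm : l'.Perm (v :: l)) (hv : v ∉ l)
    (hx : l'.take k = l.take k) (hy : l'.reverse.take k = l.reverse.take k) :
    Flex G k (insert v l.toFinset) {v} (l.take k) (l.reverse.take k) := by
  refine ⟨by simp, by simp [hk], by simp [hk], fun R' hR' => ?_⟩
  rcases subset_singleton_iff.1 hR' with rfl | rfl
  · refine ⟨l', ?_, ?_, h2', hx, hy⟩
    · rw [hperm.nodup_iff]; exact List.nodup_cons.2 ⟨hv, h1⟩
    · rw [sdiff_empty, List.toFinset_eq_of_perm _ _ hperm, List.toFinset_cons]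
  · refine ⟨l, h1, ?_, h2, rfl, rfl⟩
    ext w
    simp only [List.mem_toFinset, mem_sdiff, mem_insert, mem_singleton]
    constructor
    · intro hw
      exact ⟨Or.inr hw, fun h => hv (h ▸ hw)⟩
    · tauto

theorem exists_typical_vertex {k τ : ℕ} (M : ℕ) {c : ℝ} (hc : 0 < c) :
    ∃ γ : ℝ, 0 < γ ∧ ∀ (V : Type u) [Fintype V] (G : SimpleGraph V) (p : ℝ), Psr G k τ p γ →
      ∀ (T : Finset V) (𝒰 : Finset (Finset V)) (a b : ℕ), a + b ≤ τ → 𝒰.card ≤ M →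
        c * (p ^ b * order V) ≤ T.card →
        (∀ U ∈ 𝒰, Disjoint U T ∧ c * (p ^ a * order V) ≤ U.card) →
        ∃ v ∈ T, ∀ U ∈ 𝒰, p / 2 * U.card ≤ (nb G U v).card := by
  refine ⟨c * (c / (2 * (M + 1))) / 4, by positivity, ?_⟩
  intro V _ G p h T 𝒰 a b hab h𝒰 hT hU
  by_contra hcon
  push Not at hcon
  have hsub : T ⊆ 𝒰.biUnion (fun U => T.filter (fun v => ((nb G U v).card : ℝ) ≤ p / 2 * U.card)) := by
    intro v hv
    obtain ⟨U, hU, hlt⟩ := hcon v hv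
    exact mem_biUnion.2 ⟨U, hU, mem_filter.2 ⟨hv, hlt.le⟩⟩
  have h3 : (T.card : ℝ) ≤ M * (c / (2 * (M + 1)) * (p ^ b * order V)) := by
    calc (T.card : ℝ) ≤ ∑ U ∈ 𝒰,
            ((T.filter (fun v => ((nb G U v).card : ℝ) ≤ p / 2 * U.card)).card : ℝ) := by
          exact_mod_cast (card_le_card hsub).trans card_biUnion_le
      _ ≤ 𝒰.card * (c / (2 * (M + 1)) * (p ^ b * order V)) := by
          rw [← nsmul_eq_mul]
          refine sum_le_card_nsmul _ _ _ fun U hUm => ?_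
          refine h.low_filter (δ := 1/2) (a := a) hc (by norm_num) (hU U hUm).2 hab (by linarith)
            (disjoint_of_subset_right (filter_subset _ _) (hU U hUm).1) fun v hv => ?_
          have := (mem_filter.1 hv).2
          linarith
      _ ≤ _ := by
          have := h.pow_mul_pos b
          gcongr
  have h4 : M * (c / (2 * (M + 1))) < c := by
    rw [mul_div_assoc', div_lt_iff₀ (by positivity)]
    nlinarith [(Nat.cast_nonneg M : (0:ℝ) ≤ M)]
  have h5 := h.pow_mul_pos b
  nlinarith

/-- Take `v` in `T` with many neighbours in `A` and a full path power on `2k` vertices inside that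
neighbourhood: it remains one with `v` inserted in the middle. The path costs `2k + 1 ≤ τ`, which is
where `k ≥ 3` enters. -/
theorem hasGadgets_of_three_le {k τ : ℕ} (hk : 3 ≤ k) (hτ : 3 * k ≤ τ + 2) :
    HasGadgets.{u} k τ := by
  intro c M hc
  obtain ⟨γ₁, hγ₁, H₁⟩ := exists_typical_vertex.{u} (k := k) (τ := τ) 1 hc
  obtain ⟨c', γ₂, hc', hγ₂, H₂⟩ := exists_path_piece.{u} k τ (2 * k) M 1 (c := c / 2)
    (by positivity) (by omega) (by omega) (by omega) (by omega)
  refine ⟨c', min γ₁ γ₂, 2 * k + 1, hc', by positivity, ?_⟩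
  intro V _ G p h T A 𝒰 hTA hT hA h𝒰 hU
  have hp := h.p_pos
  have hn := h.order_pos
  obtain ⟨v, hvT, hv⟩ := H₁ V G p (h.mono (min_le_left _ _)) T {A} 0 0 (by omega) (by simp)
    (by simpa using hT) (by simpa using ⟨hTA.symm, hA⟩)
  have hvA := hv A (by simp)
  obtain ⟨l, hl, hnd, hkp, hlA, hext⟩ := H₂ V G p (h.mono (min_le_right _ _)) (nb G A v) 𝒰 h𝒰
    (by
      calc c / 2 * (p ^ 1 * order V) = p / 2 * (c * order V) := by ring
        _ ≤ p / 2 * A.card := by gcongr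
        _ ≤ _ := hvA)
    (fun U hUm => le_trans (by gcongr; linarith) (hU U hUm))
  have hvl : v ∉ l := fun hv => G.loopless.irrefl v (mem_nb.1 (hlA v hv)).2
  have hfl := Flex.of_two_lists (k := k) (l' := l.take k ++ v :: l.drop k) hnd hkp
    (KP_insert hl (fun i j hj hij hr => hkp i j hj hij hr.1) fun w hw => (mem_nb.1 (hlA w hw)).2)
    (by omega) (by
      refine List.perm_middle.trans ?_
      rw [List.take_append_drop]) hvl (take_insert hl) (take_reverse_insert hl)
  refine ⟨v, _, _, _, hvT, hfl, ?_, ?_, fun U hUm => ?_⟩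
  · refine insert_subset_insert _ fun w hw => ?_
    exact (mem_nb.1 (hlA w (List.mem_toFinset.1 hw))).1
  · refine (card_insert_le _ _).trans ?_
    rw [List.toFinset_card_of_nodup hnd, hl]
  · rw [Extd_take, Extd_take]
    exact hext U hUm

end

/-! ### Nested majority quantifiers over cliques -/

section

variable {V : Type u} {G : SimpleGraph V}

/-- A property holds for most cliques with one vertex in each member of the list: for most first
vertices, most choices of the second vertex in the neighbourhood of the first, and so on. -/
def Most (G : SimpleGraph V) (δ : ℝ) : List (Finset V) → (List V → Prop) → Prop
  | [], P => P []
  | D :: Ds, P => D.Nonempty ∧ (1 - δ) * D.card ≤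
      (D.filter (fun a => Most G δ (Ds.map (fun B => nb G B a)) (fun l => P (a :: l)))).card
termination_by l => l.length
decreasing_by all_goals simp

theorem most_nil {δ : ℝ} {P : List V → Prop} : Most G δ [] P ↔ P [] := by rw [Most]

theorem most_cons {δ : ℝ} {D : Finset V} {Ds : List (Finset V)} {P : List V → Prop} :
    Most G δ (D :: Ds) P ↔ D.Nonempty ∧ (1 - δ) * D.card ≤
      (D.filter (fun a => Most G δ (Ds.map (fun B => nb G B a)) (fun l => P (a :: l)))).card := by
  rw [Most]

theorem Most.mono {δ δ' : ℝ} (hδ : δ ≤ δ') {Ds : List (Finset V)} {P P' : List V → Prop}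
    (hP : ∀ l, P l → P' l) (h : Most G δ Ds P) : Most G δ' Ds P' := by
  induction hm : Ds.length generalizing Ds P P' with
  | zero =>
    rw [List.length_eq_zero_iff] at hm
    subst hm
    rw [most_nil] at h ⊢
    exact hP _ h
  | succ m ih =>
    obtain ⟨D, Ds, rfl⟩ := List.exists_cons_of_length_eq_add_one hm
    rw [most_cons] at h ⊢
    refine ⟨h.1, ?_⟩
    calc (1 - δ') * (D.card : ℝ) ≤ (1 - δ) * D.card := by gcongr
      _ ≤ _ := h.2
      _ ≤ _ := by
        gcongr with a ha
        exact fun h => ih (fun l hl => hP _ hl) h (by simpa using hm)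

/-- Each recursive call has passed to neighbourhoods of the vertices chosen before, so the tuples
quantified over are automatically cliques with one vertex in each set. -/
theorem Most.and_mem {δ : ℝ} {Ds : List (Finset V)} {P : List V → Prop} (h : Most G δ Ds P) :
    Most G δ Ds (fun l => P l ∧ List.Forall₂ (· ∈ ·) l Ds ∧ l.Pairwise G.Adj) := by
  induction hm : Ds.length generalizing Ds P with
  | zero =>
    rw [List.length_eq_zero_iff] at hm
    subst hm
    rw [most_nil] at h ⊢
    exact ⟨h, List.Forall₂.nil, List.Pairwise.nil⟩
  | succ m ih =>
    obtain ⟨D, Ds, rfl⟩ := List.exists_cons_of_length_eq_add_one hm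
    rw [most_cons] at h ⊢
    refine ⟨h.1, h.2.trans ?_⟩
    norm_cast
    refine card_le_card fun a ha => ?_
    rw [mem_filter] at ha ⊢
    refine ⟨ha.1, (ih ha.2 (by simpa using hm)).mono le_rfl ?_⟩
    rintro l ⟨h1, h2, h3⟩
    rw [List.forall₂_map_right_iff] at h2
    have h4 : ∀ w ∈ l, G.Adj a w := by
      intro w hw
      obtain ⟨i, hi, rfl⟩ := List.mem_iff_getElem.1 hw
      have := h2.get (i := i) hi (h2.length_eq ▸ hi)
      exact (mem_nb.1 this).2
    exact ⟨h1, List.Forall₂.cons ha.1 (h2.imp fun w B hw => (mem_nb.1 hw).1),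
      List.pairwise_cons.2 ⟨h4, h3⟩⟩

/-- At every level two subsets, each of more than half of the same set, intersect. Both properties
must be quantified in the same order of sets. -/
theorem Most.exists_and {δ : ℝ} (hδ : δ < 1 / 2) {Ds : List (Finset V)} {P P' : List V → Prop}
    (h : Most G δ Ds P) (h' : Most G δ Ds P') : ∃ l, P l ∧ P' l := by
  induction hm : Ds.length generalizing Ds P P' with
  | zero =>
    rw [List.length_eq_zero_iff] at hm
    subst hm
    rw [most_nil] at h h'
    exact ⟨_, h, h'⟩
  | succ m ih =>
    obtain ⟨D, Ds, rfl⟩ := List.exists_cons_of_length_eq_add_one hm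
    rw [most_cons] at h h'
    set X := D.filter (fun a => Most G δ (Ds.map (fun B => nb G B a)) (fun l => P (a :: l)))
    set X' := D.filter (fun a => Most G δ (Ds.map (fun B => nb G B a)) (fun l => P' (a :: l)))
    have hne : (X ∩ X').Nonempty := by
      rw [← card_pos]
      by_contra hc
      have h1 : (X ∪ X').card ≤ D.card :=
        card_le_card (union_subset (filter_subset _ _) (filter_subset _ _))
      have h2 := card_union_add_card_inter X X'
      have h3 : X.card + X'.card ≤ D.card := by omega
      have h4 : (X.card : ℝ) + X'.card ≤ D.card := by exact_mod_cast h3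
      have h5 : (0:ℝ) < D.card := by exact_mod_cast h.1.card_pos
      nlinarith [h.2, h'.2]
    obtain ⟨a, ha⟩ := hne
    obtain ⟨ha1, ha2⟩ := mem_inter.1 ha
    obtain ⟨l, hl⟩ := ih (mem_filter.1 ha1).2 (mem_filter.1 ha2).2 (by simpa using hm)
    exact ⟨_, hl⟩

/-- The atypical vertices of `D` with respect to a list of sets. -/
noncomputable def atyp (G : SimpleGraph V) (p : ℝ) (D : Finset V) (Bs : List (Finset V)) :
    Finset V :=
  D.filter (fun v => ∃ B ∈ Bs, ((nb G B v).card : ℝ) < p / 2 * B.card)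

theorem not_mem_atyp {p : ℝ} {D : Finset V} {Bs : List (Finset V)} {v : V} (hv : v ∈ D)
    (h : v ∉ atyp G p D Bs) : ∀ B ∈ Bs, p / 2 * B.card ≤ (nb G B v).card := by
  intro B hB
  by_contra hc
  exact h (mem_filter.2 ⟨hv, B, hB, not_le.1 hc⟩)

theorem pairwise_disjoint_map {Ds : List (Finset V)} (h : Ds.Pairwise Disjoint) (a : V) :
    (Ds.map (fun B => nb G B a)).Pairwise Disjoint := by
  rw [List.pairwise_map]
  exact h.imp fun hd => disjoint_of_subset_left (nb_subset _ _)
    (disjoint_of_subset_right (nb_subset _ _) hd)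

theorem card_filter_sdiff_ge {D X : Finset V} {Q : V → Prop} [DecidablePred Q] {δ : ℝ}
    (hX : (X.card : ℝ) ≤ δ * D.card) (hQ : ∀ a ∈ D, a ∉ X → Q a) :
    (1 - δ) * D.card ≤ (D.filter Q).card := by
  have h1 : D ⊆ D.filter Q ∪ X := fun a ha => by
    by_cases h : a ∈ X
    · exact mem_union_right _ h
    · exact mem_union_left _ (mem_filter.2 ⟨ha, hQ a ha h⟩)
  have h2 : (D.card : ℝ) ≤ (D.filter Q).card + X.card := by
    exact_mod_cast (card_le_card h1).trans (card_union_le _ _)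
  linarith

theorem card_filter_and_ge {D X : Finset V} {P Q : V → Prop} [DecidablePred P] [DecidablePred Q]
    {δ₁ δ₂ : ℝ}
    (hP : (1 - δ₁) * D.card ≤ (D.filter P).card)
    (hX : (X.card : ℝ) ≤ δ₂ * D.card) (hQ : ∀ a ∈ D, P a → a ∉ X → Q a) :
    (1 - (δ₁ + δ₂)) * D.card ≤ (D.filter Q).card := by
  have h1 : D.filter P ⊆ D.filter Q ∪ X := fun a ha => by
    by_cases h : a ∈ X
    · exact mem_union_right _ h
    · obtain ⟨h1, h2⟩ := mem_filter.1 ha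
      exact mem_union_left _ (mem_filter.2 ⟨h1, hQ a h1 h2 h⟩)
  have h2 : ((D.filter P).card : ℝ) ≤ (D.filter Q).card + X.card := by
    exact_mod_cast (card_le_card h1).trans (card_union_le _ _)
  linarith

/-- Lower bounds `c p ^ (q - j) n` on the sizes of the sets in a list. -/
def Sz [Fintype V] (p c : ℝ) : ℕ → List (Finset V) → Prop
  | _, [] => True
  | q, D :: Ds => c * (p ^ q * order V) ≤ D.card ∧ Sz p c (q - 1) Ds

variable [Fintype V] {k τ : ℕ} {p γ : ℝ}

theorem Psr.sz_mem (h : Psr G k τ p γ) {c : ℝ} (hc : 0 ≤ c) {q : ℕ} {Ds : List (Finset V)}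
    (hs : Sz p c q Ds) : ∀ B ∈ Ds, c * (p ^ q * order V) ≤ B.card := by
  induction Ds generalizing q with
  | nil => simp
  | cons D Ds ih =>
    intro B hB
    rcases List.mem_cons.1 hB with rfl | hB
    · exact hs.1
    · refine le_trans ?_ (ih hs.2 B hB)
      have := h.pow_le (Nat.sub_le q 1)
      have := h.order_pos
      gcongr

theorem Psr.sz_of_forall (h : Psr G k τ p γ) {c : ℝ} (hc : 0 ≤ c) {e q : ℕ}
    {Ds : List (Finset V)} (hs : ∀ B ∈ Ds, c * (p ^ e * order V) ≤ B.card)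
    (hq : Ds.length + e ≤ q + 1) : Sz p c q Ds := by
  induction Ds generalizing q with
  | nil => trivial
  | cons D Ds ih =>
    rw [List.length_cons] at hq
    refine ⟨(le_trans ?_ (hs D (by simp))), ?_⟩
    · have := h.pow_le (show e ≤ q by omega)
      have := h.order_pos
      gcongr
    · rcases Ds with _ | ⟨D', Ds⟩
      · trivial
      · refine ih (fun B hB => hs B (by simp [hB])) ?_
        rw [List.length_cons] at hq ⊢
        omega

/-- Restricting to a neighbourhood raises every exponent by one; `Ds.length ≤ q` prevents the
truncated subtraction in `Sz` from interfering. Applied to the tail of a list of level `q`, it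
restores that level. -/
theorem Psr.sz_map (h : Psr G k τ p γ) {c : ℝ} {q : ℕ} {Ds : List (Finset V)}
    (hs : Sz p c q Ds) (hq : Ds.length ≤ q) {a : V}
    (ha : ∀ B ∈ Ds, p / 2 * B.card ≤ (nb G B a).card) :
    Sz p (c / 2) (q + 1) (Ds.map (fun B => nb G B a)) := by
  induction Ds generalizing q with
  | nil => trivial
  | cons D Ds ih =>
    rw [List.length_cons] at hq
    have hp := h.p_pos
    refine ⟨?_, ?_⟩
    · calc c / 2 * (p ^ (q + 1) * order V) = p / 2 * (c * (p ^ q * order V)) := by ring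
        _ ≤ p / 2 * D.card := by have := hs.1; gcongr
        _ ≤ _ := ha D (by simp)
    · have := ih hs.2 (by omega) (fun B hB => ha B (by simp [hB]))
      rwa [show q - 1 + 1 = q by omega] at this

theorem Psr.card_atyp_le (h : Psr G k τ p γ) {c : ℝ} (hc : 0 < c) {a b : ℕ} (hab : a + b ≤ τ)
    {D : Finset V} {Bs : List (Finset V)} (hBs : ∀ B ∈ Bs, c * (p ^ a * order V) ≤ B.card)
    (hd : ∀ B ∈ Bs, Disjoint D B) {θ : ℝ} (hθ : 4 * γ * Bs.length ≤ c * c * θ)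
    (hD : c * (p ^ b * order V) ≤ D.card) :
    ((atyp G p D Bs).card : ℝ) ≤ θ * D.card := by
  have hγ := h.gamma_pos
  have hb := h.pow_mul_pos b
  induction Bs generalizing θ with
  | nil =>
    have hθ0 : 0 ≤ θ := by
      simp at hθ
      by_contra hneg
      nlinarith [mul_pos hc hc]
    have : atyp G p D [] = ∅ := by simp [atyp]
    rw [this]; simp; positivity
  | cons B Bs ih =>
    have h1 := ih (θ := θ - 4 * γ / (c * c)) (fun B' hB' => hBs B' (by simp [hB']))
      (fun B' hB' => hd B' (by simp [hB'])) (by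
        push_cast [List.length_cons] at hθ
        have : c * c * (θ - 4 * γ / (c * c)) = c * c * θ - 4 * γ := by field_simp
        rw [this]; linarith)
    set X := D.filter (fun v => ((nb G B v).card : ℝ) < p / 2 * B.card)
    have h2 : (X.card : ℝ) ≤ 4 * γ / c * (p ^ b * order V) := by
      refine h.low_filter (δ := 1/2) (a := a) hc (by norm_num) (hBs B (by simp)) hab ?_
        (disjoint_of_subset_right (filter_subset _ _) (hd B (by simp)).symm) fun v hv => ?_
      · field_simp; norm_num
      · have := (mem_filter.1 hv).2
        linarith
    have h3 : atyp G p D (B :: Bs) ⊆ X ∪ atyp G p D Bs := by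
      intro v hv
      obtain ⟨hvD, B', hB', hlt⟩ := mem_filter.1 hv
      rcases List.mem_cons.1 hB' with rfl | hB'
      · exact mem_union_left _ (mem_filter.2 ⟨hvD, hlt⟩)
      · exact mem_union_right _ (mem_filter.2 ⟨hvD, B', hB', hlt⟩)
    have h4 : ((atyp G p D (B :: Bs)).card : ℝ) ≤ X.card + (atyp G p D Bs).card := by
      exact_mod_cast (card_le_card h3).trans (card_union_le _ _)
    have h5 : 4 * γ / c * (p ^ b * order V) ≤ 4 * γ / (c * c) * D.card := by
      calc 4 * γ / c * (p ^ b * order V) = 4 * γ / (c * c) * (c * (p ^ b * order V)) := by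
            field_simp
        _ ≤ _ := by gcongr
    linarith

theorem Psr.nonempty_of_le (h : Psr G k τ p γ) {c : ℝ} (hc : 0 < c) {a : ℕ} {D : Finset V}
    (hD : c * (p ^ a * order V) ≤ D.card) : D.Nonempty := by
  rw [← card_pos]
  have := mul_pos hc (h.pow_mul_pos a)
  exact_mod_cast this.trans_le hD

/-- The assertion is that cliques abound. The first set has exponent `q`, the others at most `q -
1`, and `2q - 1 ≤ τ`; inside the neighbourhood of a typical first vertex the remaining sets again
have level `q`. -/
theorem most_true (k τ m : ℕ) {c δ : ℝ} (hc : 0 < c) (hδ : 0 < δ) :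
    ∃ γ : ℝ, 0 < γ ∧ ∀ (V : Type u) [Fintype V] (G : SimpleGraph V) (p : ℝ), Psr G k τ p γ →
      ∀ (q : ℕ) (Ds : List (Finset V)), Ds.length = m → m ≤ q → 2 * q ≤ τ + 1 → Sz p c q Ds →
        Ds.Pairwise Disjoint → Most G δ Ds (fun _ => True) := by
  induction m generalizing c with
  | zero =>
    refine ⟨1, one_pos, fun V _ G p _ q Ds hDs _ _ _ _ => ?_⟩
    rw [List.length_eq_zero_iff] at hDs
    subst hDs
    rw [most_nil]; trivial
  | succ m ih =>
    obtain ⟨γ, hγ, H⟩ := ih (c := c / 2) (by positivity)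
    refine ⟨min γ (c * c * δ / (4 * (m + 1))), by positivity, ?_⟩
    intro V _ G p h q Ds hDs hmq hq hs hd
    obtain ⟨D, Ds, rfl⟩ := List.exists_cons_of_length_eq_add_one hDs
    have hDs' : Ds.length = m := by simpa using hDs
    rw [most_cons]
    refine ⟨h.nonempty_of_le hc hs.1, card_filter_sdiff_ge (X := atyp G p D Ds) ?_ ?_⟩
    · refine h.card_atyp_le hc (a := q - 1) (b := q) (by omega) (h.sz_mem hc.le hs.2)
        (List.pairwise_cons.1 hd).1 ?_ hs.1
      calc 4 * min γ (c * c * δ / (4 * (m + 1))) * Ds.length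
          ≤ 4 * (c * c * δ / (4 * (m + 1))) * (m + 1) := by
            rw [hDs']; gcongr
            · exact min_le_right _ _
            · linarith
        _ = _ := by field_simp
    · intro a ha hat
      have := h.sz_map hs.2 (by omega) (not_mem_atyp ha hat)
      rw [show q - 1 + 1 = q by omega] at this
      exact H V G p (h.mono (min_le_left _ _)) q _ (by simpa using hDs') (by omega) hq this
        (pairwise_disjoint_map (List.pairwise_cons.1 hd).2 a)

end

/-! ### Changing the order of majority quantifiers -/

section

/-- Here `q` is `p|A|`, `b` is `|B|` and `w` counts the failing vertices of `B` of normal degree.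
The two sides bound the good edges from below and above; their gap is at most `5δb = δ'²b/4`, while
each failing vertex wastes about `δ'`. -/
theorem swap_arith {δ δ' q w b : ℝ} (hδ' : 0 < δ') (hδ1 : δ' ≤ 1) (hδ : δ = δ' ^ 2 / 20)
    (hq : 0 < q) (hw : 0 ≤ w)
    (h : q * ((1 - 2 * δ) * (1 - δ) * (1 - δ) * b) ≤ q * ((1 + δ) * b - δ' * (1 - δ) * w))
    (hb : 0 < b := by positivity) : w ≤ δ' / 2 * b := by
  have hδ0 : 0 < δ := by rw [hδ]; positivity
  have hδδ : δ ≤ δ' / 20 := by rw [hδ]; nlinarith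
  have h3 := le_of_mul_le_mul_left h hq
  have h4 : 1 - 4 * δ ≤ (1 - 2 * δ) * (1 - δ) * (1 - δ) := by
    nlinarith [mul_pos hδ0 hδ0, mul_pos (mul_pos hδ0 hδ0) hδ0]
  have h4b := mul_le_mul_of_nonneg_right h4 hb.le
  have hmain : δ' * (1 - δ) * w ≤ 5 * δ * b := by linarith
  have h2 : δ' * w ≤ δ' * (δ' / 2 * b) := by
    have : 5 * δ * b = δ' ^ 2 / 4 * b := by rw [hδ]; ring
    rw [this] at hmain
    have h5 : δ' * w / 2 ≤ δ' * (1 - δ) * w := by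
      nlinarith [mul_nonneg hδ'.le hw]
    nlinarith
  exact le_of_mul_le_mul_left h2 hδ'

/-- Exchanging the order of two "most" quantifiers over a bipartite graph. -/
theorem exists_most_swap (k τ : ℕ) {c δ' : ℝ} (hc : 0 < c) (hδ' : 0 < δ') (hδ1 : δ' ≤ 1) :
    ∃ δ γ : ℝ, 0 < δ ∧ δ ≤ δ' ∧ 0 < γ ∧
      ∀ (V : Type u) [Fintype V] (G : SimpleGraph V) (p : ℝ), Psr G k τ p γ →
      ∀ (A B : Finset V) (a b : ℕ) (F : V → V → Prop), a + b ≤ τ → Disjoint A B →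
        c * (p ^ a * order V) ≤ A.card → c * (p ^ b * order V) ≤ B.card →
        (1 - δ) * A.card ≤ (A.filter (fun x => (1 - δ) * (nb G B x).card ≤
          ((nb G B x).filter (fun y => F x y)).card)).card →
        (1 - δ') * B.card ≤ (B.filter (fun y => (1 - δ') * (nb G A y).card ≤
          ((nb G A y).filter (fun x => F x y)).card)).card := by
  set δ : ℝ := δ' ^ 2 / 20 with hδ
  have hδ0 : 0 < δ := by positivity
  have hδδ : δ ≤ δ' / 20 := by rw [hδ]; nlinarith
  refine ⟨δ, δ ^ 2 * c * (c * δ), hδ0, by linarith, by positivity, ?_⟩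
  intro V _ G p h A B a b F hab hd hA hB hF
  have hp := h.p_pos
  have hn := h.order_pos
  set X := A.filter (fun x => (1 - δ) * ((nb G B x).card : ℝ) ≤
          ((nb G B x).filter (fun y => F x y)).card) with hX
  set Y := B.filter (fun y => (1 - δ') * ((nb G A y).card : ℝ) ≤
          ((nb G A y).filter (fun x => F x y)).card) with hY
  have hAx : 0 < (A.card : ℝ) := (mul_pos hc (h.pow_mul_pos a)).trans_le hA
  have hBx : 0 < (B.card : ℝ) := (mul_pos hc (h.pow_mul_pos b)).trans_le hB
  -- the double count
  have hdc : ∑ x ∈ A, (((nb G B x).filter (fun y => F x y)).card : ℝ) =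
      ∑ y ∈ B, (((nb G A y).filter (fun x => F x y)).card : ℝ) := by
    simp only [nb, filter_filter, card_filter, Nat.cast_sum]
    rw [sum_comm]
    refine sum_congr rfl fun b _ => sum_congr rfl fun a _ => ?_
    simp [G.adj_comm]
  -- low degree vertices of `A`
  set Z := A.filter (fun x => ((nb G B x).card : ℝ) ≤ (1 - δ) * (p * B.card)) with hZ
  have hZc : (Z.card : ℝ) ≤ δ * A.card := by
    have := h.low_filter (A := B) (B := Z) (a := b) (b := a) (θ := c * δ) hc hδ0 hB (by omega) le_rfl
      (disjoint_of_subset_right (filter_subset _ _) hd.symm) (fun v hv => (mem_filter.1 hv).2)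
    nlinarith
  set W := B.filter (fun y => ((nb G A y).card : ℝ) ≤ (1 - δ) * (p * A.card)) with hW
  have hWc : (W.card : ℝ) ≤ δ * B.card := by
    have := h.low_filter (A := A) (B := W) (θ := c * δ) hc hδ0 hA (by omega) le_rfl
      (disjoint_of_subset_right (filter_subset _ _) hd) (fun v hv => (mem_filter.1 hv).2)
    nlinarith
  -- Good edges counted from `A`: all but `2δ|A|` vertices are good and have nearly full degree.
  have hlow : (1 - 2 * δ) * A.card * ((1 - δ) * ((1 - δ) * (p * B.card))) ≤
      ∑ x ∈ A, (((nb G B x).filter (fun y => F x y)).card : ℝ) := by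
    have h1 : (1 - 2 * δ) * A.card ≤ ((X \ Z).card : ℝ) := by
      have : (X.card : ℝ) ≤ (X \ Z).card + Z.card := by
        exact_mod_cast card_le_card_sdiff_add_card
      linarith
    have h0 : 0 ≤ (1 - δ) * ((1 - δ) * (p * B.card)) := by
      have : 0 ≤ 1 - δ := by linarith
      positivity
    calc _ ≤ ((X \ Z).card : ℝ) * ((1 - δ) * ((1 - δ) * (p * B.card))) := by gcongr
      _ ≤ ∑ x ∈ X \ Z, (((nb G B x).filter (fun y => F x y)).card : ℝ) := by
        rw [← nsmul_eq_mul]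
        refine card_nsmul_le_sum _ _ _ fun x hx => ?_
        obtain ⟨hx1, hx2⟩ := mem_sdiff.1 hx
        obtain ⟨hxA, hx3⟩ := mem_filter.1 hx1
        refine le_trans ?_ hx3
        have h4 : (1 - δ) * (p * B.card) ≤ (nb G B x).card := by
          by_contra hcon
          exact hx2 (mem_filter.2 ⟨hxA, (not_le.1 hcon).le⟩)
        have : 0 ≤ 1 - δ := by linarith
        gcongr
      _ ≤ _ := sum_le_sum_of_subset_of_nonneg (sdiff_subset.trans (filter_subset _ _))
          (fun _ _ _ => by positivity)
  -- Good edges counted from `B`: a failing vertex of normal degree loses a proportion `δ'` of its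
  -- edges.
  have hup : ∑ y ∈ B, (((nb G A y).filter (fun x => F x y)).card : ℝ) ≤
      ∑ y ∈ B, ((nb G A y).card : ℝ) - δ' * ((1 - δ) * (p * A.card)) * ((B \ Y) \ W).card := by
    have h1 : ∑ y ∈ (B \ Y) \ W, (δ' * ((1 - δ) * (p * A.card))) ≤
        ∑ y ∈ B, (((nb G A y).card : ℝ) - ((nb G A y).filter (fun x => F x y)).card) := by
      calc _ ≤ ∑ y ∈ (B \ Y) \ W,
            (((nb G A y).card : ℝ) - ((nb G A y).filter (fun x => F x y)).card) := by
            refine sum_le_sum fun y hy => ?_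
            obtain ⟨hy1, hy2⟩ := mem_sdiff.1 hy
            obtain ⟨hyB, hyY⟩ := mem_sdiff.1 hy1
            have h3 : ((nb G A y).filter (fun x => F x y)).card < (1 - δ') * ((nb G A y).card : ℝ) := by
              by_contra hcon
              exact hyY (mem_filter.2 ⟨hyB, not_lt.1 hcon⟩)
            have h4 : (1 - δ) * (p * A.card) ≤ (nb G A y).card := by
              by_contra hcon
              exact hy2 (mem_filter.2 ⟨hyB, (not_le.1 hcon).le⟩)
            have : δ' * ((1 - δ) * (p * A.card)) ≤ δ' * (nb G A y).card := by gcongr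
            linarith
        _ ≤ _ := by
            refine sum_le_sum_of_subset_of_nonneg (sdiff_subset.trans sdiff_subset) ?_
            intro y _ _
            rw [sub_nonneg]
            exact_mod_cast card_filter_le _ _
    rw [sum_const, nsmul_eq_mul, sum_sub_distrib] at h1
    linarith
  have hedge : ∑ y ∈ B, ((nb G A y).card : ℝ) ≤ (1 + δ) * (p * A.card * B.card) := by
    rw [← sum_nb_comm]
    have h1 := h.jum A B hd
    by_contra hcon
    push Not at hcon
    have h2 : (δ * (p * A.card * B.card)) ^ 2 <
        ((∑ a ∈ A, ((nb G B a).card : ℝ)) - p * A.card * B.card) ^ 2 := by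
      apply pow_lt_pow_left₀ (by linarith) (by positivity) (by norm_num)
    have h3 : p ^ τ ≤ p ^ a * p ^ b := by rw [← pow_add]; exact h.pow_le hab
    have h4 : δ ^ 2 * c * (c * δ) * p ^ (τ + 2) * order V ^ 2 * (A.card * B.card) ≤
        (δ * (p * A.card * B.card)) ^ 2 := by
      calc δ ^ 2 * c * (c * δ) * p ^ (τ + 2) * order V ^ 2 * (A.card * B.card)
          = δ ^ 2 * δ * (c * c * p ^ τ * order V ^ 2) * p ^ 2 * (A.card * B.card) := by ring
        _ ≤ δ ^ 2 * 1 * (c * c * (p ^ a * p ^ b) * order V ^ 2) * p ^ 2 * (A.card * B.card) := by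
            gcongr
            linarith
        _ = δ ^ 2 * ((c * (p ^ a * order V)) * (c * (p ^ b * order V))) * p ^ 2 *
              (A.card * B.card) := by ring
        _ ≤ δ ^ 2 * (A.card * B.card) * p ^ 2 * (A.card * B.card) := by gcongr
        _ = _ := by ring
    linarith
  rw [hdc] at hlow
  have hfin : (B.card : ℝ) ≤ Y.card + (((B \ Y) \ W).card + W.card) := by
    have h1 : B ⊆ Y ∪ (((B \ Y) \ W) ∪ W) := fun y hy => by
      simp only [mem_union, mem_sdiff]
      tauto
    exact_mod_cast (card_le_card h1).trans ((card_union_le _ _).trans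
      (Nat.add_le_add_left (card_union_le _ _) _))
  have hwle := swap_arith (q := p * A.card) (w := ((B \ Y) \ W).card) (b := B.card) hδ' hδ1 hδ
    (by positivity) (by positivity) (by
      have := hlow.trans (hup.trans (sub_le_sub_right hedge _))
      linarith)
  nlinarith

/-- Moving the first vertex of a typical clique to the end. -/
theorem exists_most_move (k τ m : ℕ) {c δ' : ℝ} (hc : 0 < c) (hδ' : 0 < δ') (hδ1 : δ' ≤ 1) :
    ∃ δ γ : ℝ, 0 < δ ∧ δ ≤ δ' ∧ 0 < γ ∧
      ∀ (V : Type u) [Fintype V] (G : SimpleGraph V) (p : ℝ), Psr G k τ p γ →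
      ∀ (a q : ℕ) (A : Finset V) (Ds : List (Finset V)) (P : List V → Prop), Ds.length = m →
        a + m + q ≤ τ + 1 → m ≤ q → 2 * q ≤ τ + 1 → c * (p ^ a * order V) ≤ A.card →
        Sz p c q Ds → (A :: Ds).Pairwise Disjoint → Most G δ (A :: Ds) P →
        Most G δ' (Ds ++ [A]) (fun l : List V => ∃ (l' : List V) (x : V), l = l' ++ [x] ∧ P (x :: l')) := by
  induction m generalizing c with
  | zero =>
    refine ⟨δ', 1, hδ', le_rfl, one_pos, fun V _ G p _ a q A Ds P hDs _ _ _ _ _ _ hM => ?_⟩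
    rw [List.length_eq_zero_iff] at hDs
    subst hDs
    rw [List.nil_append]
    rw [most_cons] at hM ⊢
    refine ⟨hM.1, hM.2.trans ?_⟩
    norm_cast
    refine card_le_card fun x hx => ?_
    rw [mem_filter] at hx ⊢
    refine ⟨hx.1, ?_⟩
    have := hx.2
    rw [List.map_nil, most_nil] at this ⊢
    exact ⟨[], x, rfl, this⟩
  | succ m ih =>
    obtain ⟨δ₀, γ₀, hδ₀, hδ₀', hγ₀, H⟩ := ih (c := c / 2) (by positivity)
    obtain ⟨δ, γ₁, hδ, hδle, hγ₁, Hs⟩ := exists_most_swap.{u} k τ (c := c) (δ' := min δ₀ (δ' / 2)) hc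
      (by positivity) ((min_le_right _ _).trans (by linarith))
    have hmin1 : min δ₀ (δ' / 2) ≤ δ₀ := min_le_left _ _
    have hmin2 : min δ₀ (δ' / 2) ≤ δ' / 2 := min_le_right _ _
    refine ⟨δ, min γ₀ (min γ₁ (c * c * (δ' / 2) / (4 * (m + 1)))), hδ, by linarith,
      by positivity, ?_⟩
    intro V _ G p h a q A Ds P hDs hamq hmq hq hA hs hd hM
    obtain ⟨D, Ds, rfl⟩ := List.exists_cons_of_length_eq_add_one hDs
    have hDs' : Ds.length = m := by simpa using hDs
    have h1 := h.mono (min_le_right _ _)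
    have hp := h.p_pos
    have hn := h.order_pos
    rw [most_cons] at hM
    have hdA := (List.pairwise_cons.1 hd).1
    have hdD := List.pairwise_cons.1 (List.pairwise_cons.1 hd).2
    have hsw := Hs V G p (h1.mono (min_le_left _ _)) A D a q
      (fun x y => Most G δ ((Ds.map (fun B => nb G B x)).map (fun B => nb G B y))
        (fun l => P (x :: y :: l))) (by omega) (hdA D (by simp)) hA hs.1 (by
        refine hM.2.trans ?_
        norm_cast
        refine card_le_card fun x hx => ?_
        rw [mem_filter] at hx ⊢
        refine ⟨hx.1, ?_⟩
        have := hx.2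
        rw [List.map_cons, most_cons] at this
        exact this.2)
    rw [List.cons_append, most_cons]
    refine ⟨h.nonempty_of_le hc hs.1, ?_⟩
    -- `D` has exponent `q`; the exponent of `A` and those of the remaining sets are all at most `τ
    -- - q`.
    have hat : ((atyp G p D (A :: Ds)).card : ℝ) ≤ δ' / 2 * D.card := by
      refine h.card_atyp_le hc (a := τ - q) (b := q) (by omega) ?_ ?_ ?_ hs.1
      · intro B hB
        rcases List.mem_cons.1 hB with rfl | hB
        · refine le_trans ?_ hA
          have := h.pow_le (show a ≤ τ - q by omega)
          gcongr
        · refine le_trans ?_ (h.sz_mem hc.le hs.2 B hB)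
          have := h.pow_le (show q - 1 ≤ τ - q by omega)
          gcongr
      · intro B hB
        rcases List.mem_cons.1 hB with rfl | hB
        · exact (hdA D (by simp)).symm
        · exact hdD.1 B hB
      · rw [List.length_cons, hDs']
        have : min γ₀ (min γ₁ (c * c * (δ' / 2) / (4 * (m + 1)))) ≤
          c * c * (δ' / 2) / (4 * (m + 1)) := (min_le_right _ _).trans (min_le_right _ _)
        rw [le_div_iff₀ (by positivity)] at this
        push_cast
        linarith
    refine le_trans ?_ (card_filter_and_ge hsw hat ?_)
    · have : 0 ≤ (D.card : ℝ) := by positivity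
      nlinarith
    · intro y hyD hy hyt
      have htyp := not_mem_atyp hyD hyt
      have hAy : c / 2 * (p ^ (a + 1) * order V) ≤ (nb G A y).card := by
        calc c / 2 * (p ^ (a + 1) * order V) = p / 2 * (c * (p ^ a * order V)) := by ring
          _ ≤ p / 2 * A.card := by gcongr
          _ ≤ _ := htyp A (by simp)
      have hsz := h.sz_map hs.2 (by omega) (fun B hB => htyp B (by simp [hB]))
      rw [show q - 1 + 1 = q by omega] at hsz
      have hdis : (nb G A y :: Ds.map (fun B => nb G B y)).Pairwise Disjoint := by
        refine pairwise_disjoint_map (Ds := A :: Ds) ?_ y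
        exact List.pairwise_cons.2 ⟨fun B hB => hdA B (by simp [hB]), hdD.2⟩
      -- After the swap of `A` and `D` the induction runs inside the neighbourhood of `y`: the
      -- exponent of `A` rises by one, the list is one shorter, and `a + m + q` is unchanged.
      have hfin := H V G p (h.mono (min_le_left _ _)) (a + 1) q (nb G A y)
        (Ds.map (fun B => nb G B y))
        (fun l => ∃ x l'', l = x :: l'' ∧ P (x :: y :: l'')) (by simpa using hDs') (by omega)
        (by omega) hq hAy hsz hdis (by
          rw [most_cons]
          refine ⟨h.nonempty_of_le (by positivity) hAy, ?_⟩
          calc (1 - δ₀) * ((nb G A y).card : ℝ) ≤ (1 - min δ₀ (δ' / 2)) * (nb G A y).card := by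
                gcongr
            _ ≤ _ := hy
            _ ≤ _ := by
              norm_cast
              refine card_le_card fun x hx => ?_
              rw [mem_filter] at hx ⊢
              refine ⟨hx.1, ?_⟩
              have h2 := hx.2
              simp only [List.map_map] at h2 ⊢
              rw [show (fun B => nb G B y) ∘ (fun B => nb G B x) =
                (fun B => nb G B x) ∘ (fun B => nb G B y) from
                funext fun B => nb_comm B x y] at h2
              exact h2.mono (by linarith) (fun l hl => ⟨x, l, rfl, hl⟩))
      rw [List.map_append, List.map_singleton]
      refine hfin.mono le_rfl ?_
      rintro l ⟨l', x, rfl, x', l'', he, hP⟩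
      obtain ⟨rfl, rfl⟩ := List.cons.inj he
      exact ⟨y :: l', x, rfl, hP⟩

/-- Replacing the last vertex by a neighbour in a new set. -/
theorem exists_most_replace_last (k τ m : ℕ) {c δ' : ℝ} (hc : 0 < c) (hδ' : 0 < δ') :
    ∃ δ γ : ℝ, 0 < δ ∧ δ ≤ δ' ∧ 0 < γ ∧
      ∀ (V : Type u) [Fintype V] (G : SimpleGraph V) (p : ℝ), Psr G k τ p γ →
      ∀ (a b q : ℕ) (A B : Finset V) (Ds : List (Finset V)) (P : List V → Prop), Ds.length = m →
        a + m + q ≤ τ + 1 → b + m + q ≤ τ + 1 → m ≤ q → 2 * q ≤ τ + 1 → a + b + 2 * m ≤ τ →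
        c * (p ^ a * order V) ≤ A.card → c * (p ^ b * order V) ≤ B.card → Sz p c q Ds →
        (A :: B :: Ds).Pairwise Disjoint → Most G δ (Ds ++ [A]) P →
        Most G δ' (Ds ++ [B])
          (fun l : List V => ∃ (l' : List V) (x y : V), l = l' ++ [y] ∧ P (l' ++ [x]) ∧ G.Adj x y) := by
  induction m generalizing c with
  | zero =>
    refine ⟨min δ' (1 / 2), c / 2 * (c * δ'), by positivity, min_le_left _ _, by positivity, ?_⟩
    intro V _ G p h a b q A B Ds P hDs _ _ _ _ hab hA hB _ hd hM
    rw [List.length_eq_zero_iff] at hDs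
    subst hDs
    rw [List.nil_append, most_cons] at hM ⊢
    -- At least half of `A` satisfies `P`, so all but few vertices of `B` have a neighbour there. In
    -- the general case `A` and `B` arrive here with exponents `a + m` and `b + m`, hence the
    -- condition `a + b + 2m ≤ τ`.
    set A' := A.filter (fun a => Most G (min δ' (1 / 2)) (List.map (fun B => nb G B a) [])
      (fun l => P (a :: l))) with hA'
    refine ⟨h.nonempty_of_le hc hB,
      card_filter_sdiff_ge (X := B.filter (fun y => nb G A' y = ∅)) ?_ ?_⟩
    · have h1 : c / 2 * (p ^ a * order V) ≤ A'.card := by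
        refine le_trans ?_ hM.2
        have : min δ' (1/2:ℝ) ≤ 1/2 := min_le_right _ _
        nlinarith [mul_pos hc (h.pow_mul_pos a)]
      have := h.empty_filter (A := A') (B := B.filter (fun y => nb G A' y = ∅)) (b := b)
        (by positivity) h1 (by omega) le_rfl
        (disjoint_of_subset_left (filter_subset _ _) (disjoint_of_subset_right (filter_subset _ _)
          ((List.pairwise_cons.1 hd).1 B (by simp)))) (fun v hv => (mem_filter.1 hv).2)
      nlinarith
    · intro y hy hyn
      have hne : (nb G A' y).Nonempty := by
        rw [nonempty_iff_ne_empty]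
        exact fun he => hyn (mem_filter.2 ⟨hy, he⟩)
      obtain ⟨x, hx⟩ := hne
      obtain ⟨hx1, hx2⟩ := mem_nb.1 hx
      have h3 := (mem_filter.1 hx1).2
      rw [List.map_nil, most_nil] at h3 ⊢
      exact ⟨[], x, y, rfl, h3, hx2.symm⟩
  | succ m ih =>
    obtain ⟨δ₀, γ₀, hδ₀, hδ₀', hγ₀, H⟩ := ih (c := c / 2) (by positivity)
    refine ⟨min δ₀ (δ' / 2), min γ₀ (c * c * (δ' / 2) / (4 * (m + 2))), by positivity,
      (min_le_right _ _).trans (by linarith), by positivity, ?_⟩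
    have hmin1 : min δ₀ (δ' / 2) ≤ δ₀ := min_le_left _ _
    have hmin2 : min δ₀ (δ' / 2) ≤ δ' / 2 := min_le_right _ _
    intro V _ G p h a b q A B Ds P hDs hamq hbmq hmq hq hab hA hB hs hd hM
    obtain ⟨D, Ds, rfl⟩ := List.exists_cons_of_length_eq_add_one hDs
    have hDs' : Ds.length = m := by simpa using hDs
    have hp := h.p_pos
    have hn := h.order_pos
    rw [List.cons_append, most_cons] at hM ⊢
    refine ⟨hM.1, ?_⟩
    have hd1 := List.pairwise_cons.1 hd
    have hd2 := List.pairwise_cons.1 hd1.2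
    have hd3 := List.pairwise_cons.1 hd2.2
    have hat : ((atyp G p D (A :: B :: Ds)).card : ℝ) ≤ δ' / 2 * D.card := by
      refine h.card_atyp_le hc (a := τ - q) (b := q) (by omega) ?_ ?_ ?_ hs.1
      · intro C hC
        rcases List.mem_cons.1 hC with rfl | hC
        · refine le_trans ?_ hA
          have := h.pow_le (show a ≤ τ - q by omega)
          gcongr
        rcases List.mem_cons.1 hC with rfl | hC
        · refine le_trans ?_ hB
          have := h.pow_le (show b ≤ τ - q by omega)
          gcongr
        · refine le_trans ?_ (h.sz_mem hc.le hs.2 C hC)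
          have := h.pow_le (show q - 1 ≤ τ - q by omega)
          gcongr
      · intro C hC
        rcases List.mem_cons.1 hC with rfl | hC
        · exact (hd1.1 D (by simp)).symm
        rcases List.mem_cons.1 hC with rfl | hC
        · exact (hd2.1 D (by simp)).symm
        · exact hd3.1 C hC
      · rw [List.length_cons, List.length_cons, hDs']
        have : min γ₀ (c * c * (δ' / 2) / (4 * (m + 2))) ≤
          c * c * (δ' / 2) / (4 * (m + 2)) := min_le_right _ _
        rw [le_div_iff₀ (by positivity)] at this
        push_cast
        linarith
    refine le_trans ?_ (card_filter_and_ge hM.2 hat ?_)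
    · have : 0 ≤ (D.card : ℝ) := by positivity
      nlinarith
    · intro y hyD hy hyt
      have htyp := not_mem_atyp hyD hyt
      have hgrow : ∀ (e : ℕ) (C : Finset V), C ∈ A :: B :: Ds → c * (p ^ e * order V) ≤ C.card →
          c / 2 * (p ^ (e + 1) * order V) ≤ (nb G C y).card := fun e C hC hCe => by
        calc c / 2 * (p ^ (e + 1) * order V) = p / 2 * (c * (p ^ e * order V)) := by ring
          _ ≤ p / 2 * C.card := by gcongr
          _ ≤ _ := htyp C hC
      have hsz := h.sz_map hs.2 (by omega) (fun C hC => htyp C (by simp [hC]))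
      rw [show q - 1 + 1 = q by omega] at hsz
      rw [List.map_append, List.map_singleton] at hy ⊢
      refine (H V G p (h.mono (min_le_left _ _)) (a + 1) (b + 1) q (nb G A y) (nb G B y)
        (Ds.map (fun C => nb G C y)) (fun l => P (y :: l)) (by simpa using hDs') (by omega)
        (by omega) (by omega) hq (by omega) (hgrow a A (by simp) hA) (hgrow b B (by simp) hB) hsz
        (pairwise_disjoint_map (Ds := A :: B :: Ds) (List.pairwise_cons.2
          ⟨fun C hC => hd1.1 C (by
            rcases List.mem_cons.1 hC with rfl | hC
            · simp
            · simp [hC]), List.pairwise_cons.2 ⟨fun C hC => hd2.1 C (by simp [hC]), hd3.2⟩⟩) y)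
        (hy.mono hmin1 fun _ h => h)).mono le_rfl ?_
      rintro l ⟨l', x, z, rfl, hP, hxz⟩
      exact ⟨y :: l', x, z, rfl, hP, hxz⟩

/-- Reversing the order of the "most" quantifiers. -/
theorem exists_most_reverse (k τ m : ℕ) {c δ' : ℝ} (hc : 0 < c) (hδ' : 0 < δ') (hδ1 : δ' ≤ 1) :
    ∃ δ γ : ℝ, 0 < δ ∧ δ ≤ δ' ∧ 0 < γ ∧
      ∀ (V : Type u) [Fintype V] (G : SimpleGraph V) (p : ℝ), Psr G k τ p γ →
      ∀ (e K : ℕ) (Ds : List (Finset V)) (P : List V → Prop), Ds.length = m →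
        e + m ≤ K → 2 * K ≤ τ + 1 → (∀ D ∈ Ds, c * (p ^ e * order V) ≤ D.card) →
        Ds.Pairwise Disjoint → Most G δ Ds P →
        Most G δ' Ds.reverse (fun l => P l.reverse) := by
  induction m generalizing c δ' with
  | zero =>
    refine ⟨δ', 1, hδ', le_rfl, one_pos, fun V _ G p _ e K Ds P hDs _ _ _ _ hM => ?_⟩
    rw [List.length_eq_zero_iff] at hDs
    subst hDs
    rw [List.reverse_nil, most_nil]
    rw [most_nil] at hM
    exact hM
  | succ m ih =>
    obtain ⟨δ₁, γ₁, hδ₁, hδ₁', hγ₁, Hm⟩ := exists_most_move.{u} k τ m hc hδ' hδ1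
    obtain ⟨δ₀, γ₀, hδ₀, hδ₀', hγ₀, H⟩ := ih (c := c / 2) (δ' := δ₁ / 2) (by positivity)
      (by positivity) (by linarith)
    refine ⟨min δ₀ (δ₁ / 2), min γ₀ (min γ₁ (c * c * (δ₁ / 2) / (4 * (m + 1)))), by positivity,
      (min_le_right _ _).trans (by linarith), by positivity, ?_⟩
    have hmin1 : min δ₀ (δ₁ / 2) ≤ δ₀ := min_le_left _ _
    have hmin2 : min δ₀ (δ₁ / 2) ≤ δ₁ / 2 := min_le_right _ _
    intro V _ G p h e K Ds P hDs hem hK hs hd hM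
    obtain ⟨A, Ds, rfl⟩ := List.exists_cons_of_length_eq_add_one hDs
    have hDs' : Ds.length = m := by simpa using hDs
    have h1 := h.mono (min_le_right _ _)
    have hp := h.p_pos
    have hd1 := List.pairwise_cons.1 hd
    have hA := hs A (by simp)
    -- The tail is reversed by induction inside the neighbourhood of a typical first vertex;
    -- afterwards `exists_most_move` carries that vertex to the end.
    have key : Most G δ₁ (A :: Ds.reverse) (fun l => ∃ x l', l = x :: l' ∧ P (x :: l'.reverse)) := by
      rw [most_cons] at hM ⊢
      refine ⟨hM.1, ?_⟩
      have hat : ((atyp G p A Ds).card : ℝ) ≤ δ₁ / 2 * A.card := by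
        refine h.card_atyp_le hc (a := e) (b := e) (by omega) (fun B hB => hs B (by simp [hB]))
          hd1.1 ?_ hA
        rw [hDs']
        have : min γ₀ (min γ₁ (c * c * (δ₁ / 2) / (4 * (m + 1)))) ≤
          c * c * (δ₁ / 2) / (4 * (m + 1)) := (min_le_right _ _).trans (min_le_right _ _)
        rw [le_div_iff₀ (by positivity)] at this
        nlinarith [h.gamma_pos]
      refine le_trans ?_ (card_filter_and_ge hM.2 hat ?_)
      · have : 0 ≤ (A.card : ℝ) := by positivity
        nlinarith
      · intro x hxA hx hxt
        have htyp := not_mem_atyp hxA hxt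
        rw [List.map_reverse]
        refine (H V G p (h.mono (min_le_left _ _)) (e + 1) K (Ds.map (fun B => nb G B x))
          (fun l => P (x :: l)) (by simpa using hDs') (by omega) hK ?_
          (pairwise_disjoint_map hd1.2 x) (hx.mono hmin1 fun _ h => h)).mono (by linarith) ?_
        · intro D hD
          obtain ⟨B, hB, rfl⟩ := List.mem_map.1 hD
          calc c / 2 * (p ^ (e + 1) * order V) = p / 2 * (c * (p ^ e * order V)) := by ring
            _ ≤ p / 2 * B.card := by have := hs B (by simp [hB]); gcongr
            _ ≤ _ := htyp B hB
        · intro l hl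
          exact ⟨x, l, rfl, hl⟩
    rw [List.reverse_cons]
    refine (Hm V G p (h1.mono (min_le_left _ _)) e (e + m) A Ds.reverse _ (by simpa using hDs')
      (by omega) (by omega) (by omega) hA (h.sz_of_forall hc.le (e := e) (fun B hB => hs B (by
        simp only [List.mem_reverse] at hB; simp [hB])) (by simp; omega))
      (List.pairwise_cons.2 ⟨fun B hB => hd1.1 B (by simpa using hB), by
        rw [List.pairwise_reverse]
        exact hd1.2.imp fun h => h.symm⟩) key).mono le_rfl ?_
    rintro l ⟨l', x, rfl, x', l'', he, hP⟩
    obtain ⟨rfl, rfl⟩ := List.cons.inj he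
    simpa using hP

end

/-! ### Connections from reachability, and reachability by rotation -/

section

/-- Connecting paths: tuples extendable to disjoint sets can be joined through these sets, with
one vertex in each set. -/
def HasConnections.{w} (k τ L : ℕ) : Prop :=
  ∀ c : ℝ, 0 < c → ∃ γ : ℝ, 0 < γ ∧
    ∀ (V : Type w) [Fintype V] (G : SimpleGraph V) (p : ℝ), Psr G k τ p γ →
      ∀ (K : List (Finset V)) (x y : List V), K.length = L → K.Pairwise Disjoint →
        x.length = k → y.length = k → (∀ U ∈ K, Extd G k p c x U ∧ Extd G k p c y U) →
        ∃ z : List V, List.Forall₂ (· ∈ ·) z K ∧ KP G k z ∧ Cross G k x z ∧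
          Cross G k z.reverse y

/-- From an extendable tuple most cliques in new sets are reached. -/
def HasReach.{w} (k τ m : ℕ) : Prop :=
  ∀ c δ : ℝ, 0 < c → 0 < δ → ∃ γ : ℝ, 0 < γ ∧
    ∀ (V : Type w) [Fintype V] (G : SimpleGraph V) (p : ℝ), Psr G k τ p γ →
      ∀ (Cs Ws : List (Finset V)) (x : List V), Cs.length = m → Ws.length = k →
        (Cs ++ Ws).Pairwise Disjoint → x.length = k → (∀ U ∈ Cs ++ Ws, Extd G k p c x U) →
        Most G δ Ws (fun w => ∃ s, List.Forall₂ (· ∈ ·) s Cs ∧ KP G k (s ++ w) ∧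
          Cross G k x (s ++ w))

/-- The sets are split as `m + k + m`. Most cliques in the middle `k` sets are reached from `x`
through the first block, and most from `y` through the last block read backwards. The second family
is quantified in the opposite order, so it is reversed before a common clique is chosen. -/
theorem HasReach.hasConnections {k τ m : ℕ} (hτ : 2 * k ≤ τ + 1) (h : HasReach.{u} k τ m) :
    HasConnections.{u} k τ (m + k + m) := by
  intro c hc
  obtain ⟨δ, γ₁, hδ, hδ', hγ₁, Hr⟩ := exists_most_reverse.{u} k τ k (c := c) (δ' := 1 / 4) hc
    (by norm_num) (by norm_num)
  obtain ⟨γ₂, hγ₂, H⟩ := h c δ hc hδ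
  refine ⟨min γ₁ γ₂, by positivity, ?_⟩
  intro V _ G p hG K x y hK hd hx hy hext
  have hG1 := hG.mono (min_le_left γ₁ γ₂)
  have hG2 := hG.mono (min_le_right γ₁ γ₂)
  obtain ⟨Cs, Ws, Cs', rfl, hCs, hWs, hCs'⟩ : ∃ Cs Ws Cs', K = Cs ++ (Ws ++ Cs') ∧
      Cs.length = m ∧ Ws.length = k ∧ Cs'.length = m := by
    refine ⟨K.take m, (K.drop m).take k, (K.drop m).drop k, ?_, ?_, ?_, ?_⟩
    · rw [List.take_append_drop, List.take_append_drop]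
    all_goals simp; omega
  have hd1 : (Cs ++ Ws).Pairwise Disjoint := by
    rw [← List.append_assoc] at hd
    exact (List.pairwise_append.1 hd).1
  have hd2 : (Cs'.reverse ++ Ws.reverse).Pairwise Disjoint := by
    rw [← List.reverse_append, List.pairwise_reverse]
    exact (List.pairwise_append.1 hd).2.1.imp fun h => h.symm
  have hm1 := H V G p hG2 Cs Ws x hCs hWs hd1 hx (fun U hU => (hext U (by
    simp only [List.mem_append] at hU ⊢; tauto)).1)
  have hm2 := H V G p hG2 Cs'.reverse Ws.reverse y (by simpa using hCs') (by simpa using hWs) hd2 hy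
    (fun U hU => (hext U (by
      simp only [List.mem_append, List.mem_reverse] at hU ⊢; tauto)).2)
  have hm3 := Hr V G p hG1 0 k Ws.reverse _ (by simpa using hWs) (by omega) hτ (fun U hU => by
      have := (hext U (by
        simp only [List.mem_append, List.mem_reverse] at hU ⊢; tauto)).1.card_le
      simpa using this) (List.pairwise_append.1 hd2).2.1 hm2
  rw [List.reverse_reverse] at hm3
  obtain ⟨w, ⟨⟨s, hs, hs1, hs2⟩, hw, _⟩, s', hs', hs1', hs2'⟩ :=
    Most.exists_and (by norm_num) (hm1.and_mem.mono hδ' (fun _ h => h)) hm3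
  have hwl : w.length = k := hw.length_eq.trans hWs
  have hs'' : List.Forall₂ (· ∈ ·) s'.reverse Cs' := by
    rw [← List.forall₂_reverse_iff, List.reverse_reverse]; exact hs'
  have h1 := hs1'.reverse
  rw [List.reverse_append, List.reverse_reverse, KP_append] at h1
  have h2 : KP G k ((s ++ w) ++ s'.reverse) := by
    rw [KP_append]
    refine ⟨hs1, h1.2.1, ?_⟩
    rw [List.reverse_append, Cross_append_left (by simp [hwl])]
    exact h1.2.2
  refine ⟨(s ++ w) ++ s'.reverse, ?_, h2, ?_, ?_⟩
  · rw [List.append_assoc]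
    exact List.rel_append hs (List.rel_append hw hs'')
  · rw [Cross_append_right (by simp [hwl])]
    exact hs2
  · rw [List.reverse_append, List.reverse_append, List.reverse_reverse, ← List.append_assoc,
      Cross_append_left (by simp [hwl])]
    exact hs2'.symm

section
variable {V : Type u} {G : SimpleGraph V}

theorem KP_of_pairwise {k : ℕ} {l : List V} (h : l.Pairwise G.Adj) : KP G k l :=
  fun i j hj hij _ => List.pairwise_iff_getElem.1 h i j (hij.trans hj) hj hij

/-- The sets in the list restricted to the common neighbourhoods of initial segments of `x`. -/
noncomputable def cnbs (G : SimpleGraph V) (x : List V) : ℕ → List (Finset V) → List (Finset V)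
  | _, [] => []
  | q, U :: Us => cnb G U (x.take q) :: cnbs G x (q - 1) Us

theorem cnbs_length (x : List V) (q : ℕ) (Us : List (Finset V)) :
    (cnbs G x q Us).length = Us.length := by
  induction Us generalizing q with
  | nil => rfl
  | cons U Us ih => simp [cnbs, ih]

theorem cnbs_forall₂ {x : List V} {q : ℕ} {Us : List (Finset V)} :
    List.Forall₂ (· ⊆ ·) (cnbs G x q Us) Us := by
  induction Us generalizing q with
  | nil => exact List.Forall₂.nil
  | cons U Us ih => exact List.Forall₂.cons (cnb_subset _ _) ih

theorem forall₂_mem_mono {l : List V} {As Bs : List (Finset V)}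
    (h : List.Forall₂ (· ∈ ·) l As) (h' : List.Forall₂ (· ⊆ ·) As Bs) :
    List.Forall₂ (· ∈ ·) l Bs := by
  induction h generalizing Bs with
  | nil => cases h'; exact List.Forall₂.nil
  | cons ha _ ih =>
    cases h' with
    | cons hb hr => exact List.Forall₂.cons (hb ha) (ih hr)

theorem pairwise_disjoint_of_forall₂_subset {As Bs : List (Finset V)} (h : List.Forall₂ (· ⊆ ·) As Bs)
    (hd : Bs.Pairwise Disjoint) : As.Pairwise Disjoint := by
  induction h with
  | nil => exact List.Pairwise.nil
  | @cons A B As Bs hab hr ih =>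
    rw [List.pairwise_cons] at hd ⊢
    refine ⟨fun C hC => ?_, ih hd.2⟩
    obtain ⟨i, hi, rfl⟩ := List.mem_iff_getElem.1 hC
    have h1 := hr.get (i := i) hi (hr.length_eq ▸ hi)
    exact disjoint_of_subset_left hab (disjoint_of_subset_right h1 (hd.1 _ (List.getElem_mem _)))

theorem cross_of_cnbs {x g : List V} {q : ℕ} {Us : List (Finset V)}
    (h : List.Forall₂ (· ∈ ·) g (cnbs G x q Us)) : Cross G q x g := by
  induction Us generalizing g q with
  | nil =>
    cases h
    intro i j hi hj
    simp at hj
  | cons U Us ih =>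
    cases h with
    | @cons v _ g _ hv hg =>
      intro i j hi hj hij
      rcases j with _ | j
      · rw [List.getElem_cons_zero]
        refine (mem_cnb.1 hv).2 _ ?_
        rw [List.mem_take_iff_getElem]
        exact ⟨i, by omega, rfl⟩
      · rw [List.getElem_cons_succ]
        exact ih hg i j hi (by simpa using hj) (by omega)

variable [Fintype V] {k τ : ℕ} {p γ : ℝ}

theorem sz_cnbs {c : ℝ} {x : List V} {q : ℕ} (hq : q ≤ k) {Us : List (Finset V)}
    (h : ∀ U ∈ Us, Extd G k p c x U) : Sz p c q (cnbs G x q Us) := by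
  induction Us generalizing q with
  | nil => trivial
  | cons U Us ih =>
    exact ⟨h U (by simp) q hq, ih (by omega) fun U' hU' => h U' (by simp [hU'])⟩

theorem Psr.sz_append (h : Psr G k τ p γ) {c : ℝ} (hc : 0 ≤ c) {q q' : ℕ} (hq : q ≤ q')
    {Ds : List (Finset V)} {B : Finset V} (hs : Sz p c q Ds) (hB : c * order V ≤ B.card) :
    Sz p c q' (Ds ++ [B]) := by
  have hn := h.order_pos
  induction Ds generalizing q q' with
  | nil =>
    refine ⟨le_trans ?_ hB, trivial⟩
    have := h.pow_le (Nat.zero_le q')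
    rw [pow_zero] at this
    have : p ^ q' * order V ≤ 1 * order V := by gcongr
    rw [one_mul] at this
    gcongr
  | cons D Ds ih =>
    refine ⟨le_trans ?_ hs.1, ih (by omega) hs.2⟩
    have := h.pow_le hq
    gcongr

end

/-- The vertices of `g` are reached from `x` by a path through the sets in `Done`. -/
def Reached {V : Type u} (G : SimpleGraph V) (k : ℕ) (x : List V) (Done Alive : List (Finset V))
    (g : List V) : Prop :=
  ∃ s, List.Forall₂ (· ∈ ·) s Done ∧ List.Forall₂ (· ∈ ·) g Alive ∧ KP G k (s ++ g) ∧
    Cross G k x (s ++ g)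

/-- One rotation: the first vertex is moved to the end of the quantifier order and there exchanged
for a neighbour in the fresh set `B`. The old vertex stays in the path, so the new one sees its `k`
predecessors. The exchange costs `k + 0 + 2(k - 1) = 3k - 2 ≤ τ`, the bottleneck for general `k`. -/
theorem exists_reached_step (k τ : ℕ) (hk : 1 ≤ k) (hτ : 3 * k ≤ τ + 2) {c δ' : ℝ} (hc : 0 < c)
    (hδ' : 0 < δ') (hδ1 : δ' ≤ 1) :
    ∃ δ γ : ℝ, 0 < δ ∧ δ ≤ δ' ∧ 0 < γ ∧
      ∀ (V : Type u) [Fintype V] (G : SimpleGraph V) (p : ℝ), Psr G k τ p γ →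
      ∀ (Done Ds : List (Finset V)) (A B : Finset V) (x : List V), Ds.length + 1 = k →
        Sz p c k (A :: Ds) → c * order V ≤ B.card → (A :: (Ds ++ [B])).Pairwise Disjoint →
        Most G δ (A :: Ds) (Reached G k x Done (A :: Ds)) →
        Most G δ' (Ds ++ [B]) (Reached G k x (Done ++ [A]) (Ds ++ [B])) := by
  obtain ⟨δ₁, γ₁, hδ₁, hδ₁', hγ₁, H₁⟩ := exists_most_replace_last.{u} k τ (k - 1) hc hδ'
  obtain ⟨δ₂, γ₂, hδ₂, hδ₂', hγ₂, H₂⟩ := exists_most_move.{u} k τ (k - 1) hc hδ₁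
    (hδ₁'.trans hδ1)
  refine ⟨δ₂, min γ₁ γ₂, hδ₂, by linarith, by positivity, ?_⟩
  intro V _ G p h Done Ds A B x hDs hs hB hd hM
  have hd1 := List.pairwise_cons.1 hd
  have hd2 := List.pairwise_append.1 hd1.2
  have m1 := H₂ V G p (h.mono (min_le_right _ _)) k (k - 1) A Ds _ (by omega) (by omega) le_rfl
    (by omega) hs.1 hs.2 (List.pairwise_cons.2 ⟨fun C hC => hd1.1 C (by simp [hC]), hd2.1⟩) hM
  have m2 := H₁ V G p (h.mono (min_le_left _ _)) k 0 (k - 1) A B Ds _ (by omega) (by omega)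
    (by omega) le_rfl (by omega) (by omega) hs.1 (by simpa using hB) hs.2
    (List.pairwise_cons.2 ⟨fun C hC => hd1.1 C (by
      rcases List.mem_cons.1 hC with rfl | hC
      · simp
      · simp [hC]), List.pairwise_cons.2 ⟨fun C hC => (hd2.2.2 C hC B (by simp)).symm, hd2.1⟩⟩) m1
  refine m2.and_mem.mono le_rfl ?_
  rintro l ⟨⟨l', v, w, rfl, ⟨l'', v', he, s, hs1, hs2, hs3, hs4⟩, hvw⟩, hmem, hpw⟩
  obtain ⟨rfl, hv⟩ := List.append_inj' he rfl
  obtain rfl : v = v' := by simpa using hv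
  cases hs2 with
  | cons hvA hl' =>
    have hlen : l'.length + 1 = k := by rw [hl'.length_eq, hDs]
    have hkey : (s ++ [v]) ++ (l' ++ [w]) = (s ++ v :: l') ++ [w] := by simp
    refine ⟨s ++ [v], List.rel_append hs1 (List.Forall₂.cons hvA List.Forall₂.nil), hmem, ?_, ?_⟩
    · rw [hkey, KP_append]
      refine ⟨hs3, ?_, ?_⟩
      · intro i j hj hij
        simp at hj
        omega
      · rw [List.reverse_append, Cross_append_left (by simp; omega)]
        intro i j hi hj hij
        have hadj : ∀ u ∈ v :: l', G.Adj u w := by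
          intro u hu
          rcases List.mem_cons.1 hu with rfl | hu
          · exact hvw
          · exact (List.pairwise_append.1 hpw).2.2 u hu w (by simp)
        have hj0 : j = 0 := by simp at hj; exact hj
        subst hj0
        refine hadj _ ?_
        rw [← List.mem_reverse]
        exact List.getElem_mem _
    · rw [hkey, Cross_append_right (by simp; omega)]
      exact hs4

theorem exists_reached (k τ r : ℕ) (hk : 1 ≤ k) (hτ : 3 * k ≤ τ + 2) {c δ' : ℝ} (hc : 0 < c)
    (hδ' : 0 < δ') (hδ1 : δ' ≤ 1) :
    ∃ δ γ : ℝ, 0 < δ ∧ δ ≤ δ' ∧ 0 < γ ∧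
      ∀ (V : Type u) [Fintype V] (G : SimpleGraph V) (p : ℝ), Psr G k τ p γ →
      ∀ (Done As Bs Ws : List (Finset V)) (x : List V), As.length = r → Ws.length = r →
        (As ++ Bs).length = k → Sz p c k (As ++ Bs) → (∀ W ∈ Ws, c * order V ≤ W.card) →
        (As ++ Bs ++ Ws).Pairwise Disjoint →
        Most G δ (As ++ Bs) (Reached G k x Done (As ++ Bs)) →
        Most G δ' (Bs ++ Ws) (Reached G k x (Done ++ As) (Bs ++ Ws)) := by
  induction r with
  | zero =>
    refine ⟨δ', 1, hδ', le_rfl, one_pos, ?_⟩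
    intro V _ G p _ Done As Bs Ws x hAs hWs _ _ _ _ hM
    rw [List.length_eq_zero_iff] at hAs hWs
    subst hAs hWs
    simpa using hM
  | succ r ih =>
    obtain ⟨δ₀, γ₀, hδ₀, hδ₀', hγ₀, H⟩ := ih
    obtain ⟨δ, γ₁, hδ, hδle, hγ₁, Hs⟩ := exists_reached_step.{u} k τ hk hτ hc hδ₀
      (hδ₀'.trans hδ1)
    refine ⟨δ, min γ₀ γ₁, hδ, by linarith, by positivity, ?_⟩
    intro V _ G p h Done As Bs Ws x hAs hWs hk' hs hW hd hM
    obtain ⟨A, As, rfl⟩ := List.exists_cons_of_length_eq_add_one hAs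
    obtain ⟨W, Ws, rfl⟩ := List.exists_cons_of_length_eq_add_one hWs
    have hs' : Sz p c k (As ++ (Bs ++ [W])) := by
      rw [← List.append_assoc]
      exact h.sz_append hc.le (Nat.sub_le k 1) hs.2 (hW W (by simp))
    have hd' : (A :: (As ++ Bs ++ [W] ++ Ws)).Pairwise Disjoint := by
      simpa using hd
    have m1 := Hs V G p (h.mono (min_le_right _ _)) Done (As ++ Bs) A W x (by simpa using hk')
      hs (hW W (by simp)) (by
        have := List.pairwise_append.1 (show ((A :: (As ++ Bs ++ [W])) ++ Ws).Pairwise Disjoint by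
          simpa using hd')
        exact this.1) hM
    have m2 := H V G p (h.mono (min_le_left _ _)) (Done ++ [A]) As (Bs ++ [W]) Ws x
      (by simpa using hAs) (by simpa using hWs) (by
        simp only [List.length_append, List.length_cons, List.length_nil] at hk' ⊢; omega) hs'
      (fun W' hW' => hW W' (by simp [hW'])) (by
        have := (List.pairwise_cons.1 hd').2
        simpa using this) (by simpa using m1)
    simpa using m2

/-- The first clique lives in sets of exponents `k, k - 1, …, 1` forced by adjacency to `x`. After
`k` rotations all of them have been exchanged for the unrestricted sets `Ws`. -/
theorem hasReach_of_le {k τ : ℕ} (hk : 1 ≤ k) (hτ : 3 * k ≤ τ + 2) (hτ' : 2 * k ≤ τ + 1) :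
    HasReach.{u} k τ k := by
  intro c δ hc hδ
  obtain ⟨δ₀, γ₀, hδ₀, hδ₀', hγ₀, H⟩ := exists_reached.{u} k τ k hk hτ hc
    (δ' := min δ 1) (by positivity) (min_le_right _ _)
  obtain ⟨γ₁, hγ₁, H₁⟩ := most_true.{u} k τ k hc hδ₀
  refine ⟨min γ₀ γ₁, by positivity, ?_⟩
  intro V _ G p h Cs Ws x hCs hWs hd hx hext
  have hd1 := List.pairwise_append.1 hd
  have hsub : List.Forall₂ (· ⊆ ·) (cnbs G x k Cs) Cs := cnbs_forall₂
  have hsz := sz_cnbs (G := G) (x := x) (c := c) (p := p) le_rfl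
    (fun U hU => hext U (by simp [hU]) : ∀ U ∈ Cs, Extd G k p c x U)
  have m1 := H₁ V G p (h.mono (min_le_right _ _)) k (cnbs G x k Cs)
    (by rw [cnbs_length, hCs]) le_rfl hτ' hsz (pairwise_disjoint_of_forall₂_subset hsub hd1.1)
  have m2 := H V G p (h.mono (min_le_left _ _)) [] (cnbs G x k Cs) [] Ws x
    (by rw [cnbs_length, hCs]) hWs (by rw [List.append_nil, cnbs_length, hCs])
    (by rwa [List.append_nil]) (fun W hW => (hext W (by simp [hW])).card_le)
    (by
      rw [List.append_nil]
      refine pairwise_disjoint_of_forall₂_subset (List.rel_append hsub (List.forall₂_same.2 fun W _ =>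
        Subset.refl W)) hd)
    (by
      rw [List.append_nil]
      refine m1.and_mem.mono le_rfl ?_
      rintro l ⟨-, hl1, hl2⟩
      exact ⟨[], List.Forall₂.nil, hl1, KP_of_pairwise hl2, cross_of_cnbs hl1⟩)
  refine m2.mono (min_le_left _ _) ?_
  rintro l ⟨s, hs1, -, hs3, hs4⟩
  exact ⟨s, forall₂_mem_mono (by simpa using hs1) hsub, hs3, hs4⟩

end

/-! ### Triangles through a sparse set -/

section

/-- The geometric mean in the jumbledness error is split by the arithmetic-geometric inequality with
weight `lam`, so that it can be summed over many pairs of sets. -/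
theorem le_of_sub_sq_le {e b lam X t s : ℝ} (hlam : 0 < lam) (ht : 0 ≤ t)
    (hs : 0 ≤ s) (hX : 0 ≤ X) (h : (e - b) ^ 2 ≤ X * (t * s)) : e ≤ b + lam * t + X / lam * s := by
  have h1 : (e - b) ^ 2 ≤ (lam * t + X / lam * s) ^ 2 := by
    have : X * (t * s) = (lam * t) * (X / lam * s) := by field_simp
    rw [this] at h
    nlinarith [mul_nonneg (mul_nonneg hlam.le ht) (mul_nonneg (div_nonneg hX hlam.le) hs),
      sq_nonneg (lam * t), sq_nonneg (X / lam * s)]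
  have := abs_le_of_sq_le_sq' h1 (by positivity)
  linarith [this.2]

theorem unreached_arith {a p n b γ : ℝ} (ha : 0 < a) (hp : 0 < p) (hn : 0 < n) (hb : 0 < b)
    (h : p ^ 2 * b / 8 * (a / 2 * (p * n) * (a / 2 * (p ^ 2 * n))) ≤
      γ * p ^ (3 + 2) * n ^ 2 / (p ^ 2 * b / 16) * (a / 64 * (p ^ 2 * n) * b)) :
    b ≤ 8 / a * γ * n := by
  have h2 : (a ^ 2 * p ^ 5 * n ^ 2 / 32) * b ≤ (a ^ 2 * p ^ 5 * n ^ 2 / 32) * (8 / a * γ * n) := by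
    calc _ = p ^ 2 * b / 8 * (a / 2 * (p * n) * (a / 2 * (p ^ 2 * n))) := by ring
      _ ≤ _ := h
      _ = _ := by field_simp; ring
  exact le_of_mul_le_mul_left h2 (by positivity)

set_option maxHeartbeats 1000000 in
/-- If every vertex of `Z` is assigned a large set of its partners in `X`, then all but few vertices
of `Q` see many partners forming a triangle with them and a vertex of `Z`. -/
theorem exists_card_unreached_le (k : ℕ) {a η : ℝ} (ha : 0 < a) (hη : 0 < η) :
    ∃ ρ γ : ℝ, 0 < ρ ∧ 0 < γ ∧
      ∀ (V : Type u) [Fintype V] (G : SimpleGraph V) (p : ℝ), Psr G k 3 p γ →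
      ∀ (Z X Q : Finset V) (H : V → Finset V), Disjoint Z X → Disjoint Z Q → Disjoint X Q →
        (∀ z ∈ Z, H z ⊆ nb G X z) → (∀ z ∈ Z, a * (p ^ 2 * order V) ≤ (H z).card) →
        a * (p * order V) ≤ Z.card →
        ((Q.filter (fun q => ((X.filter (fun w => ∃ z ∈ Z, w ∈ H z ∧ G.Adj z q ∧
          G.Adj w q)).card : ℝ) < a / 64 * (p ^ 2 * order V))).card : ℝ) ≤ η * order V := by
  refine ⟨a / 64, min (a ^ 2 / 16) (min (η * a / 32) (1 / 4 * η * (a / 4))), by positivity,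
    by positivity, ?_⟩
  intro V _ G p h Z X Q H hZX hZQ hXQ hHN hH hZ
  have hHX : ∀ z ∈ Z, H z ⊆ X := fun z hz => (hHN z hz).trans (nb_subset _ _)
  have hp := h.p_pos
  have hp1 := h.p_le
  have hn := h.order_pos
  set γ := min (a ^ 2 / 16) (min (η * a / 32) (1 / 4 * η * (a / 4))) with hγ
  have hγ0 := h.gamma_pos
  have hγ1 : γ ≤ a ^ 2 / 16 := min_le_left _ _
  have hγ2 : γ ≤ η * a / 32 := (min_le_right _ _).trans (min_le_left _ _)
  have hγ3 : γ ≤ 1 / 4 * η * (a / 4) := (min_le_right _ _).trans (min_le_right _ _)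
  clear_value γ
  set Bad := Q.filter (fun q => ((X.filter (fun w => ∃ z ∈ Z, w ∈ H z ∧ G.Adj z q ∧
          G.Adj w q)).card : ℝ) < a / 64 * (p ^ 2 * order V)) with hBad
  by_contra! hcon
  have hBQ : Bad ⊆ Q := filter_subset _ _
  have hbpos : 0 < (Bad.card : ℝ) := lt_trans (by positivity) hcon
  -- Triples `(z, w, q)` with `q` bad are counted in two ways. By badness the sets `S w` are small
  -- on average.
  set S : V → Finset V := fun w => Bad.filter (fun q => ∃ z ∈ Z, w ∈ H z ∧ G.Adj z q ∧
          G.Adj w q) with hS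
  have hSsum : ∑ w ∈ X, ((S w).card : ℝ) ≤ a / 64 * (p ^ 2 * order V) * Bad.card := by
    have : ∑ w ∈ X, ((S w).card : ℝ) = ∑ q ∈ Bad, ((X.filter (fun w => ∃ z ∈ Z, w ∈ H z ∧
        G.Adj z q ∧ G.Adj w q)).card : ℝ) := by
      simp only [hS, card_filter, Nat.cast_sum]
      rw [sum_comm]
    rw [this, mul_comm, ← nsmul_eq_mul]
    exact sum_le_card_nsmul _ _ _ fun q hq => (mem_filter.1 hq).2.le
  set W := X.filter (fun w => p * Bad.card / 16 < (S w).card) with hW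
  have hWX : W ⊆ X := filter_subset _ _
  have hWc : (W.card : ℝ) ≤ a / 4 * (p * order V) := by
    have h1 : (W.card : ℝ) * (p * Bad.card / 16) ≤ a / 64 * (p ^ 2 * order V) * Bad.card := by
      refine le_trans ?_ hSsum
      rw [← nsmul_eq_mul]
      refine (card_nsmul_le_sum W (fun w => ((S w).card : ℝ)) _
        fun w hw => (mem_filter.1 hw).2.le).trans ?_
      exact sum_le_sum_of_subset_of_nonneg hWX fun _ _ _ => by positivity
    have h2 : (W.card : ℝ) * (p * Bad.card / 16) ≤
        (a / 4 * (p * order V)) * (p * Bad.card / 16) := by linarith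
    exact le_of_mul_le_mul_right h2 (by positivity)
  -- the exceptional vertices of `Z`
  set B₁ := Z.filter (fun z => a / 2 * (p ^ 2 * order V) ≤ (nb G W z).card) with hB₁
  have hB₁c : (B₁.card : ℝ) ≤ a / 4 * (p * order V) := by
    have h1 := h.jum B₁ W (disjoint_of_subset_left (filter_subset _ _)
      (disjoint_of_subset_right hWX hZX))
    have h2 : (B₁.card : ℝ) * (a / 2 * (p ^ 2 * order V)) ≤ ∑ z ∈ B₁, ((nb G W z).card : ℝ) := by
      rw [← nsmul_eq_mul]
      exact card_nsmul_le_sum _ _ _ fun z hz => (mem_filter.1 hz).2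
    rcases (Nat.cast_nonneg B₁.card : (0:ℝ) ≤ B₁.card).eq_or_lt with h0 | h0
    · rw [← h0]; positivity
    have h3 : (B₁.card : ℝ) * (a / 4 * (p ^ 2 * order V)) ≤
        ∑ z ∈ B₁, ((nb G W z).card : ℝ) - p * B₁.card * W.card := by
      have : p * B₁.card * W.card ≤ p * B₁.card * (a / 4 * (p * order V)) := by gcongr
      nlinarith
    have h4 : ((B₁.card : ℝ) * (a / 4 * (p ^ 2 * order V))) ^ 2 ≤
        γ * p ^ (3 + 2) * order V ^ 2 * (B₁.card * (a / 4 * (p * order V))) := by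
      refine (pow_le_pow_left₀ (by positivity) h3 2).trans (h1.trans ?_)
      gcongr
    have h5 : (B₁.card * (p ^ 4 * order V ^ 2 * (a / 4))) * ((a / 4) * B₁.card) ≤
        (B₁.card * (p ^ 4 * order V ^ 2 * (a / 4))) * (γ * p * (p * order V)) := by
      calc _ = ((B₁.card : ℝ) * (a / 4 * (p ^ 2 * order V))) ^ 2 := by ring
        _ ≤ _ := h4
        _ = _ := by ring
    have h6 := le_of_mul_le_mul_left h5 (by positivity)
    have h7 : γ * p * (p * order V) ≤ a ^ 2 / 16 * 1 * (p * order V) := by gcongr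
    have h8 : (a / 4) * B₁.card ≤ (a / 4) * (a / 4 * (p * order V)) := by
      refine h6.trans (h7.trans (le_of_eq (by ring)))
    exact le_of_mul_le_mul_left h8 (by positivity)
  set B₂ := Z.filter (fun z => ((nb G Bad z).card : ℝ) ≤ (1 - 1 / 2) * (p * Bad.card)) with hB₂
  have hB₂c : (B₂.card : ℝ) ≤ a / 4 * (p * order V) := by
    have := h.low_filter (A := Bad) (B := B₂) (a := 0) (b := 1) (c := η) (δ := 1 / 2)
      (θ := a / 4) hη (by norm_num) (by simpa using hcon.le) (by norm_num) (by linarith)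
      (disjoint_of_subset_left hBQ (disjoint_of_subset_right (filter_subset _ _) hZQ.symm))
      (fun z hz => (mem_filter.1 hz).2)
    simpa using this
  set Z' := (Z \ B₁) \ B₂ with hZ'
  have hZ'c : a / 2 * (p * order V) ≤ Z'.card := by
    have h1 : Z ⊆ Z' ∪ (B₁ ∪ B₂) := fun z hz => by
      simp only [hZ', mem_union, mem_sdiff]; tauto
    have h2 : (Z.card : ℝ) ≤ Z'.card + (B₁.card + B₂.card) := by
      exact_mod_cast (card_le_card h1).trans ((card_union_le _ _).trans
        (Nat.add_le_add_left (card_union_le _ _) _))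
    linarith
  set H' : V → Finset V := fun z => H z \ W with hH'
  have hZ'Z : Z' ⊆ Z := sdiff_subset.trans sdiff_subset
  have hH'X : ∀ z ∈ Z', H' z ⊆ X \ W := fun z hz => sdiff_subset_sdiff (hHX z (hZ'Z hz)) le_rfl
  have hadj : ∀ z ∈ Z', a / 2 * (p ^ 2 * order V) ≤ (H' z).card ∧
      p / 2 * Bad.card ≤ (nb G Bad z).card := by
    intro z hz
    obtain ⟨hz1, hz2⟩ := mem_sdiff.1 hz
    obtain ⟨hzZ, hz3⟩ := mem_sdiff.1 hz1
    constructor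
    · have h1 : ((H z ∩ W).card : ℝ) ≤ (nb G W z).card := by
        exact_mod_cast card_le_card fun w hw => mem_nb.2
          ⟨(mem_inter.1 hw).2, (mem_nb.1 (hHN z hzZ (mem_inter.1 hw).1)).2⟩
      have h2 : ((nb G W z).card : ℝ) ≤ a / 2 * (p ^ 2 * order V) := by
        by_contra hlt
        exact hz3 (mem_filter.2 ⟨hzZ, (not_le.1 hlt).le⟩)
      have h3 : ((H z).card : ℝ) = (H' z).card + (H z ∩ W).card := by
        rw [← Nat.cast_add, card_sdiff_add_card_inter]
      linarith [hH z hzZ]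
    · by_contra hlt
      exact hz2 (mem_filter.2 ⟨hzZ, by linarith⟩)
  -- Lower count: `H' z` has exponent 2 and the bad neighbours of `z` exponent 1, which exactly
  -- exhausts `τ = 3`.
  have hlow : ∀ z ∈ Z', p ^ 2 * Bad.card / 4 * (H' z).card ≤
      ∑ w ∈ H' z, ((nb G (nb G Bad z) w).card : ℝ) := by
    intro z hz
    obtain ⟨h1, h2⟩ := hadj z hz
    by_contra! hlt
    have hle : p ^ 2 * Bad.card / 4 * (H' z).card ≤
        1 / 2 * (p * (H' z).card * (nb G Bad z).card) := by
      calc p ^ 2 * Bad.card / 4 * (H' z).card = 1 / 2 * (p * (H' z).card * (p / 2 * Bad.card)) := by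
            ring
        _ ≤ _ := by gcongr
    have h3 := h.mul_card_le (A := H' z) (B := nb G Bad z) (disjoint_of_subset_left
      ((hH'X z hz).trans sdiff_subset) (disjoint_of_subset_right ((nb_subset _ _).trans hBQ) hXQ))
      (δ := 1 / 2) (by norm_num) (by
        rw [abs_sub_comm]
        refine le_trans ?_ (le_abs_self _)
        linarith)
    have h4 : a / 2 * (p ^ 2 * order V) * (p / 2 * (η * order V)) ≤
        (H' z).card * (nb G Bad z).card := by
      have : p / 2 * (η * order V) ≤ p / 2 * Bad.card := by gcongr
      exact mul_le_mul h1 (this.trans h2) (by positivity) (by positivity)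
    have h5 : 0 < p ^ 3 * order V ^ 2 := by positivity
    nlinarith [mul_le_mul_of_nonneg_right hγ2 h5.le, mul_pos (mul_pos hη ha) h5]
  set T : V → Finset V := fun w => Z'.filter (fun z => w ∈ H' z) with hT
  have hcomm : ∀ z w, z ∈ Z' ∧ w ∈ H' z ↔ z ∈ T w ∧ w ∈ X \ W := by
    intro z w
    simp only [hT, mem_filter]
    exact ⟨fun h => ⟨h, hH'X z h.1 h.2⟩, fun h => h.1⟩
  have hhsum : ∑ z ∈ Z', ((H' z).card : ℝ) = ∑ w ∈ X \ W, ((T w).card : ℝ) := by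
    simp only [card_eq_sum_ones, Nat.cast_sum]
    exact sum_comm' hcomm
  -- Upper count: the triples at `w` are among the edges between `T w` and `S w`. The main term and
  -- the `T w` part of the split error contribute `p²|Bad|/16` per vertex of `T w` each, together
  -- half of the lower count. The rest is a multiple of `|S w|`, whose sum is small.
  have hup : ∀ w ∈ X \ W, ∑ z ∈ T w, ((nb G (S w) z).card : ℝ) ≤
      p ^ 2 * Bad.card / 8 * (T w).card +
        γ * p ^ (3 + 2) * order V ^ 2 / (p ^ 2 * Bad.card / 16) * (S w).card := by
    intro w hw
    obtain ⟨hwX, hwW⟩ := mem_sdiff.1 hw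
    have h1 := h.jum (T w) (S w) (disjoint_of_subset_left ((filter_subset _ _).trans hZ'Z)
      (disjoint_of_subset_right ((filter_subset _ _).trans hBQ) hZQ))
    have h2 := le_of_sub_sq_le (lam := p ^ 2 * Bad.card / 16) (by positivity) (by positivity)
      (by positivity) (by positivity) h1
    have h3 : ((S w).card : ℝ) ≤ p * Bad.card / 16 := by
      by_contra hlt
      exact hwW (mem_filter.2 ⟨hwX, not_le.1 hlt⟩)
    have h4 : p * (T w).card * (S w).card ≤ p * (T w).card * (p * Bad.card / 16) := by gcongr
    linarith
  have hsumlow : p ^ 2 * Bad.card / 4 * ∑ z ∈ Z', ((H' z).card : ℝ) ≤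
      ∑ w ∈ X \ W, ∑ z ∈ T w, ((nb G (S w) z).card : ℝ) := by
    rw [mul_sum, ← sum_comm' hcomm]
    refine sum_le_sum fun z hz => (hlow z hz).trans (sum_le_sum fun w hw => ?_)
    norm_cast
    refine card_le_card fun q hq => ?_
    simp only [mem_nb] at hq ⊢
    exact ⟨mem_filter.2 ⟨hq.1.1, z, hZ'Z hz, (mem_sdiff.1 hw).1, hq.1.2, hq.2⟩, hq.1.2⟩
  have hsumup := sum_le_sum hup
  rw [sum_add_distrib, ← mul_sum, ← mul_sum, ← hhsum] at hsumup
  have hS' : ∑ w ∈ X \ W, ((S w).card : ℝ) ≤ a / 64 * (p ^ 2 * order V) * Bad.card :=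
    le_trans (sum_le_sum_of_subset_of_nonneg sdiff_subset fun _ _ _ => by positivity) hSsum
  have hh : a / 2 * (p * order V) * (a / 2 * (p ^ 2 * order V)) ≤ ∑ z ∈ Z', ((H' z).card : ℝ) := by
    refine le_trans ?_ (card_nsmul_le_sum Z' _ _ fun z hz => (hadj z hz).1)
    rw [nsmul_eq_mul]
    gcongr
  have h1 : p ^ 2 * Bad.card / 8 * (a / 2 * (p * order V) * (a / 2 * (p ^ 2 * order V))) ≤
      γ * p ^ (3 + 2) * order V ^ 2 / (p ^ 2 * Bad.card / 16) *
        (a / 64 * (p ^ 2 * order V) * Bad.card) := by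
    calc _ ≤ p ^ 2 * Bad.card / 8 * ∑ z ∈ Z', ((H' z).card : ℝ) := by gcongr
      _ ≤ γ * p ^ (3 + 2) * order V ^ 2 / (p ^ 2 * Bad.card / 16) *
          ∑ w ∈ X \ W, ((S w).card : ℝ) := by linarith
      _ ≤ _ := by gcongr
  have h2 := unreached_arith ha hp hn hbpos h1
  have h3 : 8 / a * γ * order V ≤ 8 / a * (η * a / 32) * order V := by gcongr
  have h4 : 8 / a * (η * a / 32) * order V = η / 4 * order V := by field_simp; ring
  have h5 := mul_pos hη hn
  linarith

end

/-! ### Reachability for squares -/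

section

theorem exists_pos_le₂ {a b : ℝ} (ha : 0 < a) (hb : 0 < b) : ∃ γ : ℝ, 0 < γ ∧ γ ≤ a ∧ γ ≤ b :=
  ⟨min a b, lt_min ha hb, min_le_left _ _, min_le_right _ _⟩

theorem exists_pos_le₃ {a b c : ℝ} (ha : 0 < a) (hb : 0 < b) (hc : 0 < c) :
    ∃ γ : ℝ, 0 < γ ∧ γ ≤ a ∧ γ ≤ b ∧ γ ≤ c := by
  obtain ⟨x, hx, h1, h2⟩ := exists_pos_le₂ hb hc
  obtain ⟨y, hy, h3, h4⟩ := exists_pos_le₂ ha hx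
  exact ⟨y, hy, h3, h4.trans h1, h4.trans h2⟩

theorem exists_pos_le₄ {a b c d : ℝ} (ha : 0 < a) (hb : 0 < b) (hc : 0 < c) (hd : 0 < d) :
    ∃ γ : ℝ, 0 < γ ∧ γ ≤ a ∧ γ ≤ b ∧ γ ≤ c ∧ γ ≤ d := by
  obtain ⟨x, hx, h1, h2, h3⟩ := exists_pos_le₃ hb hc hd
  obtain ⟨y, hy, h4, h5⟩ := exists_pos_le₂ ha hx
  exact ⟨y, hy, h4, h5.trans h1, h5.trans h2, h5.trans h3⟩

section
variable {V : Type u} {G : SimpleGraph V}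

theorem KP_two_cons {a b c : V} {l : List V} :
    KP G 2 (a :: b :: c :: l) ↔ G.Adj a b ∧ G.Adj a c ∧ KP G 2 (b :: c :: l) := by
  constructor
  · intro h
    refine ⟨h 0 1 (by simp) (by omega) (by omega), h 0 2 (by simp) (by omega) (by omega),
      fun i j hj hij hjk => ?_⟩
    exact h (i + 1) (j + 1) (by simpa using hj) (by omega) (by omega)
  · rintro ⟨h1, h2, h3⟩ i j hj hij hjk
    rcases i with _ | i
    · obtain rfl | rfl : j = 1 ∨ j = 2 := by omega
      · exact h1
      · exact h2
    · obtain ⟨j, rfl⟩ : ∃ j', j = j' + 1 := ⟨j - 1, by omega⟩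
      exact h3 i j (by simpa using hj) (by omega) (by omega)

theorem KP_two_pair {a b : V} : KP G 2 [a, b] ↔ G.Adj a b := by
  constructor
  · intro h
    exact h 0 1 (by simp) (by omega) (by omega)
  · intro h i j hj hij hjk
    simp only [List.length_cons, List.length_nil] at hj
    obtain rfl : j = 1 := by omega
    obtain rfl : i = 0 := by omega
    exact h

theorem Cross_two {a b c d : V} {x y : List V} :
    Cross G 2 (a :: b :: x) (c :: d :: y) ↔ G.Adj a c ∧ G.Adj a d ∧ G.Adj b c := by
  constructor
  · intro h
    exact ⟨h 0 0 (by simp) (by simp) (by omega), h 0 1 (by simp) (by simp) (by omega),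
      h 1 0 (by simp) (by simp) (by omega)⟩
  · rintro ⟨h1, h2, h3⟩ i j hi hj hij
    obtain ⟨rfl, rfl⟩ | ⟨rfl, rfl⟩ | ⟨rfl, rfl⟩ :
      (i = 0 ∧ j = 0) ∨ (i = 0 ∧ j = 1) ∨ (i = 1 ∧ j = 0) := by omega
    · exact h1
    · exact h2
    · exact h3

end

/-- Most vertices of the sparse set `B` form edges with common neighbours in `C` together with some
vertex of the sparse set `A`. -/
theorem exists_card_cherry_ge (k : ℕ) {c : ℝ} (hc : 0 < c) :
    ∃ γ : ℝ, 0 < γ ∧ ∀ (V : Type u) [Fintype V] (G : SimpleGraph V) (p : ℝ), Psr G k 3 p γ →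
      ∀ A B C : Finset V, Disjoint A B → Disjoint A C → Disjoint B C →
        c * (p ^ 2 * order V) ≤ A.card → c * (p ^ 1 * order V) ≤ B.card → c * order V ≤ C.card →
        (1 - 1 / 2) * (B.card : ℝ) ≤ (B.filter (fun y => ∃ x ∈ A, G.Adj x y ∧
          c / 4 * (p ^ 2 * order V) ≤ (nb G (nb G C x) y).card)).card := by
  -- One quarter is lost in the exchange of quantifiers and one quarter to atypical vertices, which
  -- leaves half of `B`.
  obtain ⟨q, hq⟩ : ∃ q : ℝ, q = 1 / 4 := ⟨_, rfl⟩
  obtain ⟨δ, γ₁, hδ, hδ', hγ₁, Hs⟩ := exists_most_swap.{u} k 3 hc (δ' := q) (by rw [hq]; norm_num)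
    (by rw [hq]; norm_num)
  obtain ⟨γ, hγ, g1, g2, g3, g4⟩ := exists_pos_le₄ hγ₁ (by positivity : 0 < c * c * δ / 8)
    (by positivity : 0 < c / 2 * (c / 2) * δ / 4) (by rw [hq]; positivity : 0 < c * c * q / 4)
  refine ⟨γ, hγ, ?_⟩
  intro V _ G p h A B C hAB hAC hBC hA hB hC
  have hp := h.p_pos
  have hn := h.order_pos
  -- The property is easy for most `x` in `A` and most neighbours `y` of `x` in `B`, since `nb G C
  -- x` has exponent 1 and `nb G B x` exponent 2. The swap turns this into a statement for most `y`.
  have hs := Hs V G p (h.mono g1) A B 2 1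
    (fun x y => c / 4 * (p ^ 2 * order V) ≤ (nb G (nb G C x) y).card) le_rfl hAB hA hB ?_
  · have hat : ((atyp G p B [A]).card : ℝ) ≤ q * B.card := by
      refine h.card_atyp_le hc (a := 2) (b := 1) le_rfl (by simpa using hA)
        (by simpa using hAB.symm) ?_ hB
      rw [List.length_singleton, Nat.cast_one]
      linarith
    refine le_trans (le_of_eq (by rw [hq]; norm_num)) (card_filter_and_ge hs hat ?_)
    intro y hyB hy hyt
    have h1 := not_mem_atyp hyB hyt A (by simp)
    have h2 : (0 : ℝ) < A.card := lt_of_lt_of_le (by positivity) hA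
    have h3 : (0 : ℝ) < ((nb G A y).filter (fun x => c / 4 * (p ^ 2 * order V) ≤
        (nb G (nb G C x) y).card)).card := by
      refine lt_of_lt_of_le ?_ hy
      have : (0 : ℝ) < (nb G A y).card := lt_of_lt_of_le (by positivity) h1
      rw [hq]
      linarith
    obtain ⟨x, hx⟩ := card_pos.1 (by exact_mod_cast h3)
    obtain ⟨hx1, hx2⟩ := mem_filter.1 hx
    exact ⟨x, (mem_nb.1 hx1).1, (mem_nb.1 hx1).2.symm, hx2⟩
  · refine card_filter_sdiff_ge (X := atyp G p A [B, C]) ?_ ?_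
    · refine h.card_atyp_le hc (a := 1) (b := 2) le_rfl (fun D hD => ?_) (fun D hD => ?_) ?_ hA
      · simp only [List.mem_cons, List.not_mem_nil, or_false] at hD
        rcases hD with rfl | rfl
        · exact hB
        · refine le_trans ?_ hC
          rw [pow_one]
          have : p * order V ≤ 1 * order V := by
            have := h.p_le
            gcongr
          rw [one_mul] at this
          gcongr
      · simp only [List.mem_cons, List.not_mem_nil, or_false] at hD
        rcases hD with rfl | rfl
        · exact hAB
        · exact hAC
      · simp only [List.length_cons, List.length_nil]
        push_cast
        linarith
    · intro x hxA hxt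
      have h1 := not_mem_atyp hxA hxt B (by simp)
      have h2 := not_mem_atyp hxA hxt C (by simp)
      have hBx : c / 2 * (p ^ 2 * order V) ≤ (nb G B x).card := by
        calc c / 2 * (p ^ 2 * order V) = p / 2 * (c * (p ^ 1 * order V)) := by ring
          _ ≤ p / 2 * B.card := by gcongr
          _ ≤ _ := h1
      have hCx : c / 2 * (p ^ 1 * order V) ≤ (nb G C x).card := by
        calc c / 2 * (p ^ 1 * order V) = p / 2 * (c * order V) := by ring
          _ ≤ p / 2 * C.card := by gcongr
          _ ≤ _ := h2
      refine card_filter_sdiff_ge (X := atyp G p (nb G B x) [nb G C x]) ?_ ?_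
      · refine h.card_atyp_le (c := c / 2) (by positivity) (a := 1) (b := 2) le_rfl
          (by simpa using hCx) ?_ ?_ hBx
        · intro D hD
          rw [List.mem_singleton] at hD
          rw [hD]
          exact disjoint_of_subset_left (nb_subset _ _) (disjoint_of_subset_right (nb_subset _ _) hBC)
        · rw [List.length_singleton, Nat.cast_one]
          linarith
      · intro y hy hyt
        have h3 := not_mem_atyp hy hyt (nb G C x) (by simp)
        calc c / 4 * (p ^ 2 * order V) = p / 2 * (c / 2 * (p ^ 1 * order V)) := by ring
          _ ≤ p / 2 * (nb G C x).card := by gcongr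
          _ ≤ _ := h3

/-- The path is `x₁ x₂ (f z) z w q y`. Half of the neighbours `z` of `x₂` in `U₄` have a partner `f
z`, adjacent to `x₁` and `x₂`, with about `p²n` common neighbours `w` in `U₅`. By the triangle count
almost every `q` then has about `p²n` usable `w`, and most neighbours `y` of `q` see one of them. -/
theorem hasReach_two : HasReach.{u} 2 3 3 := by
  intro c δ hc hδ
  obtain ⟨γ₁, hγ₁, H₁⟩ := exists_card_cherry_ge.{u} 2 hc
  obtain ⟨ρ, γ₂, hρ, hγ₂, H₂⟩ := exists_card_unreached_le.{u} 2 (a := c / 4)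
    (η := c * (δ / 2)) (by positivity) (by positivity)
  obtain ⟨γ, hγ, g1, g2, g3, g4⟩ := exists_pos_le₄ hγ₁ hγ₂
    (by positivity : 0 < c * c * (δ / 2) / 4) (by positivity : 0 < c / 4 / 64 * (δ * (c / 2)))
  refine ⟨γ, hγ, ?_⟩
  intro V _ G p h Cs Ws x hCs hWs hd hx hext
  have hp := h.p_pos
  have hp1 := h.p_le
  have hn := h.order_pos
  obtain ⟨U₃, U₄, U₅, rfl⟩ := List.length_eq_three.1 hCs
  obtain ⟨U₆, U₇, rfl⟩ := List.length_eq_two.1 hWs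
  obtain ⟨x₂, x₁, rfl⟩ := List.length_eq_two.1 hx
  simp only [List.cons_append, List.nil_append, List.pairwise_cons, List.mem_cons,
    List.not_mem_nil, or_false, forall_eq_or_imp, forall_eq, List.Pairwise.nil, and_true,
    IsEmpty.forall_iff, implies_true] at hd hext
  obtain ⟨⟨d34, d35, d36, d37⟩, ⟨d45, d46, d47⟩, ⟨d56, d57⟩, d67⟩ := hd
  obtain ⟨e3, e4, e5, e6, e7⟩ := hext
  set X₃ := cnb G U₃ [x₂, x₁] with hX₃
  set X₄ := cnb G U₄ [x₂] with hX₄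
  have s3 : X₃ ⊆ U₃ := cnb_subset _ _
  have s4 : X₄ ⊆ U₄ := cnb_subset _ _
  have hX₃c : c * (p ^ 2 * order V) ≤ X₃.card := e3 2 le_rfl
  have hX₄c : c * (p ^ 1 * order V) ≤ X₄.card := e4 1 (by norm_num)
  have hU₅ := e5.card_le
  have hU₆ := e6.card_le
  have hU₇ := e7.card_le
  have hZc := H₁ V G p (h.mono g1) X₃ X₄ U₅ (disjoint_of_subset_left s3 (disjoint_of_subset_right s4 d34))
    (disjoint_of_subset_left s3 d35) (disjoint_of_subset_left s4 d45) hX₃c hX₄c hU₅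
  set Z := X₄.filter (fun y => ∃ x ∈ X₃, G.Adj x y ∧
          c / 4 * (p ^ 2 * order V) ≤ (nb G (nb G U₅ x) y).card) with hZ
  have sZ : Z ⊆ U₄ := (filter_subset _ _).trans s4
  have hZex : ∀ z : V, ∃ x : V, z ∈ Z → x ∈ X₃ ∧ G.Adj x z ∧
      c / 4 * (p ^ 2 * order V) ≤ (nb G (nb G U₅ x) z).card := by
    intro z
    by_cases hz : z ∈ Z
    · obtain ⟨x, hx⟩ := (mem_filter.1 hz).2
      exact ⟨x, fun _ => hx⟩
    · exact ⟨z, fun h => absurd h hz⟩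
  choose f hf using hZex
  have hbad := H₂ V G p (h.mono g2) Z U₅ U₆ (fun z => nb G (nb G U₅ (f z)) z)
    (disjoint_of_subset_left sZ d45) (disjoint_of_subset_left sZ d46) d56
    (fun z _ => nb_comm U₅ (f z) z ▸ nb_subset _ _) (fun z hz => (hf z hz).2.2)
    (by rw [pow_one] at hX₄c; nlinarith [mul_pos hp hn])
  set I : V → Finset V := fun q => U₅.filter (fun w => ∃ z ∈ Z, w ∈ nb G (nb G U₅ (f z)) z ∧
    G.Adj z q ∧ G.Adj w q) with hI
  have hat : ((atyp G p U₆ [U₇]).card : ℝ) ≤ δ / 2 * U₆.card := by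
    refine h.card_atyp_le hc (a := 0) (b := 0) (by norm_num) (by simpa using hU₇)
      (by simpa using d67) ?_ (by simpa using hU₆)
    rw [List.length_singleton, Nat.cast_one]
    linarith
  have hn6 : U₆.Nonempty := h.nonempty_of_le (a := 0) hc (by simpa using hU₆)
  rw [most_cons]
  refine ⟨hn6, ?_⟩
  have hb' : (1 - δ / 2) * (U₆.card : ℝ) ≤
      (U₆.filter (fun q => c / 4 / 64 * (p ^ 2 * order V) ≤ (I q).card)).card := by
    refine card_filter_sdiff_ge (hbad.trans ?_) ?_
    · calc c * (δ / 2) * order V = δ / 2 * (c * order V) := by ring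
        _ ≤ _ := by gcongr
    · intro q hq hqn
      by_contra hlt
      exact hqn (mem_filter.2 ⟨hq, not_le.1 hlt⟩)
  refine le_trans (by linarith) (card_filter_and_ge hb' hat ?_)
  intro q hq hqI hqt
  have h7 := not_mem_atyp hq hqt U₇ (by simp)
  have hU₇q : c / 2 * (p ^ 1 * order V) ≤ (nb G U₇ q).card := by
    calc c / 2 * (p ^ 1 * order V) = p / 2 * (c * order V) := by ring
      _ ≤ p / 2 * U₇.card := by gcongr
      _ ≤ _ := h7
  rw [List.map_singleton, most_cons]
  refine ⟨h.nonempty_of_le (by positivity) hU₇q,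
    card_filter_sdiff_ge (X := (nb G U₇ q).filter (fun y => nb G (I q) y = ∅)) ?_ ?_⟩
  -- `I q` has exponent 2 and `nb G U₇ q` exponent 1.
  · have := h.empty_filter (A := I q) (B := (nb G U₇ q).filter (fun y => nb G (I q) y = ∅))
      (c := c / 4 / 64) (a := 2) (b := 1) (θ := δ * (c / 2)) (by positivity) hqI le_rfl g4
      (disjoint_of_subset_left (filter_subset _ _) (disjoint_of_subset_right
        ((filter_subset _ _).trans (nb_subset _ _)) d57)) (fun v hv => (mem_filter.1 hv).2)
    refine this.trans ?_
    rw [mul_assoc]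
    gcongr
  · intro y hy hyn
    obtain ⟨w, hw⟩ := nonempty_iff_ne_empty.2 fun he => hyn (mem_filter.2 ⟨hy, he⟩)
    rw [List.map_nil, most_nil]
    obtain ⟨hwI, hyw⟩ := mem_nb.1 hw
    obtain ⟨hw5, z, hzZ, hwz, hzq, hwq⟩ := mem_filter.1 hwI
    obtain ⟨hf3, hfz, -⟩ := hf z hzZ
    have hqy := (mem_nb.1 hy).2
    obtain ⟨hwf, hzw⟩ := mem_nb.1 hwz
    have hfw := (mem_nb.1 hwf).2
    have hz4 := mem_cnb.1 ((mem_filter.1 hzZ).1)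
    have hf3' := mem_cnb.1 hf3
    refine ⟨[f z, z, w], by simpa using ⟨s3 hf3, sZ hzZ, hw5⟩, ?_, ?_⟩
    · simp only [List.cons_append, List.nil_append, KP_two_cons, KP_two_pair]
      exact ⟨hfz, hfw, hzw, hzq, hwq, hyw.symm, hqy⟩
    · simp only [List.cons_append, List.nil_append, Cross_two]
      exact ⟨hf3'.2 _ (by simp), hz4.2 _ (by simp), hf3'.2 _ (by simp)⟩

end

/-! ### Wings of the gadget for squares -/

section

variable {V : Type u} {G : SimpleGraph V}

section
variable [Fintype V] {k τ : ℕ} {p γ : ℝ}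

theorem Psr.card_nb_ge (h : Psr G k τ p γ) {c : ℝ} {a : ℕ} {B : Finset V} {v : V}
    (hB : c * (p ^ a * order V) ≤ B.card) (hv : p / 2 * B.card ≤ (nb G B v).card) :
    c / 2 * (p ^ (a + 1) * order V) ≤ (nb G B v).card := by
  have := h.p_pos
  calc c / 2 * (p ^ (a + 1) * order V) = p / 2 * (c * (p ^ a * order V)) := by ring
    _ ≤ p / 2 * B.card := by gcongr
    _ ≤ _ := hv

theorem Psr.size_mono (h : Psr G k τ p γ) {c c' : ℝ} (hc : 0 ≤ c') (hcc : c' ≤ c) {a b : ℕ}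
    (hab : a ≤ b) {x : ℝ} (hx : c * (p ^ a * order V) ≤ x) : c' * (p ^ b * order V) ≤ x := by
  have hn := h.order_pos
  have hp := h.pow_le hab
  have := h.pow_pos b
  have := h.pow_pos a
  calc c' * (p ^ b * order V) ≤ c' * (p ^ a * order V) := by gcongr
    _ ≤ c * (p ^ a * order V) := by gcongr
    _ ≤ x := hx

/-- Few vertices are atypical for large sets, which need not be disjoint from the given one. -/
theorem Psr.card_atyp_le' (h : Psr G k τ p γ) {c : ℝ} (hc : 0 < c) {a b : ℕ} (hab : a + b ≤ τ)
    (ha : 2 * a ≤ τ) (hak : a ≤ k) {D : Finset V} {Bs : List (Finset V)}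
    (hBs : ∀ B ∈ Bs, c * (p ^ a * order V) ≤ B.card) {θ : ℝ} (hθ : 64 * γ * Bs.length ≤ c * c * θ)
    (hγ : 1024 * γ < c ^ 2) (hγ' : 8 * γ ≤ c) (hD : c * (p ^ b * order V) ≤ D.card) :
    ((atyp G p D Bs).card : ℝ) ≤ θ * D.card := by
  have hγ0 := h.gamma_pos
  have hb := h.pow_mul_pos b
  have hsub : atyp G p D Bs ⊆ Bs.toFinset.biUnion
      (fun B => D.filter (fun v => ((nb G B v).card : ℝ) ≤ p / 2 * B.card)) := by
    intro v hv
    obtain ⟨hvD, B, hB, hlt⟩ := mem_filter.1 hv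
    exact mem_biUnion.2 ⟨B, by simpa using hB, mem_filter.2 ⟨hvD, hlt.le⟩⟩
  have h1 : ((atyp G p D Bs).card : ℝ) ≤ Bs.length * (64 * γ / c * (p ^ b * order V)) := by
    calc ((atyp G p D Bs).card : ℝ) ≤ ∑ B ∈ Bs.toFinset,
          ((D.filter (fun v => ((nb G B v).card : ℝ) ≤ p / 2 * B.card)).card : ℝ) := by
          exact_mod_cast (card_le_card hsub).trans card_biUnion_le
      _ ≤ Bs.toFinset.card * (64 * γ / c * (p ^ b * order V)) := by
          rw [← nsmul_eq_mul]
          refine sum_le_card_nsmul _ _ _ fun B hB => ?_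
          exact h.low_filter' hc (hBs B (by simpa using hB)) hab ha hak
            (le_of_eq (by field_simp)) hγ hγ' fun v hv => (mem_filter.1 hv).2
      _ ≤ _ := by
          gcongr
          exact List.toFinset_card_le _
  have hθ0 : 0 ≤ θ := by
    have : 0 ≤ c * c * θ := le_trans (by positivity) hθ
    by_contra hlt
    nlinarith [mul_pos hc hc]
  refine h1.trans ?_
  calc Bs.length * (64 * γ / c * (p ^ b * order V))
      = 64 * γ * Bs.length / c * (p ^ b * order V) := by ring
    _ ≤ c * c * θ / c * (p ^ b * order V) := by gcongr
    _ = θ * (c * (p ^ b * order V)) := by field_simp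
    _ ≤ _ := by gcongr

end

/-- This is the unit step of the greedy choices for `τ = 3`: a vertex from a set of exponent 2,
typical for boundedly many sets of exponent 1, possibly overlapping. -/
theorem exists_typical_of_list (N : ℕ) {c : ℝ} (hc : 0 < c) :
    ∃ γ : ℝ, 0 < γ ∧ ∀ (V : Type u) [Fintype V] (G : SimpleGraph V) (p : ℝ), Psr G 2 3 p γ →
      ∀ (D : Finset V) (Bs : List (Finset V)), Bs.length ≤ N → c * (p ^ 2 * order V) ≤ D.card →
        (∀ B ∈ Bs, c * (p ^ 1 * order V) ≤ B.card) →
        ∃ v ∈ D, ∀ B ∈ Bs, p / 2 * B.card ≤ (nb G B v).card := by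
  obtain ⟨γ, hγ, g1, g2, g3⟩ := exists_pos_le₃ (by positivity : 0 < c * c * (1 / 2) / (64 * (N + 1)))
    (by positivity : 0 < c ^ 2 / 2048) (by positivity : 0 < c / 8)
  refine ⟨γ, hγ, ?_⟩
  intro V _ G p h D Bs hN hD hBs
  have h1 := h.card_atyp_le' hc (a := 1) (b := 2) le_rfl (by norm_num) (by norm_num) hBs
    (θ := 1 / 2) (by
      have : (Bs.length : ℝ) ≤ N + 1 := by exact_mod_cast hN.trans (Nat.le_succ N)
      rw [le_div_iff₀ (by positivity)] at g1
      calc 64 * γ * Bs.length ≤ 64 * γ * (N + 1) := by gcongr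
        _ = γ * (64 * (N + 1)) := by ring
        _ ≤ _ := g1) (by have : 0 < c ^ 2 := by positivity
                         linarith) (by linarith) hD
  have hD0 : (0:ℝ) < D.card := (mul_pos hc (h.pow_mul_pos 2)).trans_le hD
  have h2 : (D \ atyp G p D Bs).Nonempty := by
    rw [← card_pos]
    by_contra hcon
    have h3 : (D.card : ℝ) ≤ (D \ atyp G p D Bs).card + (atyp G p D Bs).card := by
      exact_mod_cast card_le_card_sdiff_add_card
    have h4 : (D \ atyp G p D Bs).card = 0 := by omega
    rw [h4] at h3
    push_cast at h3
    linarith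
  obtain ⟨v, hv⟩ := h2
  obtain ⟨hvD, hvt⟩ := mem_sdiff.1 hv
  exact ⟨v, hvD, not_mem_atyp hvD hvt⟩

theorem Extd_two [Fintype V] {p c : ℝ} {f w : V} {X : Finset V} (h0 : c * order V ≤ X.card)
    (h1 : c * (p ^ 1 * order V) ≤ (nb G X f).card)
    (h2 : c * (p ^ 2 * order V) ≤ (nb G (nb G X w) f).card) : Extd G 2 p c [f, w] X := by
  intro j hj
  interval_cases j
  · simpa [cnb_nil] using h0
  · simpa [cnb_nil, cnb_cons] using h1
  · simpa [cnb_nil, cnb_cons] using h2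

/-- The vertex `l` has suitable neighbours in `C` and, together with `m`, in `E`. -/
def Wing [Fintype V] (G : SimpleGraph V) (p c : ℝ) (w : V) (C E : Finset V) (Ks Ks' : List (Finset V))
    (m l : V) : Prop :=
  (∃ f ∈ C, G.Adj f l ∧ ∀ X ∈ Ks, Extd G 2 p c [f, w] X) ∧
    ∃ f ∈ E, G.Adj f l ∧ G.Adj f m ∧ ∀ X ∈ Ks', Extd G 2 p c [f, l] X

-- For a typical `l` in `D` there is a neighbour in `C` (exponents 1 and 2), and most `m` in `nb G M
-- l` have a neighbour in `nb G E l` (again 1 and 2). The quantifiers are then exchanged, so that a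
-- single `m` can serve two wings. Removing atypical vertices of `C` and `nb G E l` beforehand makes
-- the pairs extendable.
set_option maxHeartbeats 1000000 in
theorem exists_wing (N : ℕ) {c q : ℝ} (hc : 0 < c) (hq : 0 < q) (hq1 : q ≤ 1 / 2) :
    ∃ c' γ : ℝ, 0 < c' ∧ 0 < γ ∧ ∀ (V : Type u) [Fintype V] (G : SimpleGraph V) (p : ℝ),
      Psr G 2 3 p γ → ∀ (w : V) (C D E M : Finset V) (Ks Ks' : List (Finset V)),
        Ks.length ≤ N → Ks'.length ≤ N → c * (p ^ 2 * order V) ≤ C.card →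
        c * (p ^ 1 * order V) ≤ D.card → c * (p ^ 1 * order V) ≤ E.card → c * order V ≤ M.card →
        (∀ X ∈ Ks, c * order V ≤ X.card ∧ c * (p ^ 1 * order V) ≤ (nb G X w).card) →
        (∀ X ∈ Ks', c * order V ≤ X.card) → Disjoint C D → Disjoint D M → Disjoint E M →
        (1 - 2 * q) * (M.card : ℝ) ≤ (M.filter (fun m => c' * (p ^ 2 * order V) ≤
          ((nb G D m).filter (fun l => Wing G p c' w C E Ks Ks' m l)).card)).card := by
  obtain ⟨δ, γ₁, hδ, hδ', hγ₁, Hs⟩ := exists_most_swap.{u} 2 3 hc hq (by linarith)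
  set c₁ : ℝ := c / 4 with hc₁
  have hc₁0 : 0 < c₁ := by positivity
  have hcc : c₁ ≤ c := by rw [hc₁]; linarith
  have hcc2 : c₁ ≤ c / 2 := by rw [hc₁]; linarith
  obtain ⟨γ, hγ, g1, g2, g3, g4⟩ := exists_pos_le₄ hγ₁
    (by positivity : 0 < c₁ * c₁ * (min (δ / 2) (1 / 2)) / (64 * (2 * N + 2)))
    (by positivity : 0 < c₁ ^ 2 / 2048) (by positivity : 0 < c₁ / 8)
  have hm1 : min (δ / 2) (1 / 2) ≤ δ / 2 := min_le_left _ _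
  have hm2 : min (δ / 2) (1 / 2) ≤ 1 / 2 := min_le_right _ _
  set θ := min (δ / 2) (1 / 2) with hθ
  have hθ0 : 0 < θ := by positivity
  clear_value θ
  refine ⟨c / 4 , γ, by positivity, hγ, ?_⟩
  intro V _ G p h w C D E M Ks Ks' hKs hKs' hC hD hE hM hK hK' hCD hDM hEM
  have hp := h.p_pos
  have hγ' : 64 * γ * (2 * N + 2) ≤ c₁ * c₁ * θ := by
    rw [le_div_iff₀ (by positivity)] at g2
    linarith
  have hAt : ∀ (b : ℕ), b ≤ 2 → ∀ (D' : Finset V) (Bs : List (Finset V)), Bs.length ≤ 2 * N + 2 →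
      (∀ B ∈ Bs, c₁ * (p ^ 1 * order V) ≤ B.card) → c₁ * (p ^ b * order V) ≤ D'.card →
      ((atyp G p D' Bs).card : ℝ) ≤ θ * D'.card := by
    intro b hb D' Bs hl hBs hD'
    refine h.card_atyp_le' hc₁0 (a := 1) (b := b) (by omega) (by norm_num) (by norm_num) hBs ?_
      (by have : 0 < c₁ ^ 2 := by positivity
          linarith) (by linarith) hD'
    have : (Bs.length : ℝ) ≤ 2 * N + 2 := by exact_mod_cast hl
    calc 64 * γ * Bs.length ≤ 64 * γ * (2 * N + 2) := by gcongr
      _ ≤ _ := hγ'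
  have hEm : ∀ A B : Finset V, Disjoint A B → c₁ * (p ^ 2 * order V) ≤ A.card →
      c₁ * (p ^ 1 * order V) ≤ B.card →
      ((B.filter (fun v => nb G A v = ∅)).card : ℝ) ≤ θ * B.card := by
    intro A B hAB hA hB
    refine (h.empty_filter (A := A) hc₁0 hA (b := 1) (θ := θ * c₁) le_rfl ?_
      (disjoint_of_subset_right (filter_subset _ _) hAB) fun v hv => (mem_filter.1 hv).2).trans ?_
    · nlinarith [(Nat.cast_nonneg N : (0:ℝ) ≤ N)]
    · rw [mul_assoc]
      gcongr
  have hhalf : ∀ (b : ℕ) (D' X : Finset V), 2 * c₁ * (p ^ b * order V) ≤ D'.card →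
      (X.card : ℝ) ≤ θ * D'.card → c₁ * (p ^ b * order V) ≤ (D' \ X).card := by
    intro b D' X hD' hX
    have h1 : (D'.card : ℝ) ≤ (D' \ X).card + X.card := by
      exact_mod_cast card_le_card_sdiff_add_card
    nlinarith [h.pow_mul_pos b]
  have hext : ∀ (D' : Finset V) (w f : V) (Ls : List (Finset V)) (X : Finset V), X ∈ Ls →
      c * order V ≤ X.card → c / 2 * (p ^ 1 * order V) ≤ (nb G X w).card → f ∈ D' →
      f ∉ atyp G p D' (Ls ++ Ls.map (fun X => nb G X w)) → Extd G 2 p (c / 4) [f, w] X := by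
    intro D' w f Ls X hX h1 h2 hf hft
    have ht := not_mem_atyp hf hft
    have h3 := h.card_nb_ge (a := 0) (by simpa using h1) (ht X (by simp [hX]))
    have h4 := h.card_nb_ge h2 (ht (nb G X w) (by
      rw [List.mem_append, List.mem_map]
      exact Or.inr ⟨X, hX, rfl⟩))
    refine Extd_two ?_ ?_ ?_
    · have := h.order_pos
      nlinarith
    · exact h.size_mono (by positivity) (by linarith) le_rfl h3
    · exact h.size_mono (by positivity) (by linarith) le_rfl h4
  set C' := C \ atyp G p C (Ks ++ Ks.map (fun X => nb G X w)) with hC'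
  have hC'c : c₁ * (p ^ 2 * order V) ≤ C'.card := by
    refine hhalf 2 C _ (h.size_mono (by positivity) (by linarith) le_rfl hC)
      (hAt 2 le_rfl _ _ (by simp; omega) (fun B hB => ?_)
        (h.size_mono (by positivity) (by linarith) le_rfl hC))
    rw [List.mem_append, List.mem_map] at hB
    rcases hB with hB | ⟨B, hB, rfl⟩
    · exact h.size_mono (a := 0) (by positivity) hcc (by norm_num) (by simpa using (hK B hB).1)
    · exact h.size_mono (by positivity) hcc le_rfl (hK B hB).2
  have hsw := Hs V G p (h.mono g1) D M 1 0 (fun l m => Wing G p (c / 4) w C E Ks Ks' m l)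
    (by norm_num) hDM hD (by simpa using hM) ?_
  · have hat : ((atyp G p M [D]).card : ℝ) ≤ q * M.card := by
      refine (hAt 0 (by norm_num) M [D] (by simp) (by
        simpa using h.size_mono (by positivity) hcc le_rfl hD)
        (h.size_mono (a := 0) (by positivity) hcc le_rfl (by simpa using hM))).trans ?_
      have : θ ≤ q := by linarith
      gcongr
    refine le_trans (le_of_eq (by ring)) (card_filter_and_ge hsw hat ?_)
    intro m hmM hm hmt
    refine le_trans ?_ hm
    have h1 := h.card_nb_ge hD (not_mem_atyp hmM hmt D (by simp))
    norm_num at h1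
    nlinarith [h.pow_mul_pos 2]
  · refine card_filter_sdiff_ge (X := atyp G p D (E :: M :: Ks') ∪ D.filter (fun l => nb G C' l = ∅))
      ?_ ?_
    · have h1 := hAt 1 (by norm_num) D (E :: M :: Ks') (by simp; omega) (fun B hB => ?_)
        (h.size_mono (by positivity) hcc le_rfl hD)
      · have h2 := hEm C' D (disjoint_of_subset_left sdiff_subset hCD) hC'c
          (h.size_mono (by positivity) hcc le_rfl hD)
        have h3 : (((atyp G p D (E :: M :: Ks') ∪ D.filter (fun l => nb G C' l = ∅)).card : ℕ) : ℝ) ≤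
            (atyp G p D (E :: M :: Ks')).card + (D.filter (fun l => nb G C' l = ∅)).card := by
          exact_mod_cast card_union_le _ _
        have : θ * (D.card : ℝ) ≤ δ / 2 * D.card := by gcongr
        linarith
      · simp only [List.mem_cons] at hB
        rcases hB with rfl | rfl | hB
        · exact h.size_mono (by positivity) hcc le_rfl hE
        · exact h.size_mono (a := 0) (by positivity) hcc (by norm_num) (by simpa using hM)
        · exact h.size_mono (a := 0) (by positivity) hcc (by norm_num) (by simpa using hK' B hB)
    · intro l hl hlt
      rw [mem_union, not_or] at hlt
      have ht := not_mem_atyp hl hlt.1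
      obtain ⟨f, hf⟩ := nonempty_iff_ne_empty.2 fun he => hlt.2 (mem_filter.2 ⟨hl, he⟩)
      obtain ⟨hfC', hlf⟩ := mem_nb.1 hf
      obtain ⟨hfC, hft⟩ := mem_sdiff.1 hfC'
      have hEl := h.card_nb_ge hE (ht E (by simp))
      have hMl := h.card_nb_ge (a := 0) (by simpa using hM) (ht M (by simp))
      have hXl : ∀ X ∈ Ks', c / 2 * (p ^ 1 * order V) ≤ (nb G X l).card := fun X hX =>
        h.card_nb_ge (a := 0) (by simpa using hK' X hX) (ht X (by simp [hX]))
      set E' := nb G E l \ atyp G p (nb G E l) (Ks' ++ Ks'.map (fun X => nb G X l)) with hE'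
      have hE'c : c₁ * (p ^ 2 * order V) ≤ E'.card := by
        refine hhalf 2 _ _ (h.size_mono (by positivity) (by linarith) le_rfl hEl)
          (hAt 2 le_rfl _ _ (by simp; omega) (fun B hB => ?_)
            (h.size_mono (by positivity) hcc2 le_rfl hEl))
        rw [List.mem_append, List.mem_map] at hB
        rcases hB with hB | ⟨B, hB, rfl⟩
        · exact h.size_mono (a := 0) (by positivity) hcc (by norm_num) (by simpa using hK' B hB)
        · exact h.size_mono (by positivity) hcc2 le_rfl (hXl B hB)
      refine card_filter_sdiff_ge (X := (nb G M l).filter (fun m => nb G E' m = ∅)) ?_ ?_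
      · refine (hEm E' (nb G M l) (disjoint_of_subset_left (sdiff_subset.trans (nb_subset _ _))
          (disjoint_of_subset_right (nb_subset _ _) hEM)) hE'c
          (h.size_mono (by positivity) hcc2 le_rfl hMl)).trans ?_
        have : θ ≤ δ := by linarith
        gcongr
      · intro m hm hmt
        obtain ⟨f', hf'⟩ := nonempty_iff_ne_empty.2 fun he => hmt (mem_filter.2 ⟨hm, he⟩)
        obtain ⟨hf'E', hmf'⟩ := mem_nb.1 hf'
        obtain ⟨hf'E, hf't⟩ := mem_sdiff.1 hf'E'
        refine ⟨⟨f, hfC, hlf.symm, fun X hX => ?_⟩, f', (mem_nb.1 hf'E).1, (mem_nb.1 hf'E).2.symm,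
          hmf'.symm, fun X hX => ?_⟩
        · exact hext C w f Ks X hX (hK X hX).1
            (h.size_mono (by positivity) (by linarith) le_rfl (hK X hX).2) hfC hft
        · exact hext _ l f' Ks' X hX (hK' X hX) (hXl X hX) hf'E hf't

end

/-! ### The two orderings of the gadget for squares -/

section

section
variable {V : Type u} {G : SimpleGraph V}

theorem KP_two_join {a b c d : V} {z l : List V} (hab : G.Adj a b) (hz : KP G 2 z)
    (h2 : 2 ≤ z.length) (h1 : Cross G 2 [b, a] z) (h3 : Cross G 2 z.reverse [c, d])
    (hl : KP G 2 (c :: d :: l)) : KP G 2 (a :: b :: (z ++ c :: d :: l)) :=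
  KP_join (l₁ := [a, b]) (KP_two_pair.2 hab) hl hz h2 h1 h3

theorem nodup_of_forall₂_mem {l : List V} {Ss : List (Finset V)} (h : List.Forall₂ (· ∈ ·) l Ss)
    (hd : Ss.Pairwise Disjoint) : l.Nodup := by
  induction h with
  | nil => exact List.nodup_nil
  | @cons a S l Ss haS hr ih =>
    rw [List.pairwise_cons] at hd
    refine List.nodup_cons.2 ⟨fun hal => ?_, ih hd.2⟩
    obtain ⟨i, hi, rfl⟩ := List.mem_iff_getElem.1 hal
    have h1 := hr.get (i := i) hi (hr.length_eq ▸ hi)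
    exact disjoint_left.1 (hd.1 _ (List.getElem_mem _)) haS h1

theorem exists_disjoint_list (A : Finset V) {m : ℕ} {x : ℝ} (hm : 0 < m)
    (hx : (m : ℝ) ≤ x) (h : x ≤ A.card) :
    ∃ L : List (Finset V), L.length = m ∧ L.Pairwise Disjoint ∧
      ∀ X ∈ L, X ⊆ A ∧ x / (2 * m) ≤ X.card := by
  obtain ⟨f, hf, hd⟩ := exists_disjoint_subsets_real A hm hx h
  refine ⟨(List.range m).map f, by simp, ?_, fun X hX => ?_⟩
  · rw [List.pairwise_map]
    exact List.nodup_range.imp_of_mem fun ha hb hab =>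
      hd _ (List.mem_range.1 ha) _ (List.mem_range.1 hb) hab
  · obtain ⟨i, hi, rfl⟩ := List.mem_map.1 hX
    exact hf i (List.mem_range.1 hi)

/-- The elements of `P` outside `X` fill at least half of `D`, so they must meet the three quarters
satisfying `Q`. -/
theorem exists_mem_of_card {D X : Finset V} {P Q : V → Prop} [DecidablePred P] [DecidablePred Q]
    (hD : D.Nonempty) (hP : (1 - 1 / 4) * (D.card : ℝ) ≤ (D.filter P).card)
    (hQ : (1 - 1 / 4) * (D.card : ℝ) ≤ (D.filter Q).card) (hX : (X.card : ℝ) ≤ 1 / 4 * D.card) :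
    ∃ d ∈ D, P d ∧ Q d ∧ d ∉ X := by
  have h1 := card_filter_and_ge (Q := fun d => P d ∧ d ∉ X) hP hX fun a _ h h' => ⟨h, h'⟩
  by_contra! hcon
  have h2 : Disjoint (D.filter (fun d => P d ∧ d ∉ X)) (D.filter Q) := by
    rw [disjoint_left]
    intro a ha hb
    obtain ⟨ha1, ha2, ha3⟩ := mem_filter.1 ha
    exact ha3 (hcon a ha1 ha2 (mem_filter.1 hb).2)
  have h3 := card_le_card (union_subset (filter_subset (fun d => P d ∧ d ∉ X) D)
    (filter_subset Q D))
  rw [card_union_of_disjoint h2] at h3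
  have h4 : ((D.filter (fun d => P d ∧ d ∉ X)).card : ℝ) + (D.filter Q).card ≤ D.card := by
    exact_mod_cast h3
  have h5 : (0:ℝ) < D.card := by exact_mod_cast hD.card_pos
  linarith

/-- The flexible path of the absorbing gadget for squares of paths. -/
theorem Flex.of_gadget {v l₀ l₁ l₂ m r₁ r₀ f₀ f₁ f₂ f₃ f₄ f₅ : V} {z z' : List V}
    (hnd : (f₀ :: l₀ :: l₁ :: f₁ :: (z ++ f₄ :: r₁ :: r₀ :: f₅ :: (z' ++ [f₂, l₂, m, f₃]))).Nodup)
    (hv : v ∉ f₀ :: l₀ :: l₁ :: f₁ :: (z ++ f₄ :: r₁ :: r₀ :: f₅ :: (z' ++ [f₂, l₂, m, f₃])))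
    (hz : KP G 2 z) (hz2 : 2 ≤ z.length) (hz' : KP G 2 z') (hz2' : 2 ≤ z'.length)
    (c1 : Cross G 2 [f₁, l₁] z) (c2 : Cross G 2 z.reverse [f₄, r₁])
    (c3 : Cross G 2 [f₅, r₀] z') (c4 : Cross G 2 z'.reverse [f₂, l₂])
    (hl0l1 : G.Adj l₀ l₁) (hl0r0 : G.Adj l₀ r₀) (hl0v : G.Adj l₀ v) (hvr0 : G.Adj v r₀)
    (hr1r0 : G.Adj r₁ r₀) (hr1m : G.Adj r₁ m) (hl2m : G.Adj l₂ m) (hl2l1 : G.Adj l₂ l₁)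
    (hf0v : G.Adj f₀ v) (hf0l0 : G.Adj f₀ l₀) (hf0l1 : G.Adj f₀ l₁)
    (hl0f1 : G.Adj l₀ f₁) (hl1f1 : G.Adj l₁ f₁) (hl2f1 : G.Adj l₂ f₁)
    (hf2l1 : G.Adj f₂ l₁) (hf2l2 : G.Adj f₂ l₂) (hf2m : G.Adj f₂ m)
    (hl2f3 : G.Adj l₂ f₃) (hmf3 : G.Adj m f₃) (hr1f3 : G.Adj r₁ f₃)
    (hf4m : G.Adj f₄ m) (hf4r1 : G.Adj f₄ r₁) (hf4r0 : G.Adj f₄ r₀)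
    (hr1f5 : G.Adj r₁ f₅) (hr0f5 : G.Adj r₀ f₅) (hvf5 : G.Adj v f₅) :
    Flex G 2 (insert v (f₀ :: l₀ :: l₁ :: f₁ :: (z ++ f₄ :: r₁ :: r₀ :: f₅ ::
      (z' ++ [f₂, l₂, m, f₃]))).toFinset) {v} [f₀, l₀] [f₃, m] := by
  have hrev : ∀ a b c d : V, ∀ l : List V,
      (a :: b :: (l ++ [c, d])).reverse.take 2 = [d, c] := by
    intro a b c d l
    simp
  -- With blocks `X = l₁ f₁ z f₄ r₁` and `Y = r₀ f₅ z' f₂ l₂`, the list without `v` is `f₀ l₀ X Y m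
  -- f₃`, and the one with `v` is `f₀ l₀ v Y X m f₃`. Only the seams between blocks change, and the
  -- extra adjacencies serve both sets of seams.
  have key := Flex.of_two_lists (G := G) (k := 2)
    (l := f₀ :: l₀ :: l₁ :: f₁ :: (z ++ f₄ :: r₁ :: r₀ :: f₅ :: (z' ++ [f₂, l₂, m, f₃])))
    (l' := f₀ :: l₀ :: v :: r₀ :: f₅ :: (z' ++ f₂ :: l₂ :: l₁ :: f₁ :: (z ++ [f₄, r₁, m, f₃])))
    (v := v) hnd ?_ ?_ (by simp) ?_ hv (by simp) ?_
  · have h1 : (f₀ :: l₀ :: l₁ :: f₁ :: (z ++ f₄ :: r₁ :: r₀ :: f₅ ::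
        (z' ++ [f₂, l₂, m, f₃]))).reverse.take 2 = [f₃, m] := by
      simp
    rw [h1] at key
    simpa only [List.take_succ_cons, List.take_zero] using key
  · rw [KP_two_cons, KP_two_cons]
    refine ⟨hf0l0, hf0l1, hl0l1, hl0f1, KP_two_join hl1f1 hz hz2 c1 c2 ?_⟩
    rw [KP_two_cons, KP_two_cons]
    refine ⟨hf4r1, hf4r0, hr1r0, hr1f5, KP_two_join hr0f5 hz' hz2' c3 c4 ?_⟩
    simp only [KP_two_cons, KP_two_pair]
    exact ⟨hf2l2, hf2m, hl2m, hl2f3, hmf3⟩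
  · rw [KP_two_cons, KP_two_cons, KP_two_cons]
    refine ⟨hf0l0, hf0v, hl0v, hl0r0, hvr0, hvf5, KP_two_join hr0f5 hz' hz2' c3 c4 ?_⟩
    rw [KP_two_cons, KP_two_cons]
    refine ⟨hf2l2, hf2l1, hl2l1, hl2f1, KP_two_join hl1f1 hz hz2 c1 c2 ?_⟩
    simp only [KP_two_cons, KP_two_pair]
    exact ⟨hf4r1, hf4m, hr1m, hr1f3, hmf3⟩
  · rw [List.perm_iff_count]
    intro a
    simp only [List.count_cons, List.count_append, List.count_nil]
    ring
  · simp

end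

theorem Psr.extd_two_of_typical {V : Type u} {G : SimpleGraph V} [Fintype V] {k τ : ℕ} {p γ : ℝ}
    (h : Psr G k τ p γ) {c : ℝ} (hc : 0 ≤ c) {f w : V} {X : Finset V} (h0 : c * order V ≤ X.card)
    (h1 : c / 2 * (p ^ 1 * order V) ≤ (nb G X w).card) (h2 : p / 2 * X.card ≤ (nb G X f).card)
    (h3 : p / 2 * (nb G X w).card ≤ (nb G (nb G X w) f).card) : Extd G 2 p (c / 4) [f, w] X := by
  have h4 := h.card_nb_ge (a := 0) (by simpa using h0) h2
  have h5 := h.card_nb_ge h1 h3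
  refine Extd_two ?_ ?_ ?_
  · have := h.order_pos
    nlinarith
  · exact h.size_mono (by positivity) (by linarith) le_rfl h4
  · exact h.size_mono (by positivity) (by linarith) le_rfl h5

end

/-! ### Construction of the gadget for squares -/

section

theorem exists_list_split {α : Type u} {L : List α} (hL : L.length = 28) :
    ∃ a₁ a₂ a₃ a₄ K a₅ a₆ a₇ a₈ K' a₉ b₁ b₂ b₃,
      L = a₁ :: a₂ :: a₃ :: a₄ :: (K ++ a₅ :: a₆ :: a₇ :: a₈ :: (K' ++ [a₉, b₁, b₂, b₃])) ∧
        K.length = 8 ∧ K'.length = 8 := by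
  have key : ∀ (m : ℕ) (L : List α), L.length = m + 4 →
      ∃ a b c d L', L = a :: b :: c :: d :: L' ∧ L'.length = m := by
    intro m L hL
    obtain ⟨a, L, rfl⟩ := List.exists_cons_of_length_eq_add_one hL
    obtain ⟨b, L, rfl⟩ := List.exists_cons_of_length_eq_add_one (Nat.succ.inj hL)
    obtain ⟨c, L, rfl⟩ := List.exists_cons_of_length_eq_add_one (Nat.succ.inj (Nat.succ.inj hL))
    obtain ⟨d, L, rfl⟩ := List.exists_cons_of_length_eq_add_one
      (Nat.succ.inj (Nat.succ.inj (Nat.succ.inj hL)))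
    exact ⟨a, b, c, d, L, rfl, by simpa using hL⟩
  obtain ⟨a₁, a₂, a₃, a₄, L₁, rfl, h1⟩ := key 24 L hL
  obtain ⟨a₅, a₆, a₇, a₈, L₂, h2, h3⟩ := key 12 (L₁.drop 8) (by simp [h1])
  obtain ⟨a₉, b₁, b₂, b₃, L₃, h4, h5⟩ := key 0 (L₂.drop 8) (by simp [h3])
  rw [List.length_eq_zero_iff] at h5
  subst h5
  refine ⟨a₁, a₂, a₃, a₄, L₁.take 8, a₅, a₆, a₇, a₈, L₂.take 8, a₉, b₁, b₂, b₃, ?_, by simp [h1],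
    by simp [h3]⟩
  rw [← h4, List.take_append_drop, ← h2, List.take_append_drop]

-- The vertices `v, l₀, r₀, f₀, l₁` are picked greedily as typical vertices. Two applications of
-- `exists_wing`, at `l₁` and at `r₀`, share the vertex `m` and provide `l₂, f₁, f₂` and `r₁, f₄,
-- f₅`. Finally `z` and `z'` are connecting paths.
set_option maxHeartbeats 2000000 in
theorem hasGadgets_two (hconn : HasConnections.{u} 2 3 8) : HasGadgets.{u} 2 3 := by
  intro c N hc
  -- `A` is cut into 28 parts, for the twelve named vertices besides `v` and eight for each
  -- connecting path; rounding costs a factor 2.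
  set c₀ : ℝ := c / 56 with hc₀
  have hc₀0 : 0 < c₀ := by positivity
  set c₁ : ℝ := c₀ / 4 with hc₁
  have hc₁0 : 0 < c₁ := by positivity
  have hc₁₀ : c₁ ≤ c₀ := by linarith
  have hc₀c : c₀ ≤ c := by linarith
  obtain ⟨γ₁, hγ₁, Ht⟩ := exists_typical_of_list.{u} (2 * N + 16) hc₁0
  obtain ⟨c₂, γ₂, hc₂0, hγ₂, Hw⟩ := exists_wing.{u} 8 (c := c₁) (q := 1 / 8) hc₁0 (by norm_num)
    (by norm_num)
  obtain ⟨γ₃, hγ₃, Hc⟩ := hconn c₂ hc₂0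
  obtain ⟨γ₄, hγ₄, g1, g2, g3, g4⟩ := exists_pos_le₄
    (by positivity : 0 < c₁ * c₁ * (1 / 4) / (64 * (2 * N + 2)))
    (by positivity : 0 < c₁ ^ 2 / 2048) (by positivity : 0 < c₁ / 8)
    (by positivity : 0 < c₂ * (1 / 4 * c₁))
  obtain ⟨γ, hγ, e1, e2, e3, e4⟩ := exists_pos_le₄ hγ₁ hγ₂ hγ₃ hγ₄
  refine ⟨c / 4, min γ (c / 28), 29, by positivity, by positivity, ?_⟩
  intro V _ G p h' T A 𝒰 hTA hT hA h𝒰 hU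
  have h := h'.mono (min_le_left _ _)
  have hp := h.p_pos
  have hn := h.order_pos
  have hAt : ∀ (b : ℕ), b ≤ 2 → ∀ (D' : Finset V) (Bs : List (Finset V)), Bs.length ≤ 2 * N + 2 →
      (∀ B ∈ Bs, c₁ * (p ^ 1 * order V) ≤ B.card) → c₁ * (p ^ b * order V) ≤ D'.card →
      ((atyp G p D' Bs).card : ℝ) ≤ 1 / 4 * D'.card := by
    intro b hb D' Bs hl hBs hD'
    refine h.card_atyp_le' hc₁0 (a := 1) (b := b) (by omega) (by norm_num) (by norm_num) hBs ?_
      (by have : 0 < c₁ ^ 2 := by positivity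
          linarith) (by linarith) hD'
    have : (Bs.length : ℝ) ≤ 2 * N + 2 := by exact_mod_cast hl
    rw [le_div_iff₀ (by positivity)] at g1
    calc 64 * γ * Bs.length ≤ 64 * γ * (2 * N + 2) := by gcongr
      _ ≤ 64 * γ₄ * (2 * N + 2) := by gcongr
      _ = γ₄ * (64 * (2 * N + 2)) := by ring
      _ ≤ _ := g1
  have hEm : ∀ A B : Finset V, Disjoint A B → c₂ * (p ^ 2 * order V) ≤ A.card →
      c₁ * (p ^ 1 * order V) ≤ B.card →
      ((B.filter (fun v => nb G A v = ∅)).card : ℝ) ≤ 1 / 4 * B.card := by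
    intro A B hAB hA hB
    refine (h.empty_filter (A := A) hc₂0 hA (b := 1) (θ := 1 / 4 * c₁) le_rfl (e4.trans g4)
      (disjoint_of_subset_right (filter_subset _ _) hAB) fun v hv => (mem_filter.1 hv).2).trans ?_
    rw [mul_assoc]
    gcongr
  -- the parts
  obtain ⟨L, hL, hLd, hLA⟩ := exists_disjoint_list A (m := 28) (x := c * order V) (by norm_num) (by
    have := h'.le_pow_order (D := 28 / c) (m := 0) (by
      calc min γ (c / 28) * (28 / c) ≤ c / 28 * (28 / c) := by
            gcongr
            exact min_le_right _ _
        _ = 1 := by field_simp) (by norm_num)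
    rw [pow_zero, one_mul, div_le_iff₀ hc] at this
    push_cast
    linarith) hA
  have hLc : ∀ X ∈ L, c₀ * (p ^ 0 * order V) ≤ X.card := fun X hX => by
    refine le_trans (le_of_eq ?_) (hLA X hX).2
    rw [hc₀]
    push_cast
    ring
  obtain ⟨F₀, N₀, N₁, F₁, K, F₄, R₁, R₀, F₅, K', F₂, N₂, M, F₃, rfl, hK, hK'⟩ :
      ∃ F₀ N₀ N₁ F₁ K F₄ R₁ R₀ F₅ K' F₂ N₂ M F₃,
        L = F₀ :: N₀ :: N₁ :: F₁ :: (K ++ F₄ :: R₁ :: R₀ :: F₅ :: (K' ++ [F₂, N₂, M, F₃])) ∧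
        K.length = 8 ∧ K'.length = 8 := exists_list_split hL
  have htp : ∀ (D : Finset V) (Bs : List (Finset V)), Bs.length ≤ 2 * N + 16 →
      c₁ * (p ^ 2 * order V) ≤ D.card → (∀ B ∈ Bs, c₁ * (p ^ 1 * order V) ≤ B.card) →
      ∃ v ∈ D, ∀ B ∈ Bs, p / 2 * B.card ≤ (nb G B v).card := Ht V G p (h.mono e1)
  have hNU : 𝒰.toList.length ≤ N := by simpa using h𝒰
  have z01 : ∀ B : Finset V, c₀ * (p ^ 0 * order V) ≤ B.card → c₁ * (p ^ 1 * order V) ≤ B.card :=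
    fun B hB => h.size_mono hc₁0.le hc₁₀ (by norm_num) hB
  have z11 : ∀ B : Finset V, c₀ / 2 * (p ^ 1 * order V) ≤ B.card →
      c₁ * (p ^ 1 * order V) ≤ B.card :=
    fun B hB => h.size_mono hc₁0.le (by linarith) le_rfl hB
  have z12 : ∀ B : Finset V, c₀ / 2 * (p ^ 1 * order V) ≤ B.card →
      c₁ * (p ^ 2 * order V) ≤ B.card :=
    fun B hB => h.size_mono hc₁0.le (by linarith) (by norm_num) hB
  have z22 : ∀ B : Finset V, c₀ / 2 / 2 * (p ^ 2 * order V) ≤ B.card →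
      c₁ * (p ^ 2 * order V) ≤ B.card :=
    fun B hB => h.size_mono hc₁0.le (by linarith) le_rfl hB
  have hUc : ∀ U ∈ 𝒰.toList, c * (p ^ 0 * order V) ≤ U.card := fun U hU' => by
    simpa using hU U (by simpa using hU')
  have zU : ∀ U ∈ 𝒰.toList, c₁ * (p ^ 1 * order V) ≤ U.card := fun U hU' =>
    h.size_mono hc₁0.le (hc₁₀.trans hc₀c) (by norm_num) (hUc U hU')
  have zU1 : ∀ (w : V), (∀ U ∈ 𝒰.toList, p / 2 * U.card ≤ (nb G U w).card) → ∀ B ∈ 𝒰.toList ++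
      𝒰.toList.map (fun X => nb G X w), c₁ * (p ^ 1 * order V) ≤ B.card := fun w hw B hB => by
    rw [List.mem_append, List.mem_map] at hB
    rcases hB with hB | ⟨B, hB, rfl⟩
    · exact zU B hB
    · exact h.size_mono hc₁0.le (by linarith) le_rfl (h.card_nb_ge (hUc B hB) (hw B hB))
  simp only [List.mem_cons, List.mem_append, List.not_mem_nil, or_false, or_imp,
    forall_and, forall_eq] at hLc
  obtain ⟨sF₀, sN₀, sN₁, sF₁, sK, sF₄, sR₁, sR₀, sF₅, sK', sF₂, sN₂, sM, sF₃⟩ := hLc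
  -- the first vertices
  obtain ⟨v, hvT, hv⟩ := htp T [N₀, R₀, F₀, F₅] (by simp)
    (h.size_mono (a := 0) hc₁0.le (hc₁₀.trans hc₀c) (by norm_num) (by simpa using hT)) (by
      simp only [List.mem_cons, List.not_mem_nil, or_false, forall_eq_or_imp, forall_eq]
      exact ⟨z01 _ sN₀, z01 _ sR₀, z01 _ sF₀, z01 _ sF₅⟩)
  simp only [List.mem_cons, List.not_mem_nil, or_false, forall_eq_or_imp, forall_eq] at hv
  obtain ⟨hvN₀, hvR₀, hvF₀, hvF₅⟩ := hv
  have sN₀v := h.card_nb_ge sN₀ hvN₀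
  have sR₀v := h.card_nb_ge sR₀ hvR₀
  have sF₀v := h.card_nb_ge sF₀ hvF₀
  have sF₅v := h.card_nb_ge sF₅ hvF₅
  obtain ⟨l₀, hl₀, hl₀t⟩ := htp (nb G N₀ v) (nb G R₀ v :: nb G F₀ v :: N₁ :: F₁ :: 𝒰.toList)
    (by simp only [List.length_cons]; omega) (z12 _ sN₀v) (by
      simp only [List.mem_cons, forall_eq_or_imp]
      exact ⟨z11 _ sR₀v, z11 _ sF₀v, z01 _ sN₁, z01 _ sF₁, zU⟩)
  simp only [List.mem_cons, forall_eq_or_imp] at hl₀t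
  obtain ⟨tR₀, tF₀, tN₁, tF₁, tU⟩ := hl₀t
  have sR₀vl := h.card_nb_ge sR₀v tR₀
  have sF₀vl := h.card_nb_ge sF₀v tF₀
  have sN₁l := h.card_nb_ge sN₁ tN₁
  have sF₁l := h.card_nb_ge sF₁ tF₁
  obtain ⟨r₀, hr₀, hr₀t⟩ := htp (nb G (nb G R₀ v) l₀) (nb G F₅ v :: R₁ :: F₄ :: K')
    (by simp only [List.length_cons]; omega) (z22 _ sR₀vl) (by
      simp only [List.mem_cons, forall_eq_or_imp]
      exact ⟨z11 _ sF₅v, z01 _ sR₁, z01 _ sF₄, fun B hB => z01 _ (sK' B hB)⟩)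
  simp only [List.mem_cons, forall_eq_or_imp] at hr₀t
  obtain ⟨tF₅, tR₁, tF₄, tK'⟩ := hr₀t
  obtain ⟨f₀, hf₀, hf₀t⟩ := htp (nb G (nb G F₀ v) l₀) (nb G N₁ l₀ :: (𝒰.toList ++
      𝒰.toList.map (fun X => nb G X l₀)))
    (by simp only [List.length_cons, List.length_append, List.length_map]; omega) (z22 _ sF₀vl) (by
      simp only [List.mem_cons, forall_eq_or_imp]
      exact ⟨z11 _ sN₁l, zU1 l₀ tU⟩)
  simp only [List.mem_cons, forall_eq_or_imp] at hf₀t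
  obtain ⟨tN₁l, tUf⟩ := hf₀t
  obtain ⟨l₁, hl₁, hl₁t⟩ := htp (nb G (nb G N₁ l₀) f₀) (nb G F₁ l₀ :: N₂ :: F₂ :: K)
    (by simp only [List.length_cons]; omega) (z22 _ (h.card_nb_ge sN₁l tN₁l)) (by
      simp only [List.mem_cons, forall_eq_or_imp]
      exact ⟨z11 _ sF₁l, z01 _ sN₂, z01 _ sF₂, fun B hB => z01 _ (sK B hB)⟩)
  simp only [List.mem_cons, forall_eq_or_imp] at hl₁t
  obtain ⟨tF₁l, tN₂, tF₂, tK⟩ := hl₁t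
  -- disjointness
  have d1 := List.pairwise_cons.1
    (List.pairwise_cons.1 (List.pairwise_cons.1 (List.pairwise_cons.1 hLd).2).2).2
  have d2 := List.pairwise_cons.1 (List.pairwise_append.1 d1.2).2.1
  have d3 := List.pairwise_cons.1 d2.2
  have d4 := List.pairwise_cons.1 d3.2
  have d5 := List.pairwise_cons.1 d4.2
  have d6 := (List.pairwise_append.1 d5.2).2.1
  simp only [List.pairwise_cons, List.mem_cons, List.not_mem_nil, or_false, forall_eq_or_imp,
    forall_eq] at d6
  have dF₁N₂ : Disjoint F₁ N₂ := d1.1 N₂ (by simp)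
  have dF₄M : Disjoint F₄ M := d2.1 M (by simp)
  have dR₁F₅ : Disjoint R₁ F₅ := d3.1 F₅ (by simp)
  have dR₁M : Disjoint R₁ M := d3.1 M (by simp)
  have dR₁F₃ : Disjoint R₁ F₃ := d3.1 F₃ (by simp)
  have dF₂M : Disjoint F₂ M := d6.1.2.1
  have dN₂M : Disjoint N₂ M := d6.2.1.1
  have dN₂F₃ : Disjoint N₂ F₃ := d6.2.1.2
  have sub2 : ∀ (B : Finset V) (u w : V), nb G (nb G B u) w ⊆ B := fun B u w =>
    (nb_subset _ _).trans (nb_subset _ _)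
  -- the two wings
  have hwl := Hw V G p (h.mono e2) l₁ (nb G (nb G F₁ l₀) l₁) (nb G N₂ l₁) (nb G F₂ l₁) M K K' hK.le
    hK'.le (z22 _ (h.card_nb_ge sF₁l tF₁l)) (z11 _ (h.card_nb_ge sN₂ tN₂))
    (z11 _ (h.card_nb_ge sF₂ tF₂))
    (by simpa using h.size_mono (a := 0) (b := 0) hc₁0.le hc₁₀ le_rfl sM)
    (fun X hX => ⟨by simpa using h.size_mono (a := 0) (b := 0) hc₁0.le hc₁₀ le_rfl (sK X hX),
      z11 _ (h.card_nb_ge (sK X hX) (tK X hX))⟩)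
    (fun X hX => by simpa using h.size_mono (a := 0) (b := 0) hc₁0.le hc₁₀ le_rfl (sK' X hX))
    (disjoint_of_subset_left (sub2 _ _ _) (disjoint_of_subset_right (nb_subset _ _) dF₁N₂))
    (disjoint_of_subset_left (nb_subset _ _) dN₂M) (disjoint_of_subset_left (nb_subset _ _) dF₂M)
  have hwr := Hw V G p (h.mono e2) r₀ (nb G (nb G F₅ v) r₀) (nb G R₁ r₀) (nb G F₄ r₀) M K' K hK'.le
    hK.le (z22 _ (h.card_nb_ge sF₅v tF₅)) (z11 _ (h.card_nb_ge sR₁ tR₁))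
    (z11 _ (h.card_nb_ge sF₄ tF₄))
    (by simpa using h.size_mono (a := 0) (b := 0) hc₁0.le hc₁₀ le_rfl sM)
    (fun X hX => ⟨by simpa using h.size_mono (a := 0) (b := 0) hc₁0.le hc₁₀ le_rfl (sK' X hX),
      z11 _ (h.card_nb_ge (sK' X hX) (tK' X hX))⟩)
    (fun X hX => by simpa using h.size_mono (a := 0) (b := 0) hc₁0.le hc₁₀ le_rfl (sK X hX))
    (disjoint_of_subset_left (sub2 _ _ _) (disjoint_of_subset_right (nb_subset _ _) dR₁F₅.symm))
    (disjoint_of_subset_left (nb_subset _ _) dR₁M) (disjoint_of_subset_left (nb_subset _ _) dF₄M)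
  rw [show (1 - 2 * (1 / 8) : ℝ) = 1 - 1 / 4 by norm_num] at hwl hwr
  have hatM := hAt 0 (by norm_num) M (F₃ :: 𝒰.toList) (by simp only [List.length_cons]; omega) (by
    simp only [List.mem_cons, forall_eq_or_imp]
    exact ⟨z01 _ sF₃, zU⟩) (h.size_mono hc₁0.le hc₁₀ le_rfl sM)
  obtain ⟨m, hmM, hml, hmr, hmt⟩ := exists_mem_of_card (h.nonempty_of_le hc₀0 sM) hwl hwr hatM
  have hmt := not_mem_atyp hmM hmt
  simp only [List.mem_cons, forall_eq_or_imp] at hmt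
  obtain ⟨tF₃, tUm⟩ := hmt
  have sF₃m := h.card_nb_ge sF₃ tF₃
  set Al := (nb G (nb G N₂ l₁) m).filter
    (fun l => Wing G p c₂ l₁ (nb G (nb G F₁ l₀) l₁) (nb G F₂ l₁) K K' m l) with hAl
  set Ar := (nb G (nb G R₁ r₀) m).filter
    (fun l => Wing G p c₂ r₀ (nb G (nb G F₅ v) r₀) (nb G F₄ r₀) K' K m l) with hAr
  have hel := hEm Al (nb G F₃ m) (disjoint_of_subset_left ((filter_subset _ _).trans (sub2 _ _ _))
    (disjoint_of_subset_right (nb_subset _ _) dN₂F₃)) hml (z11 _ sF₃m)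
  have her := hEm Ar (nb G F₃ m) (disjoint_of_subset_left ((filter_subset _ _).trans (sub2 _ _ _))
    (disjoint_of_subset_right (nb_subset _ _) dR₁F₃)) hmr (z11 _ sF₃m)
  have hat3 := hAt 1 (by norm_num) (nb G F₃ m) (𝒰.toList ++ 𝒰.toList.map (fun X => nb G X m))
    (by simp only [List.length_append, List.length_map]; omega) (zU1 m tUm) (z11 _ sF₃m)
  -- The choice of `l₂` and `r₁` is postponed: `Al` and `Ar` have exponent 2, so most vertices of
  -- `nb G F₃ m`, of exponent 1, have a neighbour in each.
  obtain ⟨f₃, hf₃, hf₃l, hf₃r, hf₃t⟩ := exists_mem_of_card (P := fun x => (nb G Al x).Nonempty)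
    (Q := fun x => (nb G Ar x).Nonempty)
    (h.nonempty_of_le (by positivity) sF₃m)
    (card_filter_sdiff_ge hel fun a ha hna => nonempty_iff_ne_empty.2 fun he =>
      hna (mem_filter.2 ⟨ha, he⟩))
    (card_filter_sdiff_ge her fun a ha hna => nonempty_iff_ne_empty.2 fun he =>
      hna (mem_filter.2 ⟨ha, he⟩)) hat3
  have hf₃t := not_mem_atyp hf₃ hf₃t
  obtain ⟨l₂, hl₂⟩ := hf₃l
  obtain ⟨r₁, hr₁⟩ := hf₃r
  rw [mem_nb, mem_filter, mem_nb, mem_nb] at hl₂ hr₁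
  obtain ⟨⟨⟨⟨ml₂, al₁l₂⟩, aml₂⟩, ⟨f₁, hf₁, af₁l₂, ef₁⟩, f₂, hf₂, af₂l₂, af₂m, ef₂⟩, af₃l₂⟩ := hl₂
  obtain ⟨⟨⟨⟨mr₁, ar₀r₁⟩, amr₁⟩, ⟨f₅, hf₅, af₅r₁, ef₅⟩, f₄, hf₄, af₄r₁, af₄m, ef₄⟩, af₃r₁⟩ := hr₁
  rw [mem_nb, mem_nb] at hf₁ hf₅ hr₀ hf₀ hl₁
  rw [mem_nb] at hf₂ hf₄ hl₀ hf₃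
  -- the connections
  have hKd : K.Pairwise Disjoint := (List.pairwise_append.1 d1.2).1
  have hKd' : K'.Pairwise Disjoint := (List.pairwise_append.1 d5.2).1
  obtain ⟨z, hz, hzk, hz1, hz2⟩ := Hc V G p (h.mono e3) K [f₁, l₁] [f₄, r₁] hK hKd rfl rfl
    fun U hU => ⟨ef₁ U hU, ef₄ U hU⟩
  obtain ⟨z', hz', hzk', hz1', hz2'⟩ := Hc V G p (h.mono e3) K' [f₅, r₀] [f₂, l₂] hK' hKd' rfl rfl
    fun U hU => ⟨ef₅ U hU, ef₂ U hU⟩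
  have hzl : z.length = 8 := hz.length_eq.trans hK
  have hzl' : z'.length = 8 := hz'.length_eq.trans hK'
  set l := f₀ :: l₀ :: l₁ :: f₁ :: (z ++ f₄ :: r₁ :: r₀ :: f₅ :: (z' ++ [f₂, l₂, m, f₃])) with hl
  have hmem : List.Forall₂ (· ∈ ·) l (F₀ :: N₀ :: N₁ :: F₁ :: (K ++ F₄ :: R₁ :: R₀ :: F₅ ::
      (K' ++ [F₂, N₂, M, F₃]))) := by
    refine .cons hf₀.1.1 (.cons hl₀.1 (.cons hl₁.1.1 (.cons hf₁.1.1 (List.rel_append hz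
      (.cons hf₄.1 (.cons mr₁ (.cons hr₀.1.1 (.cons hf₅.1.1 (List.rel_append hz'
        (.cons hf₂.1 (.cons ml₂ (.cons hmM (.cons hf₃.1 .nil)))))))))))))
  have hnd : l.Nodup := nodup_of_forall₂_mem hmem hLd
  have hlA : ∀ w ∈ l, w ∈ A := by
    intro w hw
    obtain ⟨i, hi, rfl⟩ := List.mem_iff_getElem.1 hw
    exact (hLA _ (List.getElem_mem (hmem.length_eq ▸ hi))).1 (hmem.get hi (hmem.length_eq ▸ hi))
  have hvl : v ∉ l := fun hvl => disjoint_left.1 hTA hvT (hlA v hvl)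
  refine ⟨v, _, _, _, hvT, Flex.of_gadget hnd hvl hzk (by omega) hzk' (by omega) hz1 hz2 hz1' hz2'
    hl₁.1.2 hr₀.2 hl₀.2.symm hr₀.1.2 ar₀r₁.symm amr₁.symm aml₂.symm al₁l₂.symm hf₀.1.2.symm
    hf₀.2.symm hl₁.2 hf₁.1.2 hf₁.2 af₁l₂.symm hf₂.2.symm af₂l₂ af₂m af₃l₂.symm hf₃.2 af₃r₁.symm
    af₄m af₄r₁ hf₄.2.symm af₅r₁.symm hf₅.2 hf₅.1.2, ?_, ?_, fun U hU' => ?_⟩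
  · exact insert_subset_insert _ fun w hw => hlA w (List.mem_toFinset.1 hw)
  · refine (card_insert_le _ _).trans ?_
    refine Nat.add_le_add_right ((List.toFinset_card_le _).trans (le_of_eq ?_)) 1
    rw [hmem.length_eq, hL]
  · have hUl : U ∈ 𝒰.toList := by simpa using hU'
    have hUm : ∀ w, nb G U w ∈ 𝒰.toList ++ 𝒰.toList.map (fun X => nb G X w) := fun w => by
      rw [List.mem_append, List.mem_map]
      exact Or.inr ⟨U, hUl, rfl⟩
    exact ⟨h.extd_two_of_typical hc.le (hU U hU') (h.card_nb_ge (hUc U hUl) (tU U hUl))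
      (tUf U (by simp [hU'])) (tUf _ (hUm l₀)),
      h.extd_two_of_typical hc.le (hU U hU') (h.card_nb_ge (hUc U hUl) (tUm U hUl))
      (hf₃t U (by simp [hU'])) (hf₃t _ (hUm m))⟩

end

/-! ### Attaching one piece to a chain -/

section

/-- A flexible path whose second end can be extended into the unused parts of the members of
`K`. -/
def Chain {V : Type u} [Fintype V] (G : SimpleGraph V) (k : ℕ) (p c : ℝ) (K : List (Finset V))
    (S R : Finset V) (x y : List V) : Prop :=
  Flex G k S R x y ∧ ∀ U ∈ K, Extd G k p c y (U \ S)

/-- `v` belongs to a member of `K`. -/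
def InSome {V : Type u} (K : List (Finset V)) (v : V) : Prop := ∃ U ∈ K, v ∈ U

/-- Attachments are iterated linearly often, so the constant must not decay. The new piece is
extendable with `2c`, and the at most `D + L ≤ (c/2)p^k n` new vertices leave at least `c` for the
new end. Hence later statements fix a threshold `c'` and hold for every `c ≤ c'`. -/
theorem exists_attach {k τ L : ℕ} (hconn : HasConnections.{u} k τ L) (hkL : k ≤ L) (D : ℕ) {c : ℝ}
    (hc : 0 < c) :
    ∃ γ : ℝ, 0 < γ ∧ ∀ (V : Type u) [Fintype V] (G : SimpleGraph V) (p : ℝ), Psr G k τ p γ →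
      ∀ (K : List (Finset V)) (S R S' R' : Finset V) (x y x' y' : List V), K.length = L →
        K.Pairwise Disjoint → Chain G k p c K S R x y → Flex G k S' R' x' y' → Disjoint S S' →
        S'.card ≤ D → (∀ U ∈ K, Extd G k p (2 * c) x' (U \ S) ∧ Extd G k p (2 * c) y' (U \ S)) →
        ∃ W, Chain G k p c K (S ∪ W) (R ∪ R') x y' ∧ S' ⊆ W ∧ Disjoint S W ∧
          (∀ w ∈ W, w ∈ S' ∨ InSome K w) ∧ (W \ S').card ≤ L := by
  obtain ⟨γ₁, hγ₁, H⟩ := hconn (c / 2) (by positivity)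
  refine ⟨min γ₁ (c / 2 / (D + L + 1)), by positivity, ?_⟩
  intro V _ G p h K S R S' R' x y x' y' hK hKd hch hfl hd hD hext
  have hp := h.p_pos
  have hbig : ((D + L : ℕ) : ℝ) ≤ c / 2 * (p ^ k * order V) := by
    have := h.le_pow_order (D := (D + L + 1) / (c / 2)) (m := k) (by
      calc _ ≤ c / 2 / (D + L + 1) * ((D + L + 1) / (c / 2)) := by
            gcongr
            exact min_le_right _ _
        _ = 1 := by field_simp) le_rfl
    rw [div_le_iff₀ (by positivity)] at this
    push_cast
    linarith
  have hcard : ∀ X : Finset V, X.card ≤ D + L → ∀ (a : ℝ) (U : Finset V) (l : List V), 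
      Extd G k p a l U → Extd G k p (a - c / 2) l (U \ X) := by
    intro X hX a U l he
    refine he.sdiff hp.le h.p_le (le_trans ?_ hbig) (by positivity)
    exact_mod_cast (card_le_card inter_subset_left).trans hX
  obtain ⟨z, hz, hzk, hz1, hz2⟩ := H V G p (h.mono (min_le_left _ _))
    (K.map (fun U => (U \ S) \ S')) y x' (by simpa using hK) (by
      rw [List.pairwise_map]
      exact hKd.imp fun hUU => disjoint_of_subset_left (sdiff_subset.trans sdiff_subset)
        (disjoint_of_subset_right (sdiff_subset.trans sdiff_subset) hUU)) hch.1.2.2.1 hfl.2.1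
    (by
      intro U' hU'
      obtain ⟨U, hU, rfl⟩ := List.mem_map.1 hU'
      have h1 := hcard S' (by omega) _ _ _ (hch.2 U hU)
      have h2 := hcard S' (by omega) _ _ _ (hext U hU).1
      exact ⟨h1.mono hp.le (by linarith) subset_rfl, h2.mono hp.le (by linarith) subset_rfl⟩)
  have hzl : z.length = L := by rw [hz.length_eq, List.length_map, hK]
  have hzmem : ∀ w ∈ z, InSome K w ∧ w ∉ S ∧ w ∉ S' := by
    intro w hw
    obtain ⟨i, hi, rfl⟩ := List.mem_iff_getElem.1 hw
    have h1 := hz.get (i := i) hi (hz.length_eq ▸ hi)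
    simp only [List.get_eq_getElem, List.getElem_map, mem_sdiff] at h1
    exact ⟨⟨_, List.getElem_mem _, h1.1.1⟩, h1.1.2, h1.2⟩
  have hznd : z.Nodup := nodup_of_forall₂_mem hz (by
    rw [List.pairwise_map]
    exact hKd.imp fun hUU => disjoint_of_subset_left (sdiff_subset.trans sdiff_subset)
      (disjoint_of_subset_right (sdiff_subset.trans sdiff_subset) hUU))
  have hj := hch.1.join hfl hznd hzk (by omega) hz1 hz2 hd
    (disjoint_right.2 fun w hw => (hzmem w (List.mem_toFinset.1 hw)).2.1)
    (disjoint_right.2 fun w hw => (hzmem w (List.mem_toFinset.1 hw)).2.2)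
  have hzc : z.toFinset.card ≤ L := hzl ▸ List.toFinset_card_le z
  refine ⟨S' ∪ z.toFinset, ⟨by rwa [← union_assoc], fun U hU => ?_⟩, subset_union_left, ?_, ?_, ?_⟩
  · have h1 := hcard (S' ∪ z.toFinset) ((card_union_le _ _).trans (by omega)) _ _ _ (hext U hU).2
    rw [sdiff_sdiff_left] at h1
    exact h1.mono hp.le (by linarith) subset_rfl
  · exact disjoint_union_right.2 ⟨hd, disjoint_right.2 fun w hw =>
      (hzmem w (List.mem_toFinset.1 hw)).2.1⟩
  · intro w hw
    rcases mem_union.1 hw with hw | hw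
    · exact Or.inl hw
    · exact Or.inr (hzmem w (List.mem_toFinset.1 hw)).1
  · refine (card_le_card ?_).trans hzc
    intro w hw
    obtain ⟨h1, h2⟩ := mem_sdiff.1 hw
    exact (mem_union.1 h1).resolve_left h2

/-- The family of the unused parts of the members of a list, together with further sets. -/
noncomputable def unused {V : Type u} (K Es : List (Finset V)) (S : Finset V) :
    Finset (Finset V) :=
  (K.map (fun U => U \ S) ++ Es).toFinset

theorem card_unused_le {V : Type u} {K Es : List (Finset V)} {S : Finset V} {L M : ℕ}
    (hK : K.length = L) (hE : Es.length ≤ M) : (unused K Es S).card ≤ L + M := by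
  refine (List.toFinset_card_le _).trans ?_
  simp only [List.length_append, List.length_map]
  omega

theorem mem_unused {V : Type u} {K Es : List (Finset V)} {S U : Finset V} :
    U ∈ unused K Es S ↔ (∃ X ∈ K, X \ S = U) ∨ U ∈ Es := by
  simp [unused]

theorem forall_mem_unused {V : Type u} {K Es : List (Finset V)} {S : Finset V}
    {P : Finset V → Prop} : (∀ U ∈ unused K Es S, P U) ↔
      (∀ U ∈ K, P (U \ S)) ∧ ∀ U ∈ Es, P U := by
  simp only [mem_unused, or_imp, forall_and, forall_exists_index, and_imp,
    forall_apply_eq_imp_iff₂]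

/-- This serves to swallow `N` vertices of `A` at a time, and also, through the extra sets `Es`, to
redirect the end of a chain towards new sets. -/
theorem exists_attach_chunk {k τ L : ℕ} (hconn : HasConnections.{u} k τ L) (hk : 2 ≤ k)
    (hτ : 2 * k ≤ τ + 1) (hkL : k ≤ L) (N M : ℕ) (hN : k ≤ N) {c₁ : ℝ} (hc₁ : 0 < c₁) :
    ∃ c' : ℝ, 0 < c' ∧ ∀ c : ℝ, 0 < c → c ≤ c' → ∃ γ : ℝ, 0 < γ ∧
      ∀ (V : Type u) [Fintype V] (G : SimpleGraph V) (p : ℝ), Psr G k τ p γ →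
      ∀ (K Es : List (Finset V)) (S R A : Finset V) (x y : List V), K.length = L →
        K.Pairwise Disjoint → Es.length ≤ M → Chain G k p c K S R x y →
        c₁ * order V ≤ (A \ S).card → (∀ U ∈ K, c₁ * order V ≤ (U \ S).card) →
        (∀ U ∈ Es, c₁ * order V ≤ U.card) →
        ∃ (W S' : Finset V) (y' : List V), Chain G k p c K (S ∪ W) R x y' ∧
          (∀ U ∈ Es, Extd G k p c y' U) ∧ Disjoint S W ∧ S' ⊆ W ∧ S' ⊆ A ∧ S'.card = N ∧
          (∀ w ∈ W, w ∈ S' ∨ InSome K w) ∧ (W \ S').card ≤ L := by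
  obtain ⟨c₂, γ₁, hc₂, hγ₁, H₁⟩ := exists_path_piece.{u} k τ N (L + M) 0 hc₁ (by omega)
    (by omega) (by omega) (by omega)
  refine ⟨c₂ / 2, by positivity, fun c hc hcc => ?_⟩
  obtain ⟨γ₂, hγ₂, H₂⟩ := exists_attach hconn hkL N hc
  refine ⟨min γ₁ γ₂, by positivity, ?_⟩
  intro V _ G p h K Es S R A x y hK hKd hEs hch hA hKc hEc
  have hp := h.p_pos
  obtain ⟨l, hl, hnd, hkp, hlA, hext⟩ := H₁ V G p (h.mono (min_le_left _ _)) (A \ S)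
    (unused K Es S) (card_unused_le hK hEs) (by simpa using hA) (forall_mem_unused.2 ⟨hKc, hEc⟩)
  rw [forall_mem_unused] at hext
  have hlS : l.toFinset ⊆ A \ S := fun w hw => hlA w (List.mem_toFinset.1 hw)
  have hcard : l.toFinset.card = N := by rw [List.toFinset_card_of_nodup hnd, hl]
  obtain ⟨W, h1, h2, h3, h4, h5⟩ := H₂ V G p (h.mono (min_le_right _ _)) K S R _ _ x y _ _ hK hKd
    hch (Flex.of_list hnd hkp (by omega))
    (disjoint_right.2 fun w hw => (mem_sdiff.1 (hlS hw)).2) hcard.le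
    (fun U hU => by
      rw [Extd_take, Extd_take]
      exact ⟨(hext.1 U hU).1.mono hp.le (by linarith) subset_rfl,
        (hext.1 U hU).2.mono hp.le (by linarith) subset_rfl⟩)
  rw [union_empty] at h1
  exact ⟨W, _, _, h1, fun U hU => by
    rw [Extd_take]
    exact (hext.2 U hU).2.mono hp.le (by linarith) subset_rfl, h3, h2,
    hlS.trans sdiff_subset, hcard, h4, h5⟩

theorem exists_attach_cover {k τ L : ℕ} (hconn : HasConnections.{u} k τ L) (hk : 2 ≤ k)
    (hτ : 2 * k ≤ τ + 1) (hkL : k ≤ L) {c₁ : ℝ} (hc₁ : 0 < c₁) :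
    ∃ c' : ℝ, 0 < c' ∧ ∀ c : ℝ, 0 < c → c ≤ c' → ∃ γ : ℝ, 0 < γ ∧
      ∀ (V : Type u) [Fintype V] (G : SimpleGraph V) (p : ℝ), Psr G k τ p γ →
      ∀ (K : List (Finset V)) (S R A : Finset V) (x y : List V) (u : V), K.length = L →
        K.Pairwise Disjoint → Chain G k p c K S R x y → u ∉ S →
        c₁ * (p * order V) ≤ (nb G (A \ S) u).card → (∀ U ∈ K, c₁ * order V ≤ (U \ S).card) →
        ∃ (W : Finset V) (y' : List V), Chain G k p c K (S ∪ W) R x y' ∧ u ∈ W ∧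
          (∀ w ∈ W, w = u ∨ w ∈ A ∨ InSome K w) ∧ W.card ≤ 2 * k + 1 + L := by
  obtain ⟨c₂, γ₁, hc₂, hγ₁, H₁⟩ := exists_cover_piece.{u} k τ L hc₁ hk hτ
  refine ⟨c₂ / 2, by positivity, fun c hc hcc => ?_⟩
  obtain ⟨γ₂, hγ₂, H₂⟩ := exists_attach hconn hkL (2 * k + 1) hc
  refine ⟨min γ₁ γ₂, by positivity, ?_⟩
  intro V _ G p h K S R A x y u hK hKd hch hu hA hKc
  have hp := h.p_pos
  obtain ⟨l, hl, hnd, hkp, hul, hlA, hext⟩ := H₁ V G p (h.mono (min_le_left _ _)) u (A \ S)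
    (unused K [] S) (card_unused_le hK le_rfl) hA (forall_mem_unused.2 ⟨hKc, by simp⟩)
  rw [forall_mem_unused] at hext
  have hcard : l.toFinset.card = 2 * k + 1 := by rw [List.toFinset_card_of_nodup hnd, hl]
  obtain ⟨W, h1, h2, h3, h4, h5⟩ := H₂ V G p (h.mono (min_le_right _ _)) K S R _ _ x y _ _ hK hKd
    hch (Flex.of_list hnd hkp (by omega))
    (disjoint_right.2 fun w hw => by
      rcases hlA w (List.mem_toFinset.1 hw) with rfl | hw
      · exact hu
      · exact (mem_sdiff.1 hw).2) hcard.le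
    (fun U hU => by
      rw [Extd_take, Extd_take]
      exact ⟨(hext.1 U hU).1.mono hp.le (by linarith) subset_rfl,
        (hext.1 U hU).2.mono hp.le (by linarith) subset_rfl⟩)
  rw [union_empty] at h1
  refine ⟨W, _, h1, h2 (List.mem_toFinset.2 hul), fun w hw => ?_, ?_⟩
  · rcases h4 w hw with hw | hw
    · rcases hlA w (List.mem_toFinset.1 hw) with rfl | hw
      · exact Or.inl rfl
      · exact Or.inr (Or.inl (mem_sdiff.1 hw).1)
    · exact Or.inr (Or.inr hw)
  · have := card_sdiff_add_card_eq_card h2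
    omega

theorem exists_attach_gadget {k τ L : ℕ} (hconn : HasConnections.{u} k τ L)
    (hgad : HasGadgets.{u} k τ) (hkL : k ≤ L) {c₁ : ℝ} (hc₁ : 0 < c₁) :
    ∃ (c' : ℝ) (D : ℕ), 0 < c' ∧ ∀ c : ℝ, 0 < c → c ≤ c' → ∃ γ : ℝ, 0 < γ ∧
      ∀ (V : Type u) [Fintype V] (G : SimpleGraph V) (p : ℝ), Psr G k τ p γ →
      ∀ (K : List (Finset V)) (S R T A : Finset V) (x y : List V), K.length = L →
        K.Pairwise Disjoint → Chain G k p c K S R x y → Disjoint T A →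
        c₁ * order V ≤ (T \ S).card → c₁ * order V ≤ (A \ S).card →
        (∀ U ∈ K, c₁ * order V ≤ (U \ S).card) →
        ∃ (W : Finset V) (v : V) (y' : List V), Chain G k p c K (S ∪ W) (insert v R) x y' ∧
          v ∈ T ∧ v ∉ S ∧ (∀ w ∈ W, w = v ∨ w ∈ A ∨ InSome K w) ∧ W.card ≤ D + L := by
  obtain ⟨c₂, γ₁, D, hc₂, hγ₁, H₁⟩ := hgad c₁ L hc₁
  refine ⟨c₂ / 2, D, by positivity, fun c hc hcc => ?_⟩
  obtain ⟨γ₂, hγ₂, H₂⟩ := exists_attach hconn hkL D hc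
  refine ⟨min γ₁ γ₂, by positivity, ?_⟩
  intro V _ G p h K S R T A x y hK hKd hch hTA hT hA hKc
  have hp := h.p_pos
  obtain ⟨v, S', x', y', hv, hfl, hS', hcard, hext⟩ := H₁ V G p (h.mono (min_le_left _ _)) (T \ S)
    (A \ S) (unused K [] S) (disjoint_of_subset_left sdiff_subset (disjoint_of_subset_right
      sdiff_subset hTA)) hT hA (card_unused_le hK le_rfl) (forall_mem_unused.2 ⟨hKc, by simp⟩)
  rw [forall_mem_unused] at hext
  obtain ⟨hvT, hvS⟩ := mem_sdiff.1 hv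
  obtain ⟨W, h1, h2, h3, h4, h5⟩ := H₂ V G p (h.mono (min_le_right _ _)) K S R _ _ x y _ _ hK hKd
    hch hfl
    (disjoint_right.2 fun w hw => by
      rcases mem_insert.1 (hS' hw) with rfl | hw
      · exact hvS
      · exact (mem_sdiff.1 hw).2) hcard
    (fun U hU => ⟨(hext.1 U hU).1.mono hp.le (by linarith) subset_rfl,
        (hext.1 U hU).2.mono hp.le (by linarith) subset_rfl⟩)
  rw [union_comm R, ← insert_eq] at h1
  refine ⟨W, v, _, h1, hvT, hvS, fun w hw => ?_, ?_⟩
  · rcases h4 w hw with hw | hw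
    · rcases mem_insert.1 (hS' hw) with rfl | hw
      · exact Or.inl rfl
      · exact Or.inr (Or.inl (mem_sdiff.1 hw).1)
    · exact Or.inr (Or.inr hw)
  · have := card_sdiff_add_card_eq_card h2
    omega

end

/-! ### Iterated attachment -/

section

theorem card_sdiff_union_ge {V : Type u} (U S W : Finset V) :
    ((U \ S).card : ℝ) - W.card ≤ (U \ (S ∪ W)).card := by
  have h1 : U \ S ⊆ (U \ (S ∪ W)) ∪ W := fun v hv => by
    simp only [mem_union, mem_sdiff] at hv ⊢
    tauto
  have h2 : ((U \ S).card : ℝ) ≤ (U \ (S ∪ W)).card + W.card := by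
    exact_mod_cast (card_le_card h1).trans (card_union_le _ _)
  linarith

theorem card_sdiff_le_add {V : Type u} {S W S₂ : Finset V} :
    ((S₂ \ S).card : ℝ) ≤ (S₂ \ (S ∪ W)).card + W.card := by
  have h1 : S₂ \ S ⊆ (S₂ \ (S ∪ W)) ∪ W := fun v hv => by
    simp only [mem_union, mem_sdiff] at hv ⊢
    tauto
  exact_mod_cast (card_le_card h1).trans (card_union_le _ _)

/-- A chain can be prolonged to cover all vertices of `Z` with many unused neighbours in `A`. -/
theorem exists_cover_greedy {k τ L : ℕ} (hconn : HasConnections.{u} k τ L) (hk : 2 ≤ k)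
    (hτ : 2 * k ≤ τ + 1) (hkL : k ≤ L) {c₁ : ℝ} (hc₁ : 0 < c₁) :
    ∃ c' : ℝ, 0 < c' ∧ ∀ c : ℝ, 0 < c → c ≤ c' → ∃ γ : ℝ, 0 < γ ∧
      ∀ (V : Type u) [Fintype V] (G : SimpleGraph V) (p : ℝ), Psr G k τ p γ →
      ∀ (K : List (Finset V)) (S R A Z : Finset V) (x y : List V) (m : ℕ), K.length = L →
        K.Pairwise Disjoint → Chain G k p c K S R x y → (Z \ S).card ≤ m →
        (∀ U ∈ K, c₁ * order V + m * (2 * k + 1 + L) ≤ (U \ S).card) →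
        ∃ (S₂ : Finset V) (y' : List V), Chain G k p c K S₂ R x y' ∧ S ⊆ S₂ ∧
          (∀ w ∈ S₂, w ∈ S ∨ w ∈ Z ∨ w ∈ A ∨ InSome K w) ∧
          ((S₂ \ S).card : ℝ) ≤ m * (2 * k + 1 + L) ∧
          ∀ u ∈ Z, u ∉ S₂ → ((nb G (A \ S₂) u).card : ℝ) < c₁ * (p * order V) := by
  obtain ⟨c', hc', H'⟩ := exists_attach_cover hconn hk hτ hkL hc₁
  refine ⟨c', hc', fun c hc hcc => ?_⟩
  obtain ⟨γ, hγ, H⟩ := H' c hc hcc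
  refine ⟨γ, hγ, ?_⟩
  intro V _ G p h K S R A Z x y m hK hKd hch hm hKc
  induction m generalizing S y with
  | zero =>
    refine ⟨S, y, hch, subset_rfl, fun w hw => Or.inl hw, by simp, fun u hu huS => ?_⟩
    have : u ∈ Z \ S := mem_sdiff.2 ⟨hu, huS⟩
    have := card_pos.2 ⟨u, this⟩
    omega
  | succ m ih =>
    push_cast at hKc ⊢
    have hL0 : (0:ℝ) ≤ 2 * k + 1 + L := by positivity
    by_cases hex : ∃ u ∈ Z, u ∉ S ∧ c₁ * (p * order V) ≤ (nb G (A \ S) u).card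
    · obtain ⟨u, huZ, huS, hu⟩ := hex
      obtain ⟨W, y', h1, h2, h3, h4⟩ := H V G p h K S R A x y u hK hKd hch huS hu
        (fun U hU => le_trans (by have := hKc U hU; nlinarith [(Nat.cast_nonneg m : (0:ℝ) ≤ m)])
          le_rfl)
      have h4' : (W.card : ℝ) ≤ 2 * k + 1 + L := by exact_mod_cast h4
      obtain ⟨S₂, y₂, g1, g2, g3, g4, g5⟩ := ih (S ∪ W) y' h1 (by
        have hsub : Z \ (S ∪ W) ⊂ Z \ S := by
          refine ssubset_iff_of_subset (sdiff_subset_sdiff subset_rfl subset_union_left) |>.2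
            ⟨u, mem_sdiff.2 ⟨huZ, huS⟩, fun hu' => ?_⟩
          exact (mem_sdiff.1 hu').2 (mem_union_right _ h2)
        have := card_lt_card hsub
        omega) (fun U hU => by
          have := hKc U hU
          have := card_sdiff_union_ge U S W
          linarith)
      refine ⟨S₂, y₂, g1, subset_union_left.trans g2, fun w hw => ?_, ?_, g5⟩
      · rcases g3 w hw with hw | hw
        · rcases mem_union.1 hw with hw | hw
          · exact Or.inl hw
          · rcases h3 w hw with rfl | hw
            · exact Or.inr (Or.inl huZ)
            · exact Or.inr (Or.inr hw)
        · exact Or.inr hw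
      · have := card_sdiff_le_add (S := S) (W := W) (S₂ := S₂)
        linarith
    · push Not at hex
      exact ⟨S, y, hch, subset_rfl, fun w hw => Or.inl hw, by simp; positivity, hex⟩

/-- A chain can be prolonged by many absorbing gadgets. -/
theorem exists_gadget_chain {k τ L : ℕ} (hconn : HasConnections.{u} k τ L)
    (hgad : HasGadgets.{u} k τ) (hkL : k ≤ L) {c₁ : ℝ} (hc₁ : 0 < c₁) :
    ∃ (c' : ℝ) (D : ℕ), 0 < c' ∧ ∀ c : ℝ, 0 < c → c ≤ c' → ∃ γ : ℝ, 0 < γ ∧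
      ∀ (V : Type u) [Fintype V] (G : SimpleGraph V) (p : ℝ), Psr G k τ p γ →
      ∀ (K : List (Finset V)) (S R T A : Finset V) (x y : List V) (m : ℕ), K.length = L →
        K.Pairwise Disjoint → Chain G k p c K S R x y → Disjoint T A →
        c₁ * order V + m * (D + L) ≤ (T \ S).card → c₁ * order V + m * (D + L) ≤ (A \ S).card →
        (∀ U ∈ K, c₁ * order V + m * (D + L) ≤ (U \ S).card) →
        ∃ (S₂ R₂ : Finset V) (y' : List V), Chain G k p c K S₂ R₂ x y' ∧ S ⊆ S₂ ∧
          (∀ w ∈ S₂, w ∈ S ∨ w ∈ T ∨ w ∈ A ∨ InSome K w) ∧ ((S₂ \ S).card : ℝ) ≤ m * (D + L) ∧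
          (∀ w ∈ R₂, w ∈ R ∨ w ∈ T) ∧ R₂.card = R.card + m := by
  obtain ⟨c', D, hc', H'⟩ := exists_attach_gadget hconn hgad hkL hc₁
  refine ⟨c', D, hc', fun c hc hcc => ?_⟩
  obtain ⟨γ, hγ, H⟩ := H' c hc hcc
  refine ⟨γ, hγ, ?_⟩
  intro V _ G p h K S R T A x y m hK hKd hch hTA hT hA hKc
  induction m generalizing S R y with
  | zero =>
    exact ⟨S, R, y, hch, subset_rfl, fun w hw => Or.inl hw, by simp, fun w hw => Or.inl hw, rfl⟩
  | succ m ih =>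
    push_cast at hKc hT hA ⊢
    have hDL : (0:ℝ) ≤ D + L := by positivity
    have hmDL : (0:ℝ) ≤ m * (D + L) := by positivity
    obtain ⟨W, v, y', h1, h2, h3, h4, h5⟩ := H V G p h K S R T A x y hK hKd hch hTA (by linarith)
      (by linarith) (fun U hU => by linarith [hKc U hU])
    have h5' : (W.card : ℝ) ≤ D + L := by exact_mod_cast h5
    obtain ⟨S₂, R₂, y₂, g1, g2, g3, g4, g5, g6⟩ := ih (S ∪ W) (insert v R) y' h1
      (by have := card_sdiff_union_ge T S W; linarith)
      (by have := card_sdiff_union_ge A S W; linarith)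
      (fun U hU => by
        have := hKc U hU
        have := card_sdiff_union_ge U S W
        linarith)
    refine ⟨S₂, R₂, y₂, g1, subset_union_left.trans g2, fun w hw => ?_, ?_, fun w hw => ?_, ?_⟩
    · rcases g3 w hw with hw | hw
      · rcases mem_union.1 hw with hw | hw
        · exact Or.inl hw
        · rcases h4 w hw with rfl | hw
          · exact Or.inr (Or.inl h2)
          · exact Or.inr (Or.inr hw)
      · exact Or.inr hw
    · have := card_sdiff_le_add (S := S) (W := W) (S₂ := S₂)
      linarith
    · rcases g5 w hw with hw | hw
      · rcases mem_insert.1 hw with rfl | hw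
        · exact Or.inr h2
        · exact Or.inl hw
      · exact Or.inr hw
    · rw [g6, card_insert_of_notMem fun hv => h3 (hch.1.1 hv)]
      omega

/-- A chain can be prolonged to cover nearly all of `A`. -/
theorem exists_chunk_chain {k τ L : ℕ} (hconn : HasConnections.{u} k τ L) (hk : 2 ≤ k)
    (hτ : 2 * k ≤ τ + 1) (hkL : k ≤ L) (N M : ℕ) (hN : k ≤ N) {c₁ : ℝ} (hc₁ : 0 < c₁) :
    ∃ c' : ℝ, 0 < c' ∧ ∀ c : ℝ, 0 < c → c ≤ c' → ∃ γ : ℝ, 0 < γ ∧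
      ∀ (V : Type u) [Fintype V] (G : SimpleGraph V) (p : ℝ), Psr G k τ p γ →
      ∀ (K Es : List (Finset V)) (S R A : Finset V) (x y : List V) (m : ℕ), K.length = L →
        K.Pairwise Disjoint → Es.length ≤ M → Chain G k p c K S R x y →
        (∀ w ∈ A, ¬ InSome K w) → (A \ S).card ≤ m * N →
        (∀ U ∈ K, c₁ * order V + m * L ≤ (U \ S).card) →
        (∀ U ∈ Es, c₁ * order V ≤ U.card) → (∀ U ∈ Es, Extd G k p c y U) →
        ∃ (S₂ : Finset V) (y' : List V), Chain G k p c K S₂ R x y' ∧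
          (∀ U ∈ Es, Extd G k p c y' U) ∧ S ⊆ S₂ ∧ (∀ w ∈ S₂, w ∈ S ∨ w ∈ A ∨ InSome K w) ∧
          ((A \ S₂).card : ℝ) < c₁ * order V := by
  obtain ⟨c', hc', H'⟩ := exists_attach_chunk hconn hk hτ hkL N M hN hc₁
  refine ⟨c', hc', fun c hc hcc => ?_⟩
  obtain ⟨γ, hγ, H⟩ := H' c hc hcc
  refine ⟨γ, hγ, ?_⟩
  intro V _ G p h K Es S R A x y m hK hKd hEs hch hAK hm hKc hEc hext
  have hn := h.order_pos
  induction m generalizing S y with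
  | zero =>
    refine ⟨S, y, hch, hext, subset_rfl, fun w hw => Or.inl hw, ?_⟩
    have : (A \ S).card = 0 := by omega
    rw [this]
    push_cast
    positivity
  | succ m ih =>
    push_cast at hKc
    have hmL : (0:ℝ) ≤ m * L := by positivity
    have hL : (0:ℝ) ≤ L := by positivity
    by_cases hlt : ((A \ S).card : ℝ) < c₁ * order V
    · exact ⟨S, y, hch, hext, subset_rfl, fun w hw => Or.inl hw, hlt⟩
    obtain ⟨W, S', y', h1, h2, h3, h4, h5, h6, h7, h8⟩ := H V G p h K Es S R A x y hK hKd hEs hch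
      (not_lt.1 hlt) (fun U hU => by linarith [hKc U hU]) hEc
    obtain ⟨S₂, y₂, g1, g2, g3, g4, g5⟩ := ih (S ∪ W) y' h1 (by
      have hsub : A \ (S ∪ W) ⊆ (A \ S) \ S' := fun w hw => by
        simp only [mem_sdiff, mem_union, not_or] at hw ⊢
        exact ⟨⟨hw.1, hw.2.1⟩, fun hw' => hw.2.2 (h4 hw')⟩
      have hS' : S' ⊆ A \ S := fun w hw => mem_sdiff.2 ⟨h5 hw, disjoint_right.1 h3 (h4 hw)⟩
      have h9 := card_le_card hsub
      rw [card_sdiff_of_subset hS', h6] at h9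
      rw [Nat.succ_mul] at hm
      omega) (fun U hU => by
        have h9 := hKc U hU
        have h10 := card_sdiff_union_ge U S (W \ S')
        -- `A` avoids the connecting sets, so the chunk itself takes nothing from them: each chunk
        -- of `N` vertices uses up at most `L` connecting vertices.
        have h11 : U \ (S ∪ W \ S') ⊆ U \ (S ∪ W) := fun w hw => by
          simp only [mem_sdiff, mem_union, not_or, not_and, not_not] at hw ⊢
          refine ⟨hw.1, hw.2.1, fun hwW => hAK w (h5 (hw.2.2 hwW)) ⟨U, hU, hw.1⟩⟩
        have h12 : ((U \ (S ∪ W \ S')).card : ℝ) ≤ (U \ (S ∪ W)).card := by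
          exact_mod_cast card_le_card h11
        have h13 : ((W \ S').card : ℝ) ≤ L := by exact_mod_cast h8
        linarith) h2
    refine ⟨S₂, y₂, g1, g2, subset_union_left.trans g3, fun w hw => ?_, g5⟩
    rcases g4 w hw with hw | hw
    · rcases mem_union.1 hw with hw | hw
      · exact Or.inl hw
      · rcases h7 w hw with hw | hw
        · exact Or.inr (Or.inl (h5 hw))
        · exact Or.inr (Or.inr hw)
    · exact Or.inr hw

end

/-! ### Closing two paths to a cycle -/

section

theorem Psr.nat_le {V : Type u} {G : SimpleGraph V} [Fintype V] {k τ : ℕ} {p γ : ℝ}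
    (h : Psr G k τ p γ) {N : ℕ} {a : ℝ} (ha : 0 < a) (hγ : γ ≤ a / (N + 1)) {m : ℕ} (hm : m ≤ k) :
    (N : ℝ) ≤ a * (p ^ m * order V) := by
  have h1 := h.le_pow_order (D := N / a) (m := m) (by
    rw [le_div_iff₀ (by positivity)] at hγ
    rw [mul_div_assoc', div_le_one ha]
    have := h.gamma_pos
    nlinarith) hm
  rwa [div_le_iff₀' ha] at h1

/-- Two flexible paths covering all vertices are closed to a power of a Hamilton cycle. -/
theorem exists_close {k τ L : ℕ} (hconn : HasConnections.{u} k τ L) (hkL : k ≤ L) {c : ℝ}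
    (hc : 0 < c) :
    ∃ γ : ℝ, 0 < γ ∧ ∀ (V : Type u) [Fintype V] (G : SimpleGraph V) (p : ℝ), Psr G k τ p γ →
      ∀ (E : List (Finset V)) (S R S₂ : Finset V) (x y x₂ y₂ : List V), E.length = L →
        E.Pairwise Disjoint → Flex G k S R x y → Flex G k S₂ ∅ x₂ y₂ →
        (∀ U ∈ E, U ⊆ R ∧ Disjoint U S₂) → (∀ w, w ∈ S ∨ w ∈ S₂) → (∀ w ∈ S₂, w ∈ S → w ∈ R) →
        (∀ U ∈ E, Extd G k p c x U ∧ Extd G k p c y U ∧ Extd G k p c x₂ U ∧ Extd G k p c y₂ U) →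
        3 ≤ Fintype.card V → ContainsHamiltonCyclePower G k := by
  obtain ⟨γ₁, hγ₁, H₁⟩ := hconn (c / 2) (by positivity)
  refine ⟨min γ₁ (c / 2 / (L + 1)), by positivity, ?_⟩
  intro V _ G p h E S R S₂ x y x₂ y₂ hE hEd hf hf₂ hER hcov hS₂ hext hV
  have hp := h.p_pos
  have h1 := h.mono (min_le_left _ _)
  obtain ⟨z, hz, hzk, hz1, hz2⟩ := H₁ V G p h1 E y x₂ hE hEd hf.2.2.1 hf₂.2.1 fun U hU =>
    ⟨(hext U hU).2.1.mono hp.le (by linarith) subset_rfl,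
      (hext U hU).2.2.1.mono hp.le (by linarith) subset_rfl⟩
  have hzl : z.length = L := hz.length_eq.trans hE
  have hznd := nodup_of_forall₂_mem hz hEd
  have hsd : ∀ U : Finset V, ∀ l : List V, Extd G k p c l U →
      Extd G k p (c / 2) l (U \ z.toFinset) := by
    intro U l he
    have := he.sdiff (S := z.toFinset) hp.le h.p_le (d := c / 2) (le_trans (by
      exact_mod_cast (card_le_card inter_subset_left).trans (hzl ▸ List.toFinset_card_le z))
      (h.nat_le (N := L) (by positivity) (min_le_right _ _) le_rfl)) (by positivity)
    exact this.mono hp.le (by linarith) subset_rfl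
  obtain ⟨w, hw, hwk, hw1, hw2⟩ := H₁ V G p h1 (E.map (fun U => U \ z.toFinset)) y₂ x
    (by simpa using hE) (by
      rw [List.pairwise_map]
      exact hEd.imp fun hUU => disjoint_of_subset_left sdiff_subset
        (disjoint_of_subset_right sdiff_subset hUU)) hf₂.2.2.1 hf.2.1 (fun U' hU' => by
      obtain ⟨U, hU, rfl⟩ := List.mem_map.1 hU'
      exact ⟨hsd U _ (hext U hU).2.2.2, hsd U _ (hext U hU).1⟩)
  have hwl : w.length = L := by rw [hw.length_eq, List.length_map, hE]
  have hwnd := nodup_of_forall₂_mem hw (by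
      rw [List.pairwise_map]
      exact hEd.imp fun hUU => disjoint_of_subset_left sdiff_subset
        (disjoint_of_subset_right sdiff_subset hUU))
  have hzmem : ∀ v ∈ z, v ∈ R ∧ v ∉ S₂ := by
    intro v hv
    obtain ⟨i, hi, rfl⟩ := List.mem_iff_getElem.1 hv
    have h1 := hz.get (i := i) hi (hz.length_eq ▸ hi)
    obtain ⟨h2, h3⟩ := hER _ (List.getElem_mem (hz.length_eq ▸ hi))
    exact ⟨h2 h1, disjoint_left.1 h3 h1⟩
  have hwmem : ∀ v ∈ w, v ∈ R ∧ v ∉ S₂ ∧ v ∉ z := by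
    intro v hv
    obtain ⟨i, hi, rfl⟩ := List.mem_iff_getElem.1 hv
    have h1 := hw.get (i := i) hi (hw.length_eq ▸ hi)
    simp only [List.get_eq_getElem, List.getElem_map, mem_sdiff, List.mem_toFinset] at h1
    have hi' : i < E.length := by omega
    obtain ⟨h2, h3⟩ := hER _ (List.getElem_mem hi')
    exact ⟨h2 h1.1, disjoint_left.1 h3 h1.1, h1.2⟩
  obtain ⟨l₂, b1, b2, b3, b4, b5⟩ := hf₂.2.2.2 ∅ subset_rfl
  rw [sdiff_empty] at b2
  -- The absorber gives up exactly the reservoir vertices used by the second path and the two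
  -- connections; the cycle is `l₁ z l₂ w`.
  obtain ⟨l₁, a1, a2, a3, a4, a5⟩ := hf.2.2.2 (R.filter (fun v => v ∈ S₂ ∨ v ∈ z ∨ v ∈ w))
    (filter_subset _ _)
  have m1 : ∀ v, v ∈ l₁ ↔ v ∈ S ∧ ¬ (v ∈ R ∧ (v ∈ S₂ ∨ v ∈ z ∨ v ∈ w)) := fun v => by
    rw [← List.mem_toFinset, a2, mem_sdiff, mem_filter]
  have m2 : ∀ v, v ∈ l₂ ↔ v ∈ S₂ := fun v => by rw [← List.mem_toFinset, b2]
  have hRS := hf.1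
  have hlk : k ≤ (l₂ ++ w).length := by simp; omega
  have hl2k : k ≤ l₂.length := by
    have : (l₂.take k).length = k := by rw [b4, hf₂.2.1]
    rw [List.length_take] at this
    omega
  have hl1k : k ≤ l₁.length := by
    have : (l₁.take k).length = k := by rw [a4, hf.2.1]
    rw [List.length_take] at this
    omega
  refine containsHamiltonCyclePower_of_list (l := l₁ ++ (z ++ (l₂ ++ w))) ?_ ?_ ?_ ?_ hV
  · rw [List.nodup_append', List.nodup_append', List.nodup_append']
    refine ⟨a1, ⟨hznd, ⟨b1, hwnd, fun v h1 h2 => (hwmem v h2).2.1 ((m2 v).1 h1)⟩, fun v h1 h2 => ?_⟩,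
      fun v h1 h2 => ?_⟩
    · rcases List.mem_append.1 h2 with h2 | h2
      · exact (hzmem v h1).2 ((m2 v).1 h2)
      · exact (hwmem v h2).2.2 h1
    · obtain ⟨h3, h4⟩ := (m1 v).1 h1
      rcases List.mem_append.1 h2 with h2 | h2
      · exact h4 ⟨(hzmem v h2).1, Or.inr (Or.inl h2)⟩
      rcases List.mem_append.1 h2 with h2 | h2
      · exact h4 ⟨hS₂ v ((m2 v).1 h2) h3, Or.inl ((m2 v).1 h2)⟩
      · exact h4 ⟨(hwmem v h2).1, Or.inr (Or.inr h2)⟩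
  · ext v
    simp only [List.mem_toFinset, List.mem_append, mem_univ, iff_true, m1, m2]
    have := hcov v
    tauto
  · have h2 : KP G k (l₂ ++ w) := by
      rw [KP_append]
      refine ⟨b3, hwk, ?_⟩
      rw [← Cross_take le_rfl le_rfl, b5]
      rw [← Cross_take le_rfl le_rfl] at hw1
      rwa [List.take_of_length_le hf₂.2.2.1.le] at hw1
    refine KP_join a3 h2 hzk (by omega) (a5 ▸ hz1) ?_
    rw [List.take_append_of_le_length hl2k, b4]
    exact hz2
  · rw [List.reverse_append, List.reverse_append, List.reverse_append, List.append_assoc,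
      List.append_assoc, Cross_append_left (by simp; omega), Cross_append_right hl1k,
      ← Cross_take le_rfl le_rfl, a4]
    rw [← Cross_take le_rfl le_rfl] at hw2
    rwa [List.take_of_length_le hf.2.1.le] at hw2

end

/-! ### Absorbing the last vertices -/

section

theorem card_sub_le_sdiff {V : Type u} (A S : Finset V) :
    (A.card : ℝ) - S.card ≤ (A \ S).card := by
  have := card_sdiff_union_ge A ∅ S
  simpa using this

theorem card_le_add_sdiff {V : Type u} (S S₂ : Finset V) :
    (S₂.card : ℝ) ≤ S.card + (S₂ \ S).card := by
  have : (S₂.card : ℝ) ≤ (S₂ \ S).card + S.card := by exact_mod_cast card_le_card_sdiff_add_card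
  linarith

theorem card_nb_sdiff_ge {V : Type u} (G : SimpleGraph V) (A S X : Finset V) (u : V)
    (h : S ∩ A ⊆ X) : ((nb G A u).card : ℝ) - X.card ≤ (nb G (A \ S) u).card := by
  have h1 : nb G A u ⊆ nb G (A \ S) u ∪ X := fun w hw => by
    obtain ⟨h1, h2⟩ := mem_nb.1 hw
    by_cases hS : w ∈ S
    · exact mem_union_right _ (h (mem_inter.2 ⟨hS, h1⟩))
    · exact mem_union_left _ (mem_nb.2 ⟨mem_sdiff.2 ⟨h1, hS⟩, h2⟩)
  have h2 : ((nb G A u).card : ℝ) ≤ (nb G (A \ S) u).card + X.card := by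
    exact_mod_cast (card_le_card h1).trans (card_union_le _ _)
  linarith

/-- All but few vertices have large degree into a large set. -/
theorem exists_card_low_le (k τ : ℕ) (hk : 1 ≤ k) {c θ : ℝ} (hc : 0 < c) (hθ : 0 < θ) :
    ∃ γ : ℝ, 0 < γ ∧ ∀ (V : Type u) [Fintype V] (G : SimpleGraph V) (p : ℝ), Psr G k τ p γ →
      ∀ (A B : Finset V) (b : ℕ), b ≤ τ → c * order V ≤ A.card →
        (∀ v ∈ B, ((nb G A v).card : ℝ) ≤ p / 2 * A.card) →
        (B.card : ℝ) ≤ θ * (p ^ b * order V) := by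
  obtain ⟨γ, hγ, g1, g2, g3⟩ := exists_pos_le₃ (by positivity : 0 < c * θ / 64)
    (by positivity : 0 < c ^ 2 / 2048) (by positivity : 0 < c / 8)
  refine ⟨γ, hγ, fun V _ G p h A B b hb hA hB => ?_⟩
  have : 0 < c ^ 2 := by positivity
  exact h.low_filter' (a := 0) hc (by simpa using hA) (by omega) (by omega) (by omega)
    (by linarith) (by linarith) (by linarith) hB

theorem Psr.pow_mul_order_le {V : Type u} {G : SimpleGraph V} [Fintype V] {k τ : ℕ} {p γ : ℝ}
    (h : Psr G k τ p γ) (m : ℕ) : p ^ m * order V ≤ order V := by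
  have := pow_le_one₀ h.p_pos.le h.p_le (n := m)
  have := h.order_pos
  nlinarith

/-- The few vertices outside an absorbing chain with ends extendable to the reservoir are absorbed
by a second path. -/
theorem exists_finish {k τ L : ℕ} (hconn : HasConnections.{u} k τ L) (hk : 2 ≤ k)
    (hτ : 2 * k ≤ τ + 1) (hkL : k ≤ L) {c₁ ρ : ℝ} (hc₁ : 0 < c₁) (hρ : 16 * c₁ ≤ ρ) :
    ∃ c' : ℝ, 0 < c' ∧ ∀ c : ℝ, 0 < c → c ≤ c' → ∃ γ : ℝ, 0 < γ ∧
      ∀ (V : Type u) [Fintype V] (G : SimpleGraph V) (p : ℝ), Psr G k τ p γ →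
      ∀ (RC RC₂ : Finset V) (RK E : List (Finset V)) (S R : Finset V) (x y : List V),
        RK.length = L → E.length = L → (RC :: RC₂ :: (RK ++ E)).Pairwise Disjoint →
        (∀ X ∈ RC :: RC₂ :: (RK ++ E), X ⊆ R ∧ ρ * order V ≤ X.card) → Flex G k S R x y →
        (∀ U ∈ E, Extd G k p c x U ∧ Extd G k p c y U) →
        ((univ \ S).card : ℝ) * (2 * k + 1 + L) ≤ ρ / 4 * order V →
        (∀ u ∉ S, p / 2 * RC₂.card < (nb G RC₂ u).card) → 3 ≤ Fintype.card V →
        ContainsHamiltonCyclePower G k := by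
  obtain ⟨c'₁, hc'₁, H₁⟩ := exists_cover_greedy hconn hk hτ hkL hc₁
  obtain ⟨c'₂, hc'₂, H₂⟩ := exists_attach_chunk hconn hk hτ hkL k L le_rfl hc₁
  obtain ⟨c'₃, γ₃, hc'₃, hγ₃, H₃⟩ := exists_path_piece.{u} k τ k (L + L) 0 hc₁ (by omega)
    (by omega) (by omega) (by omega)
  obtain ⟨c', hc', e1, e2, e3⟩ := exists_pos_le₃ hc'₁ hc'₂ hc'₃
  refine ⟨c', hc', fun c hc hcc => ?_⟩
  obtain ⟨γ₁, hγ₁, H₁⟩ := H₁ c hc (hcc.trans e1)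
  obtain ⟨γ₂, hγ₂, H₂⟩ := H₂ c hc (hcc.trans e2)
  obtain ⟨γ₄, hγ₄, H₄⟩ := exists_close hconn hkL hc
  have hθ : 0 < c₁ / (2 * k + 1 + L) := by positivity
  obtain ⟨γ₅, hγ₅, H₅⟩ := exists_card_low_le.{u} k τ (by omega) (c := ρ / 2) (by linarith) hθ
  obtain ⟨γ', hγ', f1, f2, f3, f4⟩ := exists_pos_le₄ hγ₁ hγ₂ hγ₃ hγ₄
  obtain ⟨γ, hγ, f5, f6, f7⟩ := exists_pos_le₃ hγ' hγ₅ (by positivity : 0 < c₁ / (k + 1))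
  refine ⟨γ, hγ, ?_⟩
  intro V _ G p h RC RC₂ RK E S R x y hRK hE hd hRX hfl hext hU hRC₂ hV
  have hp := h.p_pos
  have hn := h.order_pos
  have hpn := h.pow_mul_order_le 1
  rw [pow_one] at hpn
  have hkn : (k : ℝ) ≤ c₁ * order V := by simpa using h.nat_le hc₁ f7 (Nat.zero_le k)
  have hρn : 16 * (c₁ * order V) ≤ ρ * order V := by nlinarith
  have hd1 := List.pairwise_cons.1 hd
  have hd2 := List.pairwise_cons.1 hd1.2
  have hd3 := List.pairwise_append.1 hd2.2
  have hc₁n : ∀ X ∈ RC :: RC₂ :: (RK ++ E), c₁ * order V ≤ X.card := fun X hX => by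
    have := (hRX X hX).2
    nlinarith
  -- the first piece
  obtain ⟨l, hl, hnd, hkp, hlA, hlext⟩ := H₃ V G p (h.mono (f5.trans f3)) RC (unused RK E ∅)
    (card_unused_le hRK hE.le) (by simpa using hc₁n RC (by simp)) (forall_mem_unused.2
      ⟨fun U hU => by simpa using hc₁n U (by simp [hU]), fun U hU => hc₁n U (by simp [hU])⟩)
  rw [forall_mem_unused] at hlext
  have hlS : l.toFinset ⊆ RC := fun w hw => hlA w (List.mem_toFinset.1 hw)
  have hlc : (l.toFinset.card : ℝ) ≤ c₁ * order V := by
    rw [List.toFinset_card_of_nodup hnd, hl]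
    exact hkn
  have hch : Chain G k p c RK l.toFinset ∅ (l.take k) (l.reverse.take k) := by
    refine ⟨Flex.of_list hnd hkp (by omega), fun U hU => ?_⟩
    have hUd : U \ l.toFinset = U := sdiff_eq_self_of_disjoint
      (disjoint_of_subset_right hlS (hd1.1 U (by simp [hU])).symm)
    rw [hUd, Extd_take]
    have := (hlext.1 U hU).2
    rw [sdiff_empty] at this
    exact this.mono hp.le (hcc.trans e3) subset_rfl
  have hxE : ∀ U ∈ E, Extd G k p c (l.take k) U := fun U hU => by
    rw [Extd_take]
    exact (hlext.2 U hU).1.mono hp.le (hcc.trans e3) subset_rfl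
  -- most vertices are covered with the first part of the reservoir
  set Z := univ \ S with hZ
  obtain ⟨S₁, y₁, a1, a2, a3, a4, a5⟩ := H₁ V G p (h.mono (f5.trans f1)) RK l.toFinset ∅ RC Z
    (l.take k) (l.reverse.take k) Z.card hRK hd3.1 hch (card_le_card sdiff_subset) (fun U hU => by
      have h1 := card_sub_le_sdiff U l.toFinset
      have h2 := (hRX U (by simp [hU])).2
      linarith)
  have hS₁ := card_le_add_sdiff l.toFinset S₁
  -- Vertices still uncovered have atypically few neighbours in the large rest of `RC`. There are so
  -- few of them that covering them uses at most `c₁pn` vertices.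
  have hlow := H₅ V G p (h.mono f6) (RC \ S₁) (Z \ S₁) 1 (by omega) (by
    have h1 := card_sub_le_sdiff RC S₁
    have h2 := (hRX RC (by simp)).2
    linarith) (fun u hu => by
      obtain ⟨hu1, hu2⟩ := mem_sdiff.1 hu
      have h1 := a5 u hu1 hu2
      have h2 := card_sub_le_sdiff RC S₁
      have h3 := (hRX RC (by simp)).2
      have h4 : c₁ * order V ≤ 1 / 2 * (RC \ S₁).card := by linarith
      have h5 : p * (c₁ * order V) ≤ p * (1 / 2 * (RC \ S₁).card) := by gcongr
      linarith)
  have hlow' : ((Z \ S₁).card : ℝ) * (2 * k + 1 + L) ≤ c₁ * (p * order V) := by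
    rw [pow_one] at hlow
    calc ((Z \ S₁).card : ℝ) * (2 * k + 1 + L)
        ≤ c₁ / (2 * k + 1 + L) * (p * order V) * (2 * k + 1 + L) := by gcongr
      _ = _ := by field_simp
  have hcp : c₁ * (p * order V) ≤ c₁ * order V := by gcongr
  -- the remaining vertices
  obtain ⟨S₂, y₂, b1, b2, b3, b4, b5⟩ := H₁ V G p (h.mono (f5.trans f1)) RK S₁ ∅ RC₂ (Z \ S₁)
    (l.take k) y₁ (Z \ S₁).card hRK hd3.1 a1 (card_le_card sdiff_subset) (fun U hU => by
      have h1 := card_sub_le_sdiff U S₁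
      have h2 := (hRX U (by simp [hU])).2
      linarith)
  have hS₂ := card_le_add_sdiff S₁ S₂
  have hZS : ∀ u ∈ Z, u ∉ S := fun u hu => (mem_sdiff.1 hu).2
  have hRS : ∀ w ∈ R, w ∉ Z := fun w hw hwZ => hZS w hwZ (hfl.1 hw)
  have hS₁RC₂ : ∀ w ∈ S₁, w ∉ RC₂ := by
    intro w hw hwR
    rcases a3 w hw with hw | hw | hw | ⟨U, hU, hw⟩
    · exact disjoint_left.1 (hd1.1 RC₂ (by simp)) (hlS hw) hwR
    · exact hRS w ((hRX RC₂ (by simp)).1 hwR) hw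
    · exact disjoint_left.1 (hd1.1 RC₂ (by simp)) hw hwR
    · exact disjoint_left.1 (hd2.1 U (by simp [hU])) hwR hw
  -- Every vertex outside `S` has more than `8c₁pn` neighbours in `RC₂`, and `RC₂` has lost at most
  -- `c₁pn` vertices, so the greedy covering cannot have stopped short.
  have hZ₂ : ∀ u ∈ Z, u ∈ S₂ := by
    intro u hu
    by_contra huS
    have h1 := b5 u (mem_sdiff.2 ⟨hu, fun h => huS (b2 h)⟩) huS
    have h2 := card_nb_sdiff_ge G RC₂ S₂ (S₂ \ S₁) u (fun w hw => mem_sdiff.2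
      ⟨(mem_inter.1 hw).1, fun h => hS₁RC₂ w h (mem_inter.1 hw).2⟩)
    have h3 := hRC₂ u (hZS u hu)
    have h4 := (hRX RC₂ (by simp)).2
    have h5 : p / 2 * (16 * (c₁ * order V)) ≤ p / 2 * RC₂.card := by
      have := hρn.trans h4
      gcongr
    have h6 : 0 < c₁ * (p * order V) := by positivity
    linarith
  -- the last piece
  obtain ⟨W, S', y₃, d1, d2, d3, d4, d5, d6, d7, d8⟩ := H₂ V G p (h.mono (f5.trans f2)) RK E S₂ ∅ RC
    (l.take k) y₂ hRK hd3.1 hE.le b1 (by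
      have h1 := card_sub_le_sdiff RC S₂
      have h2 := (hRX RC (by simp)).2
      linarith) (fun U hU => by
      have h1 := card_sub_le_sdiff U S₂
      have h2 := (hRX U (by simp [hU])).2
      linarith) (fun U hU => hc₁n U (by simp [hU]))
  have hfin : ∀ w ∈ S₂ ∪ W, w ∈ Z ∨ w ∈ RC ∨ w ∈ RC₂ ∨ InSome RK w := by
    intro w hw
    rcases mem_union.1 hw with hw | hw
    · rcases b3 w hw with hw | hw | hw | hw
      · rcases a3 w hw with hw | hw | hw | hw
        · exact Or.inr (Or.inl (hlS hw))
        all_goals tauto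
      · exact Or.inl (mem_sdiff.1 hw).1
      · tauto
      · tauto
    · rcases d7 w hw with hw | hw
      · exact Or.inr (Or.inl (d5 hw))
      · tauto
  refine H₄ V G p (h.mono (f5.trans f4)) E S R (S₂ ∪ W) x y (l.take k) y₃ hE hd3.2.1 hfl d1.1
    (fun U hU => ⟨(hRX U (by simp [hU])).1, disjoint_left.2 fun w hwU hw => ?_⟩) (fun w => ?_)
    (fun w hw hwS => ?_)
    (fun U hU => ⟨(hext U hU).1, (hext U hU).2, hxE U hU, d2 U hU⟩) hV
  · rcases hfin w hw with hw | hw | hw | ⟨U', hU', hw⟩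
    · exact hRS w ((hRX U (by simp [hU])).1 hwU) hw
    · exact disjoint_left.1 (hd1.1 U (by simp [hU])) hw hwU
    · exact disjoint_left.1 (hd2.1 U (by simp [hU])) hw hwU
    · exact disjoint_left.1 (hd3.2.2 U' hU' U hU) hw hwU
  · by_cases hw : w ∈ S
    · exact Or.inl hw
    · exact Or.inr (mem_union_left _ (hZ₂ w (by simp [hZ, hw])))
  · rcases hfin w hw with hw | hw | hw | ⟨U', hU', hw⟩
    · exact absurd hwS (hZS w hw)
    · exact (hRX RC (by simp)).1 hw
    · exact (hRX RC₂ (by simp)).1 hw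
    · exact (hRX U' (by simp [hU'])).1 hw

end

/-! ### Covering nearly all vertices -/

section

theorem card_sdiff_ge_of_inter {V : Type u} {U S X : Finset V} (h : S ∩ U ⊆ X) :
    (U.card : ℝ) - X.card ≤ (U \ S).card := by
  have h1 : U ⊆ (U \ S) ∪ X := fun w hw => by
    by_cases hS : w ∈ S
    · exact mem_union_right _ (h (mem_inter.2 ⟨hS, hw⟩))
    · exact mem_union_left _ (mem_sdiff.2 ⟨hw, hS⟩)
  have h2 : (U.card : ℝ) ≤ (U \ S).card + X.card := by
    exact_mod_cast (card_le_card h1).trans (card_union_le _ _)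
  linarith

/-- A chain can be prolonged to cover nearly all vertices outside the connecting sets, among them
all vertices of small degree into `RC₂`. -/
theorem exists_covering_chain {k τ L : ℕ} (hconn : HasConnections.{u} k τ L) (hk : 2 ≤ k)
    (hτ : 2 * k ≤ τ + 1) (hkL : k ≤ L) {σ ρ κ c₁ : ℝ} (hc₁ : 0 < c₁) (hκ : 16 * c₁ ≤ κ)
    (hσ : κ ≤ σ) (hρ : 0 < ρ) :
    ∃ c' : ℝ, 0 < c' ∧ ∀ c : ℝ, 0 < c → c ≤ c' → ∃ γ : ℝ, 0 < γ ∧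
      ∀ (V : Type u) [Fintype V] (G : SimpleGraph V) (p : ℝ), Psr G k τ p γ →
      ∀ (K E : List (Finset V)) (Y RC₂ S R S₁ : Finset V) (x y : List V),
        K.length = L → E.length = L → K.Pairwise Disjoint → σ * order V ≤ Y.card →
        ρ * order V ≤ RC₂.card → (∀ U ∈ K, κ / 2 * order V ≤ U.card) →
        (∀ U ∈ E, c₁ * order V ≤ U.card) → Chain G k p c K S R x y →
        (S₁.card : ℝ) ≤ c₁ * (p * order V) →
        (∀ w ∈ S, w ∈ S₁ ∨ w ∉ Y ∧ ¬ InSome K w) →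
        (∀ u ∉ S, p / 2 * Y.card < (nb G Y u).card) →
        ∃ (S₂ : Finset V) (y' : List V), Flex G k S₂ R x y' ∧ S ⊆ S₂ ∧
          (∀ U ∈ E, Extd G k p c y' U) ∧ (∀ u ∉ S₂, p / 2 * RC₂.card < (nb G RC₂ u).card) ∧
          (((univ.filter (fun w => ¬ InSome K w)) \ S₂).card : ℝ) ≤ c₁ * order V := by
  -- Chunks this long make the `L` connecting vertices per chunk negligible: in total at most
  -- `2c₁n`.
  obtain ⟨N, hN⟩ : ∃ N : ℕ, N = ⌈L / c₁⌉₊ + k := ⟨_, rfl⟩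
  have hNL : L ≤ c₁ * N := by
    have h1 := Nat.le_ceil (L / c₁)
    rw [div_le_iff₀ hc₁] at h1
    rw [hN]
    push_cast
    have : (0:ℝ) ≤ c₁ * k := by positivity
    linarith
  obtain ⟨c'₁, hc'₁, H₁⟩ := exists_cover_greedy hconn hk hτ hkL hc₁
  obtain ⟨c'₂, hc'₂, H₂⟩ := exists_attach_chunk hconn hk hτ hkL N L (by omega) hc₁
  obtain ⟨c'₃, hc'₃, H₃⟩ := exists_chunk_chain hconn hk hτ hkL N L (by omega) hc₁
  obtain ⟨c', hc', e1, e2, e3⟩ := exists_pos_le₃ hc'₁ hc'₂ hc'₃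
  refine ⟨c', hc', fun c hc hcc => ?_⟩
  obtain ⟨γ₁, hγ₁, H₁⟩ := H₁ c hc (hcc.trans e1)
  obtain ⟨γ₂, hγ₂, H₂⟩ := H₂ c hc (hcc.trans e2)
  obtain ⟨γ₃, hγ₃, H₃⟩ := H₃ c hc (hcc.trans e3)
  have hθ : 0 < c₁ / (2 * k + 1 + L) := by positivity
  obtain ⟨γ₅, hγ₅, H₅⟩ := exists_card_low_le.{u} k τ (by omega) (c := ρ) hρ hθ
  obtain ⟨γ', hγ', f1, f2, f3, f4⟩ := exists_pos_le₄ hγ₁ hγ₂ hγ₃ hγ₅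
  obtain ⟨γ, hγ, f5, f6⟩ := exists_pos_le₂ hγ' (by positivity : 0 < c₁ / ((N + L : ℕ) + 1))
  refine ⟨γ, hγ, ?_⟩
  intro V _ G p h K E Y RC₂ S R S₁ x y hK hE hKd hY hRC₂ hKc hEc hch hS₁ hSS₁ hYdeg
  have hp := h.p_pos
  have hn := h.order_pos
  have hpn := h.pow_mul_order_le 1
  rw [pow_one] at hpn
  have hcp : c₁ * (p * order V) ≤ c₁ * order V := by gcongr
  have hNn : (N : ℝ) + L ≤ c₁ * order V := by
    have := h.nat_le hc₁ f6 (Nat.zero_le k)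
    rw [pow_zero, one_mul] at this
    push_cast at this
    exact this
  have hN0 : (0:ℝ) ≤ N := by positivity
  have hκn : 16 * (c₁ * order V) ≤ κ * order V := by nlinarith
  have hσn : κ * order V ≤ σ * order V := by gcongr
  -- Within `Y` and the connecting sets, a prolonged chain consists only of vertices of `S₁` and
  -- newly added ones. `Y` is thus nearly untouched when the vertices of small degree into `RC₂` are
  -- covered through it.
  have hinter : ∀ U : Finset V, (U = Y ∨ U ∈ K) → ∀ T : Finset V, S ⊆ T →
      T ∩ U ⊆ S₁ ∪ (T \ S) := by
    intro U hU T hT w hw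
    obtain ⟨hwT, hwU⟩ := mem_inter.1 hw
    by_cases hwS : w ∈ S
    · rcases hSS₁ w hwS with h1 | ⟨h1, h2⟩
      · exact mem_union_left _ h1
      · rcases hU with rfl | hU
        · exact absurd hwU h1
        · exact absurd ⟨U, hU, hwU⟩ h2
    · exact mem_union_right _ (mem_sdiff.2 ⟨hwT, hwS⟩)
  have hcard : ∀ U : Finset V, (U = Y ∨ U ∈ K) → ∀ T : Finset V, S ⊆ T →
      (U.card : ℝ) - (S₁.card + (T \ S).card) ≤ (U \ T).card := by
    intro U hU T hT
    have h1 := card_sdiff_ge_of_inter (hinter U hU T hT)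
    have h2 : ((S₁ ∪ (T \ S)).card : ℝ) ≤ S₁.card + (T \ S).card := by
      exact_mod_cast card_union_le _ _
    linarith
  -- vertices of small degree into the reservoir
  set Z := univ.filter (fun u => ((nb G RC₂ u).card : ℝ) ≤ p / 2 * RC₂.card) with hZ
  have hZc : (Z.card : ℝ) * (2 * k + 1 + L) ≤ c₁ * (p * order V) := by
    have := H₅ V G p (h.mono (f5.trans f4)) RC₂ Z 1 (by omega) hRC₂ fun u hu => (mem_filter.1 hu).2
    rw [pow_one] at this
    calc (Z.card : ℝ) * (2 * k + 1 + L)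
        ≤ c₁ / (2 * k + 1 + L) * (p * order V) * (2 * k + 1 + L) := by gcongr
      _ = _ := by field_simp
  obtain ⟨S₂, y₂, a1, a2, a3, a4, a5⟩ := H₁ V G p (h.mono (f5.trans f1)) K S R Y Z x y Z.card hK hKd
    hch (card_le_card sdiff_subset) (fun U hU => by
      have h1 := hcard U (Or.inr hU) S subset_rfl
      rw [Finset.sdiff_self, card_empty] at h1
      have h2 := hKc U hU
      push_cast at h1
      linarith)
  have hZS₂ : ∀ u ∈ Z, u ∈ S₂ := by
    intro u hu
    by_contra huS
    have h1 := a5 u hu huS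
    have h2 := card_nb_sdiff_ge G Y S₂ _ u (hinter Y (Or.inl rfl) S₂ a2)
    have h3 : ((S₁ ∪ (S₂ \ S)).card : ℝ) ≤ S₁.card + (S₂ \ S).card := by
      exact_mod_cast card_union_le _ _
    have h4 := hYdeg u fun h => huS (a2 h)
    have h5 : p / 2 * (16 * (c₁ * order V)) ≤ p / 2 * Y.card := by
      have := hκn.trans (hσn.trans hY)
      gcongr
    have h6 : 0 < c₁ * (p * order V) := by positivity
    linarith
  -- one further piece with an end extendable to the reservoir
  obtain ⟨W, S', y₃, d1, d2, d3, d4, d5, d6, d7, d8⟩ := H₂ V G p (h.mono (f5.trans f2)) K E S₂ R Y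
    x y₂ hK hKd hE.le a1 (by
      have h1 := hcard Y (Or.inl rfl) S₂ a2
      linarith) (fun U hU => by
      have h1 := hcard U (Or.inr hU) S₂ a2
      have h2 := hKc U hU
      linarith) hEc
  have hWc : (W.card : ℝ) ≤ c₁ * order V := by
    have h1 := card_sdiff_add_card_eq_card d4
    have h2 : W.card ≤ N + L := by omega
    have h3 : (W.card : ℝ) ≤ N + L := by exact_mod_cast h2
    linarith
  -- long chunks
  set m := ⌈order V / (N : ℝ)⌉₊ with hm
  have hNpos : (0:ℝ) < N := by
    have : 0 < N := by omega
    exact_mod_cast this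
  have hmN : order V ≤ m * N := by
    have := Nat.le_ceil (order V / (N : ℝ))
    rwa [div_le_iff₀ hNpos] at this
  have hmL : (m : ℝ) * L ≤ 2 * (c₁ * order V) := by
    have h1 := (Nat.ceil_lt_add_one (a := order V / (N : ℝ)) (by positivity)).le
    have hL0 : (0:ℝ) ≤ L := by positivity
    calc (m : ℝ) * L ≤ (order V / N + 1) * L := by gcongr
      _ = order V / N * L + L := by ring
      _ ≤ order V / N * (c₁ * N) + L := by gcongr
      _ = c₁ * order V + L := by field_simp
      _ ≤ _ := by linarith
  obtain ⟨S₃, y₄, b1, b2, b3, b4, b5⟩ := H₃ V G p (h.mono (f5.trans f3)) K E (S₂ ∪ W) R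
    (univ.filter (fun w => ¬ InSome K w)) x y₃ m hK hKd hE.le d1 (fun w hw => (mem_filter.1 hw).2) (by
      have h1 : ((univ.filter (fun w => ¬ InSome K w)) \ (S₂ ∪ W)).card ≤ Fintype.card V :=
        card_le_univ _
      have h2 : Fintype.card V ≤ m * N := by exact_mod_cast hmN
      omega) (fun U hU => by
      have h1 := hcard U (Or.inr hU) S₂ a2
      have h2 := hKc U hU
      have h3 := card_sdiff_union_ge U S₂ W
      linarith) hEc d2
  refine ⟨S₃, y₄, b1.1, a2.trans (subset_union_left.trans b3), b2, fun u hu => ?_, b5.le⟩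
  by_contra hlt
  exact hu (b3 (mem_union_left _ (hZS₂ u (mem_filter.2 ⟨mem_univ _, not_lt.1 hlt⟩))))

end

/-! ### The absorbing chain -/

section

set_option maxHeartbeats 1000000 in
/-- There is a chain absorbing every subset of a linear-size reservoir, which contains all vertices
of small degree into `Y`. -/
theorem exists_absorbing_chain {k τ L : ℕ} (hconn : HasConnections.{u} k τ L)
    (hgad : HasGadgets.{u} k τ) (hk : 2 ≤ k) (hτ : 2 * k ≤ τ + 1) (hkL : k ≤ L) {σ : ℝ}
    (hσ : 0 < σ) :
    ∃ ρ : ℝ, 0 < ρ ∧ ∀ β c₁ : ℝ, 0 < c₁ → 8 * c₁ ≤ σ → 4 * c₁ ≤ β → c₁ ≤ ρ →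
      ∃ c' : ℝ, 0 < c' ∧ ∀ c : ℝ, 0 < c → c ≤ c' → ∃ γ : ℝ, 0 < γ ∧
      ∀ (V : Type u) [Fintype V] (G : SimpleGraph V) (p : ℝ), Psr G k τ p γ →
      ∀ (T Y A : Finset V) (K₁ K₂ : List (Finset V)), (∀ v, β * (p * order V) ≤ (nb G univ v).card) →
        K₁.length = L → K₂.length = L → (T :: Y :: A :: (K₁ ++ K₂)).Pairwise Disjoint →
        σ * order V ≤ T.card → σ * order V ≤ Y.card → σ * order V ≤ A.card →
        (∀ U ∈ K₁, σ * order V ≤ U.card) → (∀ U ∈ K₂, c₁ * order V ≤ U.card) →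
        ∃ (S R S₁ RC RC₂ : Finset V) (RK E : List (Finset V)) (x y : List V),
          Chain G k p c K₂ S R x y ∧ RK.length = L ∧ E.length = L ∧
          (RC :: RC₂ :: (RK ++ E)).Pairwise Disjoint ∧
          (∀ X ∈ RC :: RC₂ :: (RK ++ E), X ⊆ R ∧ ρ * order V ≤ X.card) ∧
          (∀ U ∈ E, Extd G k p c x U) ∧ (S₁.card : ℝ) ≤ c₁ * (p * order V) ∧
          (∀ w ∈ S, w ∈ S₁ ∨ w ∉ Y ∧ ¬ InSome K₂ w) ∧
          ∀ u ∉ S, p / 2 * Y.card < (nb G Y u).card := by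
  obtain ⟨c'₁, D, hc'₁, H₁⟩ := exists_gadget_chain hconn hgad hkL (by positivity : 0 < σ / 4)
  -- With `ρ₀n` gadgets, each using at most `D + L` vertices, at most `(σ/4)n` vertices are
  -- consumed.
  obtain ⟨ρ₀, hρ₀⟩ : ∃ ρ₀ : ℝ, ρ₀ = σ / (4 * (D + L + 1)) := ⟨_, rfl⟩
  have hρ₀0 : 0 < ρ₀ := by rw [hρ₀]; positivity
  refine ⟨ρ₀ / (8 * (L + 1)), by positivity, ?_⟩
  intro β c₁ hc₁ hc₁σ hβ hc₁ρ
  obtain ⟨c'₂, hc'₂, H₂⟩ := exists_cover_greedy hconn hk hτ hkL hc₁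
  obtain ⟨c'₃, hc'₃, H₃⟩ := exists_attach_chunk hconn hk hτ hkL k L le_rfl hc₁
  obtain ⟨c'₄, γ₄, hc'₄, hγ₄, H₄⟩ := exists_path_piece.{u} k τ k (L + L) 0 hc₁ (by omega)
    (by omega) (by omega) (by omega)
  obtain ⟨c', hc', e1, e2, e3, e4⟩ := exists_pos_le₄ hc'₁ hc'₂ hc'₃
    (by positivity : 0 < c'₄ / 2)
  refine ⟨c', hc', fun c hc hcc => ?_⟩
  obtain ⟨γ₁, hγ₁, H₁⟩ := H₁ c hc (hcc.trans e1)
  obtain ⟨γ₂, hγ₂, H₂⟩ := H₂ c hc (hcc.trans e2)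
  obtain ⟨γ₃, hγ₃, H₃⟩ := H₃ c hc (hcc.trans e3)
  -- The vertices used to cover those of small degree may lie anywhere. There are at most `θ₀p^k n`
  -- of them, so few that the first end stays extendable into `K₂`.
  obtain ⟨θ₀, hθ₀, t1, t2⟩ := exists_pos_le₂ hc hc₁
  have hθ : 0 < θ₀ / (2 * k + 1 + L) := by positivity
  obtain ⟨γ₅, hγ₅, H₅⟩ := exists_card_low_le.{u} k τ (by omega) (c := σ) hσ hθ
  obtain ⟨γ', hγ', f1, f2, f3, f4⟩ := exists_pos_le₄ hγ₁ hγ₂ hγ₃ hγ₄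
  obtain ⟨γ, hγ, f5, f6, f7, f8⟩ := exists_pos_le₄ hγ' hγ₅ (by positivity : 0 < c₁ / (k + 1))
    (by positivity : 0 < ρ₀ / 2 / ((2 * L + 2 : ℕ) + 1))
  refine ⟨γ, hγ, ?_⟩
  intro V _ G p h T Y A K₁ K₂ hdeg hK₁ hK₂ hd hT hY hA hK₁c hK₂c
  have hp := h.p_pos
  have hn := h.order_pos
  have hpn := h.pow_mul_order_le 1
  rw [pow_one] at hpn
  have hkpn : (k : ℝ) ≤ c₁ * (p * order V) := by
    simpa using h.nat_le hc₁ f7 (by omega : 1 ≤ k)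
  have hLn : ((2 * L + 2 : ℕ) : ℝ) ≤ ρ₀ / 2 * order V := by
    simpa using h.nat_le (by positivity) f8 (Nat.zero_le k)
  have hcp : c₁ * (p * order V) ≤ c₁ * order V := by gcongr
  have hσn : 8 * (c₁ * order V) ≤ σ * order V := by nlinarith
  have hc₁n : 0 < c₁ * order V := by positivity
  have hdT := List.pairwise_cons.1 hd
  have hdY := List.pairwise_cons.1 hdT.2
  have hdA := List.pairwise_cons.1 hdY.2
  have hdK := List.pairwise_append.1 hdA.2
  -- the initial piece
  obtain ⟨l, hl, hnd, hkp, hlA, hlext⟩ := H₄ V G p (h.mono (f5.trans f4)) A (unused K₁ K₂ ∅)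
    (card_unused_le hK₁ hK₂.le) (by simp; linarith) (forall_mem_unused.2
      ⟨fun U hU => by rw [sdiff_empty]; linarith [hK₁c U hU], hK₂c⟩)
  rw [forall_mem_unused] at hlext
  have hlS : l.toFinset ⊆ A := fun w hw => hlA w (List.mem_toFinset.1 hw)
  have hlc : (l.toFinset.card : ℝ) ≤ c₁ * (p * order V) := by
    rw [List.toFinset_card_of_nodup hnd, hl]
    exact hkpn
  have hch : Chain G k p c K₁ l.toFinset ∅ (l.take k) (l.reverse.take k) := by
    refine ⟨Flex.of_list hnd hkp (by omega), fun U hU => ?_⟩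
    have hUd : U \ l.toFinset = U := sdiff_eq_self_of_disjoint
      (disjoint_of_subset_right hlS (hdA.1 U (by simp [hU])).symm)
    rw [hUd, Extd_take]
    have := (hlext.1 U hU).2
    rw [sdiff_empty] at this
    exact this.mono hp.le (by linarith) subset_rfl
  -- vertices of small degree
  set Z := univ.filter (fun u => ((nb G Y u).card : ℝ) ≤ p / 2 * Y.card) with hZ
  have hZc : (Z.card : ℝ) * (2 * k + 1 + L) ≤ θ₀ * (p ^ k * order V) := by
    have := H₅ V G p (h.mono f6) Y Z k (by omega) hY fun u hu => (mem_filter.1 hu).2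
    calc (Z.card : ℝ) * (2 * k + 1 + L)
        ≤ θ₀ / (2 * k + 1 + L) * (p ^ k * order V) * (2 * k + 1 + L) := by gcongr
      _ = _ := by field_simp
  have hpk : p ^ k * order V ≤ p * order V := by
    have : p ^ k ≤ p := pow_le_of_le_one hp.le h.p_le (by omega)
    gcongr
  have hZc₁ : (Z.card : ℝ) * (2 * k + 1 + L) ≤ c₁ * (p * order V) := hZc.trans (by gcongr)
  obtain ⟨S₂, y₂, a1, a2, a3, a4, a5⟩ := H₂ V G p (h.mono (f5.trans f2)) K₁ l.toFinset ∅ univ Z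
    (l.take k) (l.reverse.take k) Z.card hK₁ hdK.1 hch (card_le_card sdiff_subset) (fun U hU => by
      have h1 := card_sub_le_sdiff U l.toFinset
      linarith [hK₁c U hU])
  have hS₂ := card_le_add_sdiff l.toFinset S₂
  have hZS₂ : ∀ u ∈ Z, u ∈ S₂ := by
    intro u hu
    by_contra huS
    have h1 := a5 u hu huS
    have h2 := card_nb_sdiff_ge G univ S₂ S₂ u inter_subset_left
    -- The minimum degree is used here: a vertex of small degree into `Y` still has neighbours
    -- somewhere, most of them unused.
    have h3 := hdeg u
    have h4 : 4 * c₁ * (p * order V) ≤ β * (p * order V) := by gcongr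
    have h5 : 0 < c₁ * (p * order V) := by positivity
    linarith
  -- the gadgets
  set m := ⌊ρ₀ * order V⌋₊ with hm
  have hm1 : (m : ℝ) ≤ ρ₀ * order V := Nat.floor_le (by positivity)
  have hm2 : ρ₀ / 2 * order V ≤ m := by
    have h1 := (Nat.lt_floor_add_one (ρ₀ * order V)).le
    push_cast at hLn
    have h2 : (0:ℝ) ≤ L := by positivity
    rw [← hm] at h1
    linarith
  have hmD : (m : ℝ) * (D + L) ≤ σ / 4 * order V := by
    calc (m : ℝ) * (D + L) ≤ ρ₀ * order V * (D + L + 1) :=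
          mul_le_mul hm1 (by linarith) (by positivity) (by positivity)
      _ = σ / 4 * order V := by rw [hρ₀]; field_simp
  obtain ⟨S₃, R, y₃, b1, b2, b3, b4, b5, b6⟩ := H₁ V G p (h.mono (f5.trans f1)) K₁ S₂ ∅ T A
    (l.take k) y₂ m hK₁ hdK.1 a1 (hdT.1 A (by simp))
    (by linarith [card_sub_le_sdiff T S₂]) (by linarith [card_sub_le_sdiff A S₂])
    (fun U hU => by linarith [card_sub_le_sdiff U S₂, hK₁c U hU])
  have hS₃ := card_le_add_sdiff S₂ S₃
  rw [card_empty, zero_add] at b6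
  obtain ⟨P, hP, hPd, hPR⟩ := exists_disjoint_list R (m := 2 * L + 2) (by omega) hLn (by
    rw [b6]; exact hm2)
  obtain ⟨RC, RC₂, P', rfl⟩ : ∃ a b P', P = a :: b :: P' := by
    match P, hP with
    | a :: b :: P', _ => exact ⟨a, b, P', rfl⟩
  have hP' : P' = P'.take L ++ P'.drop L := (List.take_append_drop _ _).symm
  simp only [List.length_cons] at hP
  rw [hP'] at hPd hPR
  obtain ⟨RK, hRK⟩ : ∃ RK, RK = P'.take L := ⟨_, rfl⟩
  obtain ⟨E, hE⟩ : ∃ E, E = P'.drop L := ⟨_, rfl⟩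
  rw [← hRK, ← hE] at hPd hPR
  have hPR' : ∀ X ∈ RC :: RC₂ :: (RK ++ E), X ⊆ R ∧ ρ₀ / (8 * (L + 1)) * order V ≤ X.card := by
    intro X hX
    obtain ⟨h1, h2⟩ := hPR X hX
    refine ⟨h1, le_trans (le_of_eq ?_) h2⟩
    push_cast
    field_simp
    ring
  have hEl : E.length = L := by rw [hE, List.length_drop]; omega
  have hRKl : RK.length = L := by rw [hRK, List.length_take]; omega
  -- the last piece
  obtain ⟨W, S', y₄, d1, d2, d3, d4, d5, d6, d7, d8⟩ := H₃ V G p (h.mono (f5.trans f3)) K₁ E S₃ R A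
    (l.take k) y₃ hK₁ hdK.1 hEl.le b1
    (by linarith [card_sub_le_sdiff A S₃])
    (fun U hU => by linarith [card_sub_le_sdiff U S₃, hK₁c U hU])
    (fun U hU => le_trans (by gcongr) (hPR' U (by simp [hU])).2)
  have hmem : ∀ w ∈ S₃ ∪ W, w ∈ S₂ \ l.toFinset ∨ w ∈ A ∨ w ∈ T ∨ InSome K₁ w := by
    intro w hw
    rcases mem_union.1 hw with hw | hw
    · rcases b3 w hw with hw | hw | hw | hw
      · by_cases hwl : w ∈ l.toFinset
        · exact Or.inr (Or.inl (hlS hwl))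
        · exact Or.inl (mem_sdiff.2 ⟨hw, hwl⟩)
      all_goals tauto
    · rcases d7 w hw with hw | hw
      · exact Or.inr (Or.inl (d5 hw))
      · tauto
  have hmem' : ∀ w ∈ S₃ ∪ W, w ∈ S₂ \ l.toFinset ∨ w ∉ Y ∧ ¬ InSome K₂ w := by
    intro w hw
    rcases hmem w hw with hw | hw | hw | ⟨U, hU, hw⟩
    · exact Or.inl hw
    · exact Or.inr ⟨disjoint_right.1 (hdY.1 A (by simp)) hw, fun ⟨U, hU, hwU⟩ =>
        disjoint_left.1 (hdA.1 U (by simp [hU])) hw hwU⟩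
    · exact Or.inr ⟨disjoint_left.1 (hdT.1 Y (by simp)) hw, fun ⟨U, hU, hwU⟩ =>
        disjoint_left.1 (hdT.1 U (by simp [hU])) hw hwU⟩
    · exact Or.inr ⟨disjoint_right.1 (hdY.1 U (by simp [hU])) hw, fun ⟨U', hU', hwU⟩ =>
        disjoint_left.1 (hdK.2.2 U hU U' hU') hw hwU⟩
  -- The chain is reversed: its initial piece, kept extendable into the still unused sets `K₂`,
  -- becomes the end to be prolonged, while the other end faces the reservoir parts `E`.
  refine ⟨S₃ ∪ W, R, S₂ \ l.toFinset, RC, RC₂, RK, E, y₄, l.take k, ⟨d1.1.reverse, fun U hU => ?_⟩,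
    hRKl, hEl, hPd, hPR', d2, a4.trans hZc₁, hmem', fun u hu => ?_⟩
  · have h1 := (hlext.2 U hU).1
    have h2 : (((S₃ ∪ W) ∩ U).card : ℝ) ≤ c * (p ^ k * order V) := by
      have h3 : (S₃ ∪ W) ∩ U ⊆ S₂ \ l.toFinset := fun w hw => by
        obtain ⟨hw1, hw2⟩ := mem_inter.1 hw
        exact (hmem' w hw1).resolve_right fun h => h.2 ⟨U, hU, hw2⟩
      have h4 : (((S₃ ∪ W) ∩ U).card : ℝ) ≤ (S₂ \ l.toFinset).card := by
        exact_mod_cast card_le_card h3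
      have h5 : θ₀ * (p ^ k * order V) ≤ c * (p ^ k * order V) := by gcongr
      linarith
    rw [Extd_take]
    exact (h1.sdiff hp.le h.p_le h2 hc.le).mono hp.le (by linarith) subset_rfl
  · by_contra hlt
    exact hu (mem_union_left _ (b2 (hZS₂ u (mem_filter.2 ⟨mem_univ _, not_lt.1 hlt⟩))))

end

/-! ### Assembly for pseudorandom graphs -/

section

theorem exists_map_subset_card {V : Type u} (K : List (Finset V)) (r : ℕ)
    (h : ∀ U ∈ K, r ≤ U.card) :
    ∃ f : Finset V → Finset V, (∀ U, f U ⊆ U) ∧ ∀ U ∈ K, (f U).card = r := by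
  have : ∀ U : Finset V, ∃ X ⊆ U, U ∈ K → X.card = r := fun U => by
    by_cases hU : U ∈ K
    · obtain ⟨X, hX, hXc⟩ := exists_subset_card_eq (h U hU)
      exact ⟨X, hX, fun _ => hXc⟩
    · exact ⟨U, subset_rfl, fun h => absurd h hU⟩
  choose f hf hfc using this
  exact ⟨f, hf, hfc⟩

theorem card_filter_inSome_le {V : Type u} [Fintype V] (K : List (Finset V)) (r : ℕ)
    (h : ∀ U ∈ K, U.card ≤ r) : (univ.filter (InSome K)).card ≤ K.length * r := by
  induction K with
  | nil => simp [InSome]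
  | cons U K ih =>
    have h1 : univ.filter (InSome (U :: K)) ⊆ U ∪ univ.filter (InSome K) := fun w hw => by
      obtain ⟨X, hX, hwX⟩ := (mem_filter.1 hw).2
      rcases List.mem_cons.1 hX with rfl | hX
      · exact mem_union_left _ hwX
      · exact mem_union_right _ (mem_filter.2 ⟨mem_univ _, X, hX, hwX⟩)
    have h2 := (card_le_card h1).trans (card_union_le _ _)
    have h3 := h U (by simp)
    have h4 := ih fun X hX => h X (by simp [hX])
    rw [List.length_cons, Nat.succ_mul]
    omega

/-- Pseudorandom graphs with linear minimum degree contain powers of Hamilton cycles, given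
connecting paths and absorbing gadgets. -/
theorem containsHamiltonCyclePower_of_psr {k τ L : ℕ} (hconn : HasConnections.{u} k τ L)
    (hgad : HasGadgets.{u} k τ) (hk : 2 ≤ k) (hτ : 2 * k ≤ τ + 1) (hkL : k ≤ L) {β : ℝ}
    (hβ : 0 < β) :
    ∃ γ : ℝ, 0 < γ ∧ ∀ (V : Type u) [Fintype V] (G : SimpleGraph V) (p : ℝ), Psr G k τ p γ →
      (∀ v, β * (p * order V) ≤ (nb G univ v).card) → 3 ≤ Fintype.card V →
      ContainsHamiltonCyclePower G k := by
  obtain ⟨σ, hσ⟩ : ∃ σ : ℝ, σ = 1 / (2 * (2 * L + 3 : ℕ)) := ⟨_, rfl⟩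
  have hσ0 : 0 < σ := by rw [hσ]; positivity
  obtain ⟨ρ, hρ, HA⟩ := exists_absorbing_chain hconn hgad hk hτ hkL hσ0
  -- The covering chain need not exhaust its connecting sets, so these are shrunk to size about
  -- `κn`. The leftover `(Lκ + c₁)n`, times the cost `2k + 1 + L` of covering one vertex, must fit
  -- into the reservoir.
  obtain ⟨κ, hκ, g1, g2⟩ := exists_pos_le₂ hσ0
    (by positivity : 0 < ρ / (8 * (L + 1) * (2 * k + 1 + L)))
  have hκρ : (L + 1) * κ * (2 * k + 1 + L) ≤ ρ / 8 := by
    rw [le_div_iff₀ (by positivity)] at g2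
    linarith
  have hκρ' : κ ≤ ρ := by
    have : κ * 1 ≤ κ * ((L + 1) * (2 * k + 1 + L)) := by
      gcongr
      have h1 : (0:ℝ) ≤ L := by positivity
      have h2 : (0:ℝ) ≤ k := by positivity
      nlinarith [mul_nonneg h1 h2]
    linarith
  obtain ⟨c₁, hc₁, g3, g4⟩ := exists_pos_le₂ (by positivity : 0 < κ / 16)
    (by positivity : 0 < β / 4)
  obtain ⟨c'₁, hc'₁, H₁⟩ := HA β c₁ hc₁ (by linarith) (by linarith) (by linarith)
  obtain ⟨c'₂, hc'₂, H₂⟩ := exists_covering_chain hconn hk hτ hkL hc₁ (σ := σ) (κ := κ)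
    (by linarith) g1 hρ
  obtain ⟨c'₃, hc'₃, H₃⟩ := exists_finish hconn hk hτ hkL hc₁ (ρ := ρ) (by linarith)
  obtain ⟨c, hc, e1, e2, e3⟩ := exists_pos_le₃ hc'₁ hc'₂ hc'₃
  obtain ⟨γ₁, hγ₁, H₁⟩ := H₁ c hc e1
  obtain ⟨γ₂, hγ₂, H₂⟩ := H₂ c hc e2
  obtain ⟨γ₃, hγ₃, H₃⟩ := H₃ c hc e3
  obtain ⟨γ', hγ', f1, f2, f3⟩ := exists_pos_le₃ hγ₁ hγ₂ hγ₃
  obtain ⟨γ, hγ, f4, f5, f6⟩ := exists_pos_le₃ hγ'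
    (by positivity : 0 < κ / 2 / ((1 : ℕ) + 1)) (by positivity : 0 < (1:ℝ) / ((2 * L + 3 : ℕ) + 1))
  refine ⟨γ, hγ, ?_⟩
  intro V _ G p h hdeg hV
  have hn := h.order_pos
  have hκn : 1 ≤ κ / 2 * order V := by
    simpa using h.nat_le (by positivity) f5 (Nat.zero_le k)
  have hLn : ((2 * L + 3 : ℕ) : ℝ) ≤ order V := by
    simpa using h.nat_le one_pos f6 (Nat.zero_le k)
  have hcκ : 16 * (c₁ * order V) ≤ κ * order V := by
    have : 16 * c₁ ≤ κ := by linarith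
    nlinarith
  have hκσ : κ * order V ≤ σ * order V := by gcongr
  obtain ⟨P, hP, hPd, hPc⟩ := exists_disjoint_list (univ : Finset V) (m := 2 * L + 3) (by omega)
    hLn le_rfl
  have hPσ : ∀ X ∈ P, σ * order V ≤ X.card := fun X hX => by
    refine le_trans (le_of_eq ?_) (hPc X hX).2
    rw [hσ]
    ring
  obtain ⟨T, Y, A, P', rfl⟩ : ∃ a b c P', P = a :: b :: c :: P' := by
    match P, hP with
    | a :: b :: c :: P', _ => exact ⟨a, b, c, P', rfl⟩
  simp only [List.length_cons] at hP
  obtain ⟨K₁, K', rfl, hK₁, hK'⟩ : ∃ K₁ K', P' = K₁ ++ K' ∧ K₁.length = L ∧ K'.length = L :=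
    ⟨P'.take L, P'.drop L, (List.take_append_drop _ _).symm, by simp; omega, by simp; omega⟩
  set r := ⌊κ * order V⌋₊ with hr
  have hr1 : (r : ℝ) ≤ κ * order V := Nat.floor_le (by positivity)
  have hr2 : κ / 2 * order V ≤ r := by
    have h1 := (Nat.lt_floor_add_one (κ * order V)).le
    rw [← hr] at h1
    linarith
  obtain ⟨f, hf, hfc⟩ := exists_map_subset_card K' r fun U hU => by
    have h1 := hPσ U (by simp [hU])
    have h2 : (r : ℝ) ≤ U.card := by linarith
    exact_mod_cast h2
  have hdT := List.pairwise_cons.1 hPd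
  have hdY := List.pairwise_cons.1 hdT.2
  have hdA := List.pairwise_cons.1 hdY.2
  have hdK := List.pairwise_append.1 hdA.2
  have hK₂d : (K'.map f).Pairwise Disjoint := by
    rw [List.pairwise_map]
    exact hdK.2.1.imp fun hUU => disjoint_of_subset_left (hf _) (disjoint_of_subset_right (hf _) hUU)
  have hd : (T :: Y :: A :: (K₁ ++ K'.map f)).Pairwise Disjoint := by
    have key : ∀ X : Finset V, (∀ U ∈ K', Disjoint X U) → ∀ U ∈ K'.map f, Disjoint X U := by
      intro X hX U hU
      obtain ⟨U', hU', rfl⟩ := List.mem_map.1 hU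
      exact disjoint_of_subset_right (hf _) (hX U' hU')
    have hT := key T fun U hU => hdT.1 U (by simp [hU])
    have hY := key Y fun U hU => hdY.1 U (by simp [hU])
    have hA := key A fun U hU => hdA.1 U (by simp [hU])
    refine List.pairwise_cons.2 ⟨fun X hX => ?_, List.pairwise_cons.2 ⟨fun X hX => ?_,
      List.pairwise_cons.2 ⟨fun X hX => ?_, List.pairwise_append.2 ⟨hdK.1, hK₂d, fun X hX =>
        key X (hdK.2.2 X hX)⟩⟩⟩⟩
    · by_cases hX' : X ∈ K'.map f
      · exact hT X hX'
      · exact hdT.1 X (by simp only [List.mem_cons, List.mem_append] at hX ⊢; tauto)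
    · by_cases hX' : X ∈ K'.map f
      · exact hY X hX'
      · exact hdY.1 X (by simp only [List.mem_cons, List.mem_append] at hX ⊢; tauto)
    · by_cases hX' : X ∈ K'.map f
      · exact hA X hX'
      · exact hdA.1 X (by simp only [List.mem_append] at hX ⊢; tauto)
  have hK₂ : (K'.map f).length = L := by simpa using hK'
  have hK₂r : ∀ U ∈ K'.map f, U.card = r := fun U hU => by
    obtain ⟨U', hU', rfl⟩ := List.mem_map.1 hU
    exact hfc U' hU'
  have hK₂c : ∀ U ∈ K'.map f, κ / 2 * order V ≤ U.card := fun U hU => by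
    rw [hK₂r U hU]
    exact hr2
  obtain ⟨K₂, hK₂e⟩ : ∃ K₂, K₂ = K'.map f := ⟨_, rfl⟩
  rw [← hK₂e] at hK₂ hK₂c hd hK₂d hK₂r
  have hc₁n : 0 < c₁ * order V := by positivity
  obtain ⟨S, R, S₁, RC, RC₂, RK, E, x, y, hch, hRK, hE, hRd, hRX, hxE, hS₁, hSS₁, hYdeg⟩ :=
    H₁ V G p (h.mono (f4.trans f1)) T Y A K₁ K₂ hdeg hK₁ hK₂ hd (hPσ T (by simp))
      (hPσ Y (by simp)) (hPσ A (by simp)) (fun U hU => hPσ U (by simp [hU]))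
      (fun U hU => by linarith [hK₂c U hU])
  obtain ⟨S₂, y₂, hfl, hSS₂, hyE, hRdeg, hcov⟩ := H₂ V G p (h.mono (f4.trans f2)) K₂ E Y RC₂ S R S₁
    x y hK₂ hE hK₂d (hPσ Y (by simp)) (hRX RC₂ (by simp)).2 hK₂c (fun U hU => by
      have h1 := (hRX U (by simp [hU])).2
      have h2 : κ * order V ≤ ρ * order V := by gcongr
      linarith) hch hS₁ hSS₁ hYdeg
  refine H₃ V G p (h.mono (f4.trans f3)) RC RC₂ RK E S₂ R x y₂ hRK hE hRd hRX hfl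
    (fun U hU => ⟨hxE U hU, hyE U hU⟩) ?_ hRdeg hV
  have h1 := card_filter_inSome_le K₂ r fun U hU => (hK₂r U hU).le
  have h2 : univ \ S₂ ⊆ univ.filter (InSome K₂) ∪ (univ.filter (fun w => ¬ InSome K₂ w)) \ S₂ := by
    intro w hw
    by_cases hwK : InSome K₂ w
    · exact mem_union_left _ (mem_filter.2 ⟨mem_univ _, hwK⟩)
    · exact mem_union_right _ (mem_sdiff.2 ⟨mem_filter.2 ⟨mem_univ _, hwK⟩, (mem_sdiff.1 hw).2⟩)
  have h3 : ((univ \ S₂).card : ℝ) ≤ (univ.filter (InSome K₂)).card +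
      ((univ.filter (fun w => ¬ InSome K₂ w)) \ S₂).card := by
    exact_mod_cast (card_le_card h2).trans (card_union_le _ _)
  have h4 : ((univ.filter (InSome K₂)).card : ℝ) ≤ L * r := by
    rw [← hK₂]
    exact_mod_cast h1
  have h5 : (L : ℝ) * r ≤ L * (κ * order V) := by gcongr
  have h6 : ((univ \ S₂).card : ℝ) ≤ (L + 1) * κ * order V := by linarith
  calc ((univ \ S₂).card : ℝ) * (2 * k + 1 + L)
      ≤ (L + 1) * κ * order V * (2 * k + 1 + L) := by gcongr
    _ = (L + 1) * κ * (2 * k + 1 + L) * order V := by ring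
    _ ≤ ρ / 8 * order V := by gcongr
    _ ≤ ρ / 4 * order V := by gcongr; norm_num

end

/-! ### From jumbledness to pseudorandomness, and the theorem -/

section

theorem card_interedges_eq {V : Type u} (G : SimpleGraph V) [inst : DecidableRel G.Adj]
    (A B : Finset V) : (G.interedges A B).card = ∑ a ∈ A, (nb G B a).card := by
  rw [SimpleGraph.interedges, Rel.interedges, card_filter, sum_product]
  refine sum_congr rfl fun a _ => ?_
  rw [nb, card_filter]
  refine sum_congr rfl fun b _ => ?_
  split_ifs <;> rfl

theorem containsHamiltonCyclePower_of_complete {V : Type u} [Fintype V] {G : SimpleGraph V}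
    (h : ∀ u v, u ≠ v → G.Adj u v) (k : ℕ) (hV : 3 ≤ Fintype.card V) :
    ContainsHamiltonCyclePower G k := by
  refine ⟨hV, ⟨⟨⟨(Fintype.equivFin V).symm, fun {a b} hab => h _ _ ?_⟩, ?_⟩⟩⟩
  · exact (Fintype.equivFin V).symm.injective.ne hab.1
  · exact (Fintype.equivFin V).symm.injective

/-- A jumbled graph with linear minimum degree that is not complete is pseudorandom. -/
theorem psr_of_jumbled {V : Type u} [Fintype V] {G : SimpleGraph V} {k τ : ℕ}
    {β γ ε p s : ℝ} (hkτ : k ≤ τ + 1) (hβ : 0 < β) (hε : 0 < ε) (h1 : ε ≤ 1)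
    (h2 : ε ≤ γ * (β / 4)) (h3 : ε ≤ γ / 2 ^ (k + 1)) (hp : 0 < p) (hp1 : p < 1)
    (hs : (τ : ℝ) + 2 ≤ 2 * s) (hV : 0 < Fintype.card V)
    (hdeg : ∀ v, β * (p * order V) ≤ (nb G univ v).card) (hG : ¬ ∀ u v, u ≠ v → G.Adj u v)
    (hj : ∀ A B : Finset V, Disjoint A B →
      |(∑ a ∈ A, ((nb G B a).card : ℝ)) - p * A.card * B.card| ≤
        ε * p ^ s * order V * √((A.card : ℝ) * B.card)) :
    Psr G k τ p γ := by
  have hn : 0 < order V := Nat.cast_pos.2 hV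
  have hγ : 0 < γ := by
    have := hε.trans_le h3
    have h2k : (0:ℝ) < 2 ^ (k + 1) := by positivity
    exact (div_pos_iff_of_pos_right h2k).1 this
  have hεγ : ε ≤ γ := h3.trans (div_le_self hγ.le (one_le_pow₀ (by norm_num)))
  have hps : (p ^ s) ^ 2 ≤ p ^ (τ + 2) := by
    rw [← Real.rpow_natCast, ← Real.rpow_mul hp.le, ← Real.rpow_natCast]
    refine Real.rpow_le_rpow_of_exponent_ge hp hp1.le ?_
    push_cast
    linarith
  have hjum : ∀ A B : Finset V, Disjoint A B →
      ((∑ a ∈ A, ((nb G B a).card : ℝ)) - p * A.card * B.card) ^ 2 ≤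
        ε ^ 2 * p ^ (τ + 2) * order V ^ 2 * (A.card * B.card) := by
    intro A B hAB
    have h4 := hj A B hAB
    rw [← sq_abs]
    calc _ ≤ (ε * p ^ s * order V * √((A.card : ℝ) * B.card)) ^ 2 := by gcongr
      _ = ε ^ 2 * (p ^ s) ^ 2 * order V ^ 2 * (A.card * B.card) := by
        rw [mul_pow, Real.sq_sqrt (by positivity)]
        ring
      _ ≤ _ := by gcongr
  refine ⟨hp, hp1.le, ?_, fun A B hAB => (hjum A B hAB).trans ?_⟩
  · push Not at hG
    obtain ⟨u, v, huv, hadj⟩ := hG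
    rcases le_or_gt p (1 / 2) with hp2 | hp2
    · have h5 := hjum {u} (nb G univ u) (by
        rw [disjoint_singleton_left]
        simp [nb])
      have h6 : nb G (nb G univ u) u = nb G univ u := by
        ext w
        simp [nb]
      rw [sum_singleton, h6, card_singleton] at h5
      set d : ℝ := ((nb G univ u).card : ℝ) with hd
      have hdu := hdeg u
      have hd0 : 0 < d := lt_of_lt_of_le (by positivity) hdu
      push_cast at h5
      have h7 : (1 / 2 * d) ^ 2 ≤ (d - p * 1 * d) ^ 2 := by
        have : 1 / 2 * d ≤ d - p * 1 * d := by nlinarith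
        gcongr
      have h8 : d / 4 ≤ ε ^ 2 * p ^ (τ + 2) * order V ^ 2 := by
        refine le_of_mul_le_mul_right ?_ hd0
        linarith
      have h9 : p ^ (τ + 2) ≤ p * p ^ k := by
        rw [← pow_succ']
        exact pow_le_pow_of_le_one hp.le hp1.le (by omega)
      have h10 : ε ^ 2 ≤ γ * (β / 4) := by nlinarith
      have h11 : ε ^ 2 * p ^ (τ + 2) * order V ^ 2 ≤ γ * (β / 4) * (p * p ^ k) * order V ^ 2 := by
        gcongr
      have hq : 0 < β / 4 * (p * order V) := by positivity
      refine le_of_mul_le_mul_right (a := β / 4 * (p * order V)) ?_ hq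
      calc 1 * (β / 4 * (p * order V)) ≤ d / 4 := by linarith
        _ ≤ _ := h8.trans h11
        _ = _ := by ring
    -- A non-adjacent pair has no edge where `p > 1/2` is expected, which forces `εn` to be large.
    -- Complete graphs do escape this, and are treated separately.
    · have h5 := hj {u} {v} (by simpa using huv)
      have h6 : nb G {v} u = ∅ := by
        ext w
        simp only [nb, mem_filter, mem_singleton, notMem_empty, iff_false, not_and]
        rintro rfl
        exact hadj
      simp only [sum_singleton, h6, card_empty, card_singleton] at h5
      norm_num at h5
      rw [abs_of_pos hp] at h5
      have hsp : p ^ s ≤ 1 := Real.rpow_le_one hp.le hp1.le (by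
        have : (0:ℝ) ≤ τ := by positivity
        linarith)
      have h7 : ε * p ^ s * order V ≤ γ / 2 ^ (k + 1) * 1 * order V := by gcongr
      have h8 : (1 / 2 : ℝ) ^ k ≤ p ^ k := by gcongr
      calc (1:ℝ) ≤ 2 * (γ / 2 ^ (k + 1) * 1 * order V) := by linarith
        _ = γ * ((1 / 2) ^ k * order V) := by
          rw [pow_succ, one_div, inv_pow]
          field_simp
        _ ≤ _ := by gcongr
  · have : ε ^ 2 ≤ γ := by nlinarith
    gcongr

/-- Small `n` needs no separate treatment: non-completeness already makes `p^k n` large, and a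
complete graph contains every power. -/
theorem exists_eps {k τ L : ℕ} (hconn : HasConnections.{u} k τ L) (hgad : HasGadgets.{u} k τ)
    (hk : 2 ≤ k) (hτ : 2 * k ≤ τ + 1) (hkL : k ≤ L) {β : ℝ} (hβ : 0 < β) :
    ∃ ε₀ : ℝ, 0 < ε₀ ∧ ∀ ε : ℝ, 0 < ε → ε ≤ ε₀ →
      ∀ (V : Type u) [Fintype V] (G : SimpleGraph V) [DecidableRel G.Adj] (p s : ℝ),
        3 ≤ Fintype.card V → 0 < p → p < 1 → β * p * Fintype.card V ≤ G.minDegree →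
        (τ : ℝ) + 2 ≤ 2 * s → IsJumbled G p (ε * p ^ s * Fintype.card V) →
        ContainsHamiltonCyclePower G k := by
  obtain ⟨γ, hγ, H⟩ := containsHamiltonCyclePower_of_psr hconn hgad hk hτ hkL hβ
  obtain ⟨ε₀, hε₀, h1, h2, h3⟩ := exists_pos_le₃ one_pos (by positivity : 0 < γ * (β / 4))
    (by positivity : 0 < γ / 2 ^ (k + 1))
  refine ⟨ε₀, hε₀, fun ε hε hεε V _ G _ p s hV hp hp1 hdeg hs hj => ?_⟩
  have hdeg' : ∀ v, β * (p * order V) ≤ (nb G univ v).card := by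
    intro v
    have h4 : G.degree v = (nb G univ v).card := by
      rw [← G.card_neighborFinset_eq_degree v]
      congr 1
      ext w
      simp [nb]
    rw [← h4, ← mul_assoc]
    exact hdeg.trans (by exact_mod_cast G.minDegree_le_degree v)
  by_cases hG : ∀ u v, u ≠ v → G.Adj u v
  · exact containsHamiltonCyclePower_of_complete hG k hV
  refine H V G p (psr_of_jumbled (by omega) hβ hε (hεε.trans h1) (hεε.trans h2) (hεε.trans h3) hp
    hp1 hs (by omega) hdeg' hG fun A B hAB => ?_) hdeg' hV
  have := hj A B hAB
  rw [card_interedges_eq] at this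
  exact_mod_cast this

end

end HamPow

theorem mainTheorem2 (k : ℕ) (hk : 2 ≤ k) (β : ℝ) (hβ : 0 < β) :
    ∃ ε : ℝ, 0 < ε ∧
      ∀ (V : Type*) [Fintype V] (G : SimpleGraph V) [DecidableRel G.Adj] (n : ℕ) (p : ℝ),
        Fintype.card V = n → 3 ≤ n → 0 < p → p < 1 →
        β * p * n ≤ (G.minDegree : ℝ) →
          (IsJumbled G p (ε * p ^ (5 / 2 : ℝ) * n) → ContainsHamiltonCyclePower G 2) ∧
          (IsJumbled G p (ε * p ^ (3 * (k : ℝ) / 2) * n) → ContainsHamiltonCyclePower G k) := by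
  have hconn := hasReach_two.hasConnections (by norm_num)
  obtain ⟨ε₁, hε₁, H₁⟩ := exists_eps hconn (hasGadgets_two hconn) le_rfl (by norm_num)
    (by norm_num) hβ
  rcases hk.eq_or_lt with rfl | hk3
  -- For `k = 2` the exponent 3 in the second statement is stronger than 5/2, so the argument for
  -- squares gives both.
  · refine ⟨ε₁, hε₁, ?_⟩
    rintro V _ G _ n p rfl hn hp hp1 hdeg
    refine ⟨H₁ ε₁ hε₁ le_rfl V G p _ hn hp hp1 hdeg (by norm_num),
      H₁ ε₁ hε₁ le_rfl V G p _ hn hp hp1 hdeg (by norm_num)⟩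
  -- `τ + 2 = 3k` matches the exponent 3k/2 exactly and is the least value `hasReach_of_le` permits.
  · obtain ⟨ε₂, hε₂, H₂⟩ := exists_eps (k := k) (τ := 3 * k - 2)
      ((hasReach_of_le (by omega) (by omega) (by omega)).hasConnections (by omega))
      (hasGadgets_of_three_le hk3 (by omega)) hk (by omega) (by omega) hβ
    obtain ⟨ε, hε, h1, h2⟩ := exists_pos_le₂ hε₁ hε₂
    refine ⟨ε, hε, ?_⟩
    rintro V _ G _ n p rfl hn hp hp1 hdeg
    refine ⟨H₁ ε hε h1 V G p _ hn hp hp1 hdeg (by norm_num),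
      H₂ ε hε h2 V G p _ hn hp hp1 hdeg ?_⟩
    push_cast [(by omega : 2 ≤ 3 * k)]
    linarith
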